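/- Let $p,q\in\mathbb C$ with $0<|p|,|q|<1$. Put $(z;q)_\infty=\prod_{j\ge 0}(1-zq^j)$, $(z;p,q)_\infty=\prod_{j,k\ge 0}(1-zp^jq^k)$, and let $$\Gamma(z;p,q)=\frac{(pqz^{-1};p,q)_\infty}{(z;p,q)_\infty}$$ be the elliptic gamma function; write $\Gamma(z)=\Gamma(z;p,q)$, $\Gamma(a,b)=\Gamma(a)\Gamma(b)$, $\Gamma(tz^{\pm1})=\Gamma(tz)\Gamma(tz^{-1})$, $\Gamma(z^{\pm2})=\Gamma(z^2)\Gamma(z^{-2})$. For $t=(t_1,\dots,t_8)\in\mathbb C^8$ with $|t_j|<1$ for all $j$ and $\prod_{j=1}^8t_j=p^2q^2$, define the elliptic hypergeometric function $$V(t)=V(t_1,\dots,t_8)=\frac{(p;p)_\infty(q;q)_\infty}{4\pi i}\int_{\mathbb T}\frac{\prod_{j=1}^8\Gamma(t_jz^{\pm1})}{\Gamma(z^{\pm2})}\,\frac{dz}{z},$$ where $\mathbb T$ is the positively oriented unit circle. For every such $t$ the integrand is integrable on $\mathbb T$, and the following hold. 1. Let $\rho$ be either square root of $t_1t_2t_3t_4/(pq)=pq/(t_5t_6t_7t_8)$,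 and put $s_j=\rho^{-1}t_j$ for $1\le j\le 4$ and $s_j=\rho t_j$ for $5\le j\le 8$. If $|s_j|<1$ for all $j$, then $$V(t)=\prod_{1\le j<k\le4}\Gamma(t_jt_k,\,t_{j+4}t_{k+4})\;V(s).$$ 2. Let $T=t_1t_2t_3t_4$ and $U=t_5t_6t_7t_8$, and choose square roots $T^{1/2},U^{1/2}$ with $T^{1/2}U^{1/2}=pq$. If $|T|^{1/2}<|t_j|$ and $|U|^{1/2}<|t_{j+4}|$ for $1\le j\le 4$, then $$V(t)=\prod_{j,k=1}^4\Gamma(t_jt_{k+4})\;V\big(T^{1/2}/t_1,\dots,T^{1/2}/t_4,\,U^{1/2}/t_5,\dots,U^{1/2}/t_8\big).$$ 3. If $|pq|^{1/2}<|t_j|$ for all $j$, then, for either choice of the square root $\sqrt{pq}$, $$V(t)=\prod_{1\le j<k\le8}\Gamma(t_jt_k)\;V\big(\sqrt{pq}/t_1,\dots,\sqrt{pq}/t_8\big).$$ -/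

import Mathlib

noncomputable section

namespace EllipticV

/-- The infinite product `(z; q)_∞ = ∏_{j ≥ 0} (1 - z q^j)`. -/
def qPoch (z q : ℂ) : ℂ := ∏' j : ℕ, (1 - z * q ^ j)

/-- The double infinite product `(z; p, q)_∞ = ∏_{j, k ≥ 0} (1 - z p^j q^k)`. -/
def pqPoch (z p q : ℂ) : ℂ := ∏' n : ℕ × ℕ, (1 - z * p ^ n.1 * q ^ n.2)

/-- The product defining `(z; q)_∞` converges for `|q| < 1`. -/
theorem multipliable_qPoch (z : ℂ) {q : ℂ} (hq : ‖q‖ < 1) :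
    Multipliable fun j : ℕ => 1 - z * q ^ j := by
  have h : Summable fun j : ℕ => ‖-(z * q ^ j)‖ := by
    simpa only [norm_neg, norm_mul, norm_pow] using
      (summable_geometric_of_lt_one (norm_nonneg q) hq).mul_left ‖z‖
  simpa only [sub_eq_add_neg] using multipliable_one_add_of_summable h

/-- The product defining `(z; p, q)_∞` converges for `|p|, |q| < 1`. -/
theorem multipliable_pqPoch (z : ℂ) {p q : ℂ} (hp : ‖p‖ < 1) (hq : ‖q‖ < 1) :
    Multipliable fun n : ℕ × ℕ => 1 - z * p ^ n.1 * q ^ n.2 := by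
  have h : Summable fun n : ℕ × ℕ => ‖-(z * p ^ n.1 * q ^ n.2)‖ := by
    have := ((summable_geometric_of_lt_one (norm_nonneg p) hp).mul_of_nonneg
      (summable_geometric_of_lt_one (norm_nonneg q) hq)
      (fun _ => by positivity) (fun _ => by positivity)).mul_left ‖z‖
    simpa only [norm_neg, norm_mul, norm_pow, mul_assoc] using this
  simpa only [sub_eq_add_neg] using multipliable_one_add_of_summable h

/-- The elliptic gamma function `Γ(z; p, q) = (p q z⁻¹; p, q)_∞ / (z; p, q)_∞`. -/
def ellGamma (p q z : ℂ) : ℂ := pqPoch (p * q * z⁻¹) p q / pqPoch z p q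

/-- `∏_{j=1}^8 Γ(t_j z^{±1}; p, q) / Γ(z^{±2}; p, q) · z⁻¹`, the function integrated against `dz`
in the definition of `V`. -/
def vIntegrand (p q : ℂ) (t : Fin 8 → ℂ) (z : ℂ) : ℂ :=
  (∏ j, ellGamma p q (t j * z) * ellGamma p q (t j * z⁻¹)) /
    (ellGamma p q (z ^ 2) * ellGamma p q ((z ^ 2)⁻¹)) * z⁻¹

/-- `κ = (p; p)_∞ (q; q)_∞ / (4 π i)`. -/
def kappa (p q : ℂ) : ℂ := qPoch p p * qPoch q q / (4 * Real.pi * Complex.I)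

/-- The elliptic hypergeometric function
`V(t; p, q) = κ ∫_𝕋 ∏_{j=1}^8 Γ(t_j z^{±1}; p, q) / Γ(z^{±2}; p, q) dz / z` (for `|t_j| < 1`),
with the positively oriented unit circle `𝕋`. -/
def V (p q : ℂ) (t : Fin 8 → ℂ) : ℂ :=
  kappa p q * ∮ z in C(0, 1), vIntegrand p q t z

end EllipticV

end

/-!
On the unit circle `1 / Γ(z^{±2})` equals `θ(z²; p) θ(z⁻²; q)` (`inv_ellGamma_mul_inv`), so that `V`
is, up to the factor `(p; p)_∞ (q; q)_∞ / 2`, the average over the circle of a continuous function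
which depends holomorphically on the parameters (`V_eq_ellInt`, `differentiableOn_ellInt`). All
transformations come from the elliptic beta integral (`ellBeta`), the evaluation of the analogous
integral with six parameters of product `p q`.

The beta integral rests on a theta function identity (`thetaDefect_eq_zero`), which holds because a
theta function of degree six with seven inequivalent zeros vanishes (`eq_zero_of_theta_zeros`). It
writes a combination of two integrands, in which one of two parameters has been multiplied by `q`,
as `G(z) + G(1/z)` with a function `G` such that `G(1/(q z)) = -G(z)`; shifting the contour shows
that the average of `G` is zero, and this yields a contiguity relation (`ellInt_contiguous`). Hence
the ratio of the integral to its expected value is invariant under multiplication of a parameter by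
`q`. When the annulus in which this parameter can move is wider than one period, the maximum
principle shows that the ratio does not depend on the parameter at all (`betaRatio_eq`). Two
parameters may therefore be moved to `±i r` with `r → 1`. Their factors in the integrand then form a
Poisson kernel concentrating at `z = ±i`, and the constant can be read off from the limit
(`ellBeta_of_norm_lt`). The remaining parameters are reached by analytic continuation along lines in
the logarithms of the parameters (`eq_of_eventuallyEq_of_lines`).

For `|ρ| < 1` the first transformation is Fubini's theorem: in a double integral with the factors
`Γ(ρ z^{±1} w^{±1})` either of the two integrations is an elliptic beta integral
(`pairGamma_mul_ellInt`). Exchanging the two groups of parameters gives `|ρ| > 1`, and continuity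
gives `|ρ| = 1` (`ellInt_transform`). The second transformation is the composition of two instances
of the first, and the third one the composition of the second with the first
(`ellInt_transform_mixed`, `ellInt_transform_all`). The intermediate integrals exist only if their
parameters are smaller than `1` in modulus, which is the case when all `tⱼ` are close to a common
value; analytic continuation in the logarithms of the parameters removes this restriction
(`ellInt_eq_of_eventually`). The sign of the square roots is immaterial, since the integral is
invariant under `t ↦ -t` (`ellInt_neg`).
-/

namespace EllipticV

open Set Filter Topology Complex

section

/-! ### Infinite products -/

theorem summable_norm_geometric_pair (z : ℂ) {p q : ℂ} (hp : ‖p‖ < 1) (hq : ‖q‖ < 1) :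
    Summable fun n : ℕ × ℕ => ‖-(z * p ^ n.1 * q ^ n.2)‖ := by
  have := ((summable_geometric_of_lt_one (norm_nonneg p) hp).mul_of_nonneg
    (summable_geometric_of_lt_one (norm_nonneg q) hq)
    (fun _ => by positivity) (fun _ => by positivity)).mul_left ‖z‖
  simpa only [norm_neg, norm_mul, norm_pow, mul_assoc] using this

theorem summable_norm_geometric (z : ℂ) {q : ℂ} (hq : ‖q‖ < 1) :
    Summable fun j : ℕ => ‖-(z * q ^ j)‖ := by
  simpa only [norm_neg, norm_mul, norm_pow] using
    (summable_geometric_of_lt_one (norm_nonneg q) hq).mul_left ‖z‖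

/-- A product `∏ (1 - z aᵢ)` with `∑ ‖aᵢ‖ < ∞` is an entire function of `z`. -/
theorem differentiable_tprod_one_sub_mul {ι : Type*} {a : ι → ℂ} (ha : Summable fun i => ‖a i‖) :
    Differentiable ℂ fun z : ℂ => ∏' i, (1 - z * a i) := by
  intro z
  have h : HasProdLocallyUniformlyOn (fun i x => 1 + -(x * a i))
      (fun x => ∏' i, (1 + -(x * a i))) (Metric.ball (0 : ℂ) (‖z‖ + 1)) := by
    refine Summable.hasProdLocallyUniformlyOn_one_add Metric.isOpen_ball
      (ha.mul_left (‖z‖ + 1)) (Eventually.of_forall fun i x hx => ?_) (fun i => by fun_prop)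
    rw [norm_neg, norm_mul]
    have : ‖x‖ < ‖z‖ + 1 := by simpa using hx
    gcongr
  have h2 := (hasProdLocallyUniformlyOn_iff_tendstoLocallyUniformlyOn.mp h).differentiableOn
    (Eventually.of_forall fun s => by fun_prop) Metric.isOpen_ball
  simpa only [sub_eq_add_neg] using
    h2.differentiableAt (Metric.isOpen_ball.mem_nhds (by simp))

theorem differentiable_qPoch {q : ℂ} (hq : ‖q‖ < 1) : Differentiable ℂ fun z => qPoch z q :=
  differentiable_tprod_one_sub_mul (by simpa using summable_norm_geometric 1 hq)

theorem differentiable_pqPoch {p q : ℂ} (hp : ‖p‖ < 1) (hq : ‖q‖ < 1) :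
    Differentiable ℂ fun z => pqPoch z p q := by
  have := differentiable_tprod_one_sub_mul (a := fun n : ℕ × ℕ => p ^ n.1 * q ^ n.2)
    (by simpa using summable_norm_geometric_pair 1 hp hq)
  simpa only [pqPoch, mul_assoc] using this

theorem qPoch_ne_zero {z q : ℂ} (hq : ‖q‖ < 1) (h : ∀ j : ℕ, z * q ^ j ≠ 1) : qPoch z q ≠ 0 := by
  have := tprod_one_add_ne_zero_of_summable (f := fun j : ℕ => -(z * q ^ j))
    (fun j => by rw [← sub_eq_add_neg, sub_ne_zero]; exact (h j).symm) (summable_norm_geometric z hq)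
  simpa only [qPoch, sub_eq_add_neg] using this

theorem pqPoch_ne_zero {z p q : ℂ} (hp : ‖p‖ < 1) (hq : ‖q‖ < 1)
    (h : ∀ j k : ℕ, z * p ^ j * q ^ k ≠ 1) : pqPoch z p q ≠ 0 := by
  have := tprod_one_add_ne_zero_of_summable (f := fun n : ℕ × ℕ => -(z * p ^ n.1 * q ^ n.2))
    (fun n => by rw [← sub_eq_add_neg, sub_ne_zero]; exact (h n.1 n.2).symm)
    (summable_norm_geometric_pair z hp hq)
  simpa only [pqPoch, sub_eq_add_neg] using this

theorem norm_mul_pow_lt_one {z q : ℂ} (hq : ‖q‖ < 1) (hz : ‖z‖ < 1) (j : ℕ) : ‖z * q ^ j‖ < 1 := by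
  rw [norm_mul, norm_pow]
  exact (mul_le_of_le_one_right (norm_nonneg _) (pow_le_one₀ (norm_nonneg _) hq.le)).trans_lt hz

theorem qPoch_ne_zero_of_norm_lt_one {z q : ℂ} (hq : ‖q‖ < 1) (hz : ‖z‖ < 1) :
    qPoch z q ≠ 0 :=
  qPoch_ne_zero hq fun j h => by simpa [h] using norm_mul_pow_lt_one hq hz j

theorem pqPoch_ne_zero_of_norm_lt_one {z p q : ℂ} (hp : ‖p‖ < 1) (hq : ‖q‖ < 1) (hz : ‖z‖ < 1) :
    pqPoch z p q ≠ 0 :=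
  pqPoch_ne_zero hp hq fun j k h => by
    simpa [h] using norm_mul_pow_lt_one hq (norm_mul_pow_lt_one hp hz j) k

theorem qPoch_eq_mul (z : ℂ) {q : ℂ} (hq : ‖q‖ < 1) :
    qPoch z q = (1 - z) * qPoch (q * z) q := by
  have h : (fun j : ℕ => 1 - z * q ^ (j + 1)) = fun j : ℕ => 1 - q * z * q ^ j := by
    ext j; ring
  have := tprod_eq_zero_mul' (f := fun j : ℕ => 1 - z * q ^ j)
    (by rw [h]; exact multipliable_qPoch _ hq)
  simpa [qPoch, h] using this

theorem pqPoch_comm (z p q : ℂ) : pqPoch z p q = pqPoch z q p := by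
  rw [pqPoch, pqPoch, ← (Equiv.prodComm ℕ ℕ).tprod_eq]
  refine tprod_congr fun n => ?_
  simp only [Equiv.prodComm_apply, Prod.fst_swap, Prod.snd_swap]
  ring

theorem pqPoch_eq_mul_left (z : ℂ) {p q : ℂ} (hp : ‖p‖ < 1) (hq : ‖q‖ < 1) :
    pqPoch z p q = qPoch z q * pqPoch (p * z) p q := by
  have key : ∀ w : ℂ, HasProd (fun j : ℕ => qPoch (w * p ^ j) q) (pqPoch w p q) := fun w =>
    (multipliable_pqPoch w hp hq).hasProd.prod_fiberwise
      fun j => (multipliable_qPoch (w * p ^ j) hq).hasProd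
  have h : (fun j : ℕ => qPoch (z * p ^ (j + 1)) q) = fun j : ℕ => qPoch (p * z * p ^ j) q := by
    ext j; congr 1; ring
  have := tprod_eq_zero_mul' (f := fun j : ℕ => qPoch (z * p ^ j) q)
    (by rw [h]; exact (key (p * z)).multipliable)
  rw [h, (key z).tprod_eq, (key (p * z)).tprod_eq] at this
  simpa using this

theorem pqPoch_eq_mul_right (z : ℂ) {p q : ℂ} (hp : ‖p‖ < 1) (hq : ‖q‖ < 1) :
    pqPoch z p q = qPoch z p * pqPoch (q * z) p q := by
  rw [pqPoch_comm, pqPoch_eq_mul_left z hq hp, pqPoch_comm]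

/-! ### Theta functions -/

/-- The modified theta function `θ(z; p) = (z; p)_∞ (p / z; p)_∞`. -/
noncomputable def theta (p z : ℂ) : ℂ := qPoch z p * qPoch (p / z) p

theorem qPoch_one {q : ℂ} (hq : ‖q‖ < 1) : qPoch 1 q = 0 := by
  rw [qPoch_eq_mul 1 hq]; simp

theorem theta_one {p : ℂ} (hp : ‖p‖ < 1) : theta p 1 = 0 := by
  simp [theta, qPoch_one hp]

theorem theta_div (p : ℂ) (hp0 : p ≠ 0) {z : ℂ} (hz : z ≠ 0) : theta p (p / z) = theta p z := by
  have : p / (p / z) = z := by field_simp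
  rw [theta, theta, this, mul_comm]

theorem theta_inv {p z : ℂ} (hp : ‖p‖ < 1) (hz : z ≠ 0) : theta p z⁻¹ = -z⁻¹ * theta p z := by
  have h1 := qPoch_eq_mul z⁻¹ hp
  have h2 := qPoch_eq_mul z hp
  simp only [theta, div_inv_eq_mul]
  rw [h1, h2, ← div_eq_mul_inv]
  field_simp
  ring

theorem theta_mul {p z : ℂ} (hp0 : p ≠ 0) (hp : ‖p‖ < 1) (hz : z ≠ 0) :
    theta p (p * z) = -z⁻¹ * theta p z := by
  rw [← theta_inv hp hz, ← theta_div p hp0 (inv_ne_zero hz), div_inv_eq_mul]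

theorem theta_ne_zero {p z : ℂ} (hp : ‖p‖ < 1) (h1 : ∀ j : ℕ, z * p ^ j ≠ 1)
    (h2 : ∀ j : ℕ, p / z * p ^ j ≠ 1) : theta p z ≠ 0 :=
  mul_ne_zero (qPoch_ne_zero hp h1) (qPoch_ne_zero hp h2)

theorem theta_ne_zero_of_forall_zpow {p z : ℂ} (hp0 : p ≠ 0) (hp : ‖p‖ < 1) (hz : z ≠ 0)
    (h : ∀ k : ℤ, z ≠ p ^ k) : theta p z ≠ 0 := by
  refine theta_ne_zero hp (fun j hj => h (-j) ?_) (fun j hj => h (j + 1) ?_)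
  · rw [zpow_neg, zpow_natCast]
    exact eq_inv_of_mul_eq_one_left hj
  · rw [div_mul_eq_mul_div, div_eq_one_iff_eq hz] at hj
    rw [← hj, zpow_add₀ hp0, zpow_natCast, zpow_one, mul_comm]

theorem theta_zpow {p : ℂ} (hp0 : p ≠ 0) (hp : ‖p‖ < 1) (k : ℤ) : theta p (p ^ k) = 0 := by
  induction k using Int.induction_on with
  | zero => simpa using theta_one hp
  | succ i ih =>
    rw [zpow_add₀ hp0, zpow_one, mul_comm, theta_mul hp0 hp (zpow_ne_zero _ hp0), ih, mul_zero]
  | pred i ih =>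
    have h := theta_mul hp0 hp (zpow_ne_zero (-(i : ℤ) - 1) hp0)
    rw [← zpow_one_add₀ hp0, add_sub_cancel, ih] at h
    have := inv_ne_zero (zpow_ne_zero (-(i : ℤ) - 1) hp0)
    rcases mul_eq_zero.mp h.symm with h | h
    · exact absurd (neg_eq_zero.mp h) this
    · exact h

theorem differentiableAt_theta {p z : ℂ} (hp : ‖p‖ < 1) (hz : z ≠ 0) :
    DifferentiableAt ℂ (theta p) z :=
  (differentiable_qPoch hp z).mul
    ((differentiable_qPoch hp _).comp z ((differentiableAt_const p).div differentiableAt_id hz))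

/-- The zero of `θ` at `1` is simple. -/
theorem deriv_theta_one_ne_zero {p : ℂ} (hp : ‖p‖ < 1) : deriv (theta p) 1 ≠ 0 := by
  have h : theta p = fun z => (1 - z) * (qPoch (p * z) p * qPoch (p / z) p) := by
    ext z; rw [theta, qPoch_eq_mul z hp, mul_assoc]
  have hd : DifferentiableAt ℂ (fun z : ℂ => qPoch (p * z) p * qPoch (p / z) p) 1 :=
    ((differentiable_qPoch hp _).comp (1 : ℂ) (by fun_prop)).mul
      ((differentiable_qPoch hp _).comp (1 : ℂ)
        ((differentiableAt_const p).div differentiableAt_id one_ne_zero))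
  have h3 : HasDerivAt (theta p) (-1 * (qPoch (p * 1) p * qPoch (p / 1) p) +
      (1 - 1) * deriv (fun z : ℂ => qPoch (p * z) p * qPoch (p / z) p) 1) 1 := by
    rw [h]
    exact ((hasDerivAt_id (1 : ℂ)).const_sub 1).mul hd.hasDerivAt
  rw [h3.deriv]
  simpa using qPoch_ne_zero_of_norm_lt_one hp hp

/-- All zeros of `θ` are simple. -/
theorem deriv_theta_zpow_ne_zero {p : ℂ} (hp0 : p ≠ 0) (hp : ‖p‖ < 1) (k : ℤ) :
    deriv (theta p) (p ^ k) ≠ 0 := by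
  -- differentiating `θ(p z) = -z⁻¹ θ(z)` at a zero relates the derivatives at `p ^ k`, `p ^ (k + 1)`
  have key : ∀ k : ℤ, p * deriv (theta p) (p ^ (k + 1)) =
      -(p ^ k)⁻¹ * deriv (theta p) (p ^ k) := by
    intro k
    have hk := zpow_ne_zero k hp0
    have h1 : HasDerivAt (fun z => theta p (p * z)) (p * deriv (theta p) (p ^ (k + 1))) (p ^ k) := by
      have e : p ^ (k + 1) = p * p ^ k := by rw [zpow_add₀ hp0, zpow_one, mul_comm]
      have := (differentiableAt_theta (z := p * p ^ k) hp (mul_ne_zero hp0 hk)).hasDerivAt.comp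
        (p ^ k) ((hasDerivAt_id (p ^ k)).const_mul p)
      rw [e]
      simpa [mul_comm, Function.comp_def] using this
    have h2 : HasDerivAt (fun z => -z⁻¹ * theta p z)
        (-(p ^ k)⁻¹ * deriv (theta p) (p ^ k)) (p ^ k) := by
      have := ((hasDerivAt_inv hk).fun_neg).fun_mul (differentiableAt_theta hp hk).hasDerivAt
      simpa only [theta_zpow hp0 hp k, mul_zero, zero_add] using this
    refine h1.unique (h2.congr_of_eventuallyEq ?_)
    filter_upwards [isOpen_ne.mem_nhds hk] with z hz using theta_mul hp0 hp hz
  induction k using Int.induction_on with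
  | zero => simpa using deriv_theta_one_ne_zero hp
  | succ i ih =>
    intro h
    have := key i
    rw [h, mul_zero] at this
    exact mul_ne_zero (neg_ne_zero.mpr (inv_ne_zero (zpow_ne_zero _ hp0))) ih this.symm
  | pred i ih =>
    intro h
    have := key (-(i : ℤ) - 1)
    rw [h, mul_zero, sub_add_cancel] at this
    exact mul_ne_zero hp0 ih this

/-! ### The elliptic gamma function -/

theorem differentiableAt_ellGamma {p q : ℂ} (hp : ‖p‖ < 1) (hq : ‖q‖ < 1)
    {z : ℂ} (hz0 : z ≠ 0) (hz : ‖z‖ < 1) :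
    DifferentiableAt ℂ (ellGamma p q) z :=
  ((differentiable_pqPoch hp hq _).comp z ((differentiableAt_inv hz0).const_mul (p * q))).div
    (differentiable_pqPoch hp hq z) (pqPoch_ne_zero_of_norm_lt_one hp hq hz)

theorem ellGamma_ne_zero {p q : ℂ} (hp : ‖p‖ < 1) (hq : ‖q‖ < 1)
    {z : ℂ} (hz : ‖z‖ < 1) (hz' : ‖p * q‖ < ‖z‖) : ellGamma p q z ≠ 0 := by
  refine div_ne_zero (pqPoch_ne_zero_of_norm_lt_one hp hq ?_)
    (pqPoch_ne_zero_of_norm_lt_one hp hq hz)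
  rw [← div_eq_mul_inv, norm_div]
  exact (div_lt_one ((norm_nonneg _).trans_lt hz')).mpr hz'

/-- The reflection formula `Γ(x) Γ(p q / x) = 1`. -/
theorem ellGamma_mul_reflect {p q : ℂ} (hp : ‖p‖ < 1) (hq : ‖q‖ < 1)
    (hp0 : p ≠ 0) (hq0 : q ≠ 0) {x y : ℂ} (hx : ‖x‖ < 1) (hy : ‖y‖ < 1)
    (h : x * y = p * q) : ellGamma p q x * ellGamma p q y = 1 := by
  have hxy : x * y ≠ 0 := h ▸ mul_ne_zero hp0 hq0
  have hx0 := left_ne_zero_of_mul hxy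
  have hy0 := right_ne_zero_of_mul hxy
  have e1 : p * q * x⁻¹ = y := by rw [← h]; field_simp
  have e2 : p * q * y⁻¹ = x := by rw [← h]; field_simp
  rw [ellGamma, ellGamma, e1, e2]
  have := pqPoch_ne_zero_of_norm_lt_one hp hq hx
  have := pqPoch_ne_zero_of_norm_lt_one hp hq hy
  field_simp

theorem ellGamma_mul_right {p q : ℂ} (hp : ‖p‖ < 1) (hq : ‖q‖ < 1)
    (hq0 : q ≠ 0) {z : ℂ} (hz : ‖z‖ < 1) :
    ellGamma p q (q * z) = theta p z * ellGamma p q z := by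
  have h1 := pqPoch_eq_mul_right z hp hq
  have h2 := pqPoch_eq_mul_right (p / z) hp hq
  have h0 := pqPoch_ne_zero_of_norm_lt_one hp hq hz
  have e1 : p * q * (q * z)⁻¹ = p / z := by
    rw [mul_inv]; field_simp
  have e2 : q * (p / z) = p * q * z⁻¹ := by ring
  rw [h1] at h0
  have := left_ne_zero_of_mul h0
  have := right_ne_zero_of_mul h0
  rw [ellGamma, ellGamma, e1, h2, e2, h1, theta]
  field_simp

/-- The weight `1 / Γ(x^{±1})` is a product of theta functions; at `x = 1`, where `Γ` has a pole,
both sides vanish. -/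
theorem inv_ellGamma_mul_inv {p q : ℂ} (hp : ‖p‖ < 1) (hq : ‖q‖ < 1)
    {x : ℂ} (hx : ‖x‖ = 1) :
    (ellGamma p q x * ellGamma p q x⁻¹)⁻¹ = theta p x * theta q x⁻¹ := by
  have hx0 : x ≠ 0 := by rintro rfl; simp at hx
  have hpq : ‖p * q‖ < 1 := by
    rw [norm_mul]; exact mul_lt_one_of_nonneg_of_lt_one_left (norm_nonneg _) hp hq.le
  have h1 : pqPoch (p * q * x⁻¹) p q ≠ 0 :=
    pqPoch_ne_zero_of_norm_lt_one hp hq (by simpa [hx] using hpq)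
  have h2 : pqPoch (p * q * x) p q ≠ 0 :=
    pqPoch_ne_zero_of_norm_lt_one hp hq (by simpa [hx] using hpq)
  have e1 : pqPoch x p q = qPoch x p * (qPoch (q * x) q * pqPoch (p * q * x) p q) := by
    rw [pqPoch_eq_mul_right x hp hq, pqPoch_eq_mul_left (q * x) hp hq, mul_assoc]
  have e2 : pqPoch x⁻¹ p q = qPoch x⁻¹ q * (qPoch (p * x⁻¹) p * pqPoch (p * q * x⁻¹) p q) := by
    rw [pqPoch_eq_mul_left x⁻¹ hp hq, pqPoch_eq_mul_right (p * x⁻¹) hp hq]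
    congr 3; ring
  rw [ellGamma, ellGamma, inv_inv, mul_inv, inv_div, inv_div, e1, e2, theta, theta, div_inv_eq_mul,
    div_eq_mul_inv p x]
  generalize pqPoch (p * q * x⁻¹) p q = A at *
  generalize pqPoch (p * q * x) p q = B at *
  generalize qPoch x⁻¹ q = C
  generalize qPoch (p * x⁻¹) p = D
  field_simp

end

section

/-! ### Uniqueness of theta functions -/

/-- A function continuous on `ℂ \ {0}` that vanishes off a countable set vanishes there. -/
theorem eq_zero_of_eq_zero_off_countable {f : ℂ → ℂ} (hf : ∀ z ≠ 0, ContinuousAt f z) {S : Set ℂ}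
    (hS : S.Countable) (h : ∀ z ≠ 0, z ∉ S → f z = 0) : ∀ z ≠ 0, f z = 0 := by
  intro z hz
  by_contra hne
  have h1 : ∀ᶠ w in 𝓝 z, f w ≠ 0 := (hf z hz).eventually_ne hne
  have h2 : ∀ᶠ w in 𝓝 z, w ≠ 0 := isOpen_ne.mem_nhds hz
  obtain ⟨w, hw, hwS⟩ := (mem_closure_iff_frequently.mp ((hS.dense_compl ℝ) z)).and_eventually
    (h1.and h2) |>.exists
  exact hwS.1 (h w hwS.2 hw)

theorem isPreconnected_annulus {r R : ℝ} (hr : 0 < r) (hR : 0 < R) :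
    IsPreconnected {z : ℂ | r < ‖z‖ ∧ ‖z‖ < R} := by
  have h : {z : ℂ | r < ‖z‖ ∧ ‖z‖ < R} = exp '' (re ⁻¹' Ioo (Real.log r) (Real.log R)) := by
    ext z
    constructor
    · rintro ⟨h1, h2⟩
      refine ⟨log z, ⟨?_, ?_⟩, exp_log (norm_pos_iff.mp (hr.trans h1))⟩
      · rw [log_re]; exact Real.log_lt_log hr h1
      · rw [log_re]; exact Real.log_lt_log (hr.trans h1) h2
    · rintro ⟨x, ⟨h1, h2⟩, rfl⟩
      have h1 := Real.exp_lt_exp.mpr h1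
      have h2 := Real.exp_lt_exp.mpr h2
      rw [Real.exp_log hr] at h1
      rw [Real.exp_log hR] at h2
      exact ⟨by rwa [norm_exp], by rwa [norm_exp]⟩
  rw [h]
  exact ((convex_Ioo _ _).linear_preimage reLm).isPreconnected.image _ continuous_exp.continuousOn

theorem isOpen_annulus (r R : ℝ) : IsOpen {z : ℂ | r < ‖z‖ ∧ ‖z‖ < R} :=
  (isOpen_lt continuous_const continuous_norm).inter (isOpen_lt continuous_norm continuous_const)

/-- A holomorphic function on an annulus that is invariant under `z ↦ c z`, where the annulus is
wider than one period, is constant: its modulus attains its maximum in the interior. -/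
theorem eq_of_multiplicatively_periodic {f : ℂ → ℂ} {r R : ℝ} {c : ℂ} (hr : 0 < r) (hc0 : c ≠ 0)
    (hc : ‖c‖ < 1) (hrR : r < ‖c‖ * R) (hf : ∀ z, r < ‖z‖ → ‖z‖ < R → DifferentiableAt ℂ f z)
    (hper : ∀ z, r < ‖c * z‖ → ‖z‖ < R → f (c * z) = f z) {z w : ℂ} (hz : r < ‖z‖) (hz' : ‖z‖ < R)
    (hw : r < ‖w‖) (hw' : ‖w‖ < R) : f z = f w := by
  have hcpos : 0 < ‖c‖ := norm_pos_iff.mpr hc0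
  have hRpos : 0 < R := (hr.trans hz).trans hz'
  -- a closed annulus inside the given one, containing both points and longer than one period
  obtain ⟨R₁, hR1, hR1'⟩ : ∃ R₁, max (max ‖z‖ ‖w‖) (r / ‖c‖) < R₁ ∧ R₁ < R :=
    exists_between (max_lt (max_lt hz' hw') ((div_lt_iff₀ hcpos).mpr (by linarith [mul_comm R ‖c‖])))
  obtain ⟨r₁, hr1, hr1'⟩ : ∃ r₁, r < r₁ ∧ r₁ < min (min ‖z‖ ‖w‖) (‖c‖ * R₁) := by
    refine exists_between (lt_min (lt_min hz hw) ?_)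
    have := (div_lt_iff₀ hcpos).mp ((le_max_right _ _).trans_lt hR1)
    linarith [mul_comm R₁ ‖c‖]
  simp only [max_lt_iff, lt_min_iff] at hR1 hr1'
  have hr1pos : 0 < r₁ := hr.trans hr1
  have hR1pos : 0 < R₁ := (hr.trans hz).trans hR1.1.1
  let K : Set ℂ := {x | r₁ ≤ ‖x‖ ∧ ‖x‖ ≤ R₁}
  have hKc : IsCompact K := by
    refine (isCompact_closedBall (0 : ℂ) R₁).of_isClosed_subset ?_ fun x hx => by simpa using hx.2
    exact (isClosed_le continuous_const continuous_norm).inter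
      (isClosed_le continuous_norm continuous_const)
  have hfK : ContinuousOn (fun x => ‖f x‖) K := fun x hx =>
    (hf x (hr1.trans_le hx.1) (hx.2.trans_lt hR1')).continuousAt.norm.continuousWithinAt
  obtain ⟨m, hmK, hm⟩ := hKc.exists_isMaxOn ⟨z, hr1'.1.1.le, hR1.1.1.le⟩ hfK
  -- the maximum may be moved off the boundary circles by one period
  obtain ⟨m', hm1, hm2, hm'⟩ : ∃ m', r₁ < ‖m'‖ ∧ ‖m'‖ < R₁ ∧ f m' = f m := by
    rcases eq_or_lt_of_le hmK.1 with h1 | h1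
    · have hn : ‖m / c‖ < R₁ := by
        rw [norm_div, div_lt_iff₀ hcpos, ← h1]; linarith [mul_comm R₁ ‖c‖]
      refine ⟨m / c, ?_, hn, ?_⟩
      · rw [norm_div, lt_div_iff₀ hcpos, ← h1]
        exact mul_lt_of_lt_one_right hr1pos hc
      · have := hper (m / c) (by rw [mul_div_cancel₀ _ hc0, ← h1]; exact hr1) (hn.trans hR1')
        rw [← this, mul_div_cancel₀ _ hc0]
    · rcases eq_or_lt_of_le hmK.2 with h2 | h2
      · have hn : r₁ < ‖c * m‖ := by rw [norm_mul, h2]; exact hr1'.2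
        refine ⟨c * m, hn, ?_, hper m (hr1.trans hn) (h2 ▸ hR1')⟩
        rw [norm_mul, h2]
        exact mul_lt_of_lt_one_left hR1pos hc
      · exact ⟨m, h1, h2, rfl⟩
  have hconst := eqOn_of_isPreconnected_of_isMaxOn_norm
    (isPreconnected_annulus hr1pos hR1pos) (isOpen_annulus r₁ R₁)
    (fun x hx => (hf x (hr1.trans hx.1) (hx.2.trans hR1')).differentiableWithinAt)
    (c := m') ⟨hm1, hm2⟩ (fun x hx => by
      simpa [hm'] using hm ⟨hx.1.le, hx.2.le⟩)
  exact (hconst ⟨hr1'.1.1, hR1.1.1⟩).trans (hconst ⟨hr1'.1.2, hR1.1.2⟩).symm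

/-- If `g` is holomorphic on an open set with simple zeros, and `f` is holomorphic and vanishes at
the zeros of `g`, then `f / g` extends holomorphically. -/
theorem exists_eq_mul_of_simple_zeros {f g : ℂ → ℂ} {U : Set ℂ} (hU : IsOpen U)
    (hf : DifferentiableOn ℂ f U) (hg : DifferentiableOn ℂ g U)
    (hsimple : ∀ z ∈ U, g z = 0 → deriv g z ≠ 0) (hzero : ∀ z ∈ U, g z = 0 → f z = 0) :
    ∃ k : ℂ → ℂ, DifferentiableOn ℂ k U ∧ ∀ z ∈ U, f z = g z * k z := by
  classical
  refine ⟨fun z => if g z = 0 then deriv f z / deriv g z else f z / g z, ?_, ?_⟩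
  · intro w hw
    have hUw := hU.mem_nhds hw
    have hfw := hf.differentiableAt hUw
    have hgw := hg.differentiableAt hUw
    by_cases h0 : g w = 0
    · have hd1 : DifferentiableAt ℂ (dslope f w) w :=
        ((differentiableOn_dslope hUw).mpr hf).differentiableAt hUw
      have hd2 : DifferentiableAt ℂ (dslope g w) w :=
        ((differentiableOn_dslope hUw).mpr hg).differentiableAt hUw
      have hne : dslope g w w ≠ 0 := by rw [dslope_same]; exact hsimple w hw h0
      refine ((hd1.div hd2 hne).congr_of_eventuallyEq ?_).differentiableWithinAt
      filter_upwards [hd2.continuousAt.eventually_ne hne] with z hz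
      rcases eq_or_ne z w with rfl | hzw
      · simp [h0]
      · have e1 : (z - w) * dslope g w z = g z := by
          have := sub_smul_dslope g w z; rwa [h0, sub_zero, smul_eq_mul] at this
        have e2 : (z - w) * dslope f w z = f z := by
          have := sub_smul_dslope f w z; rwa [hzero w hw h0, sub_zero, smul_eq_mul] at this
        have hzw' := sub_ne_zero.mpr hzw
        rw [if_neg (by rw [← e1]; exact mul_ne_zero hzw' hz), ← e1, ← e2]
        simp only [Pi.div_apply]
        field_simp
    · refine ((hfw.div hgw h0).congr_of_eventuallyEq ?_).differentiableWithinAt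
      filter_upwards [hgw.continuousAt.eventually_ne h0] with z hz
      simp [hz]
  · intro z hz
    by_cases h0 : g z = 0
    · simp [h0, hzero z hz h0]
    · simp only [h0, if_false]; field_simp

section

variable {p : ℂ}

theorem theta_eq_zero_iff (hp0 : p ≠ 0) (hp : ‖p‖ < 1) {z : ℂ} (hz : z ≠ 0) :
    theta p z = 0 ↔ ∃ k : ℤ, z = p ^ k := by
  refine ⟨fun h => ?_, ?_⟩
  · by_contra hne
    push Not at hne
    exact theta_ne_zero_of_forall_zpow hp0 hp hz hne h
  · rintro ⟨k, rfl⟩; exact theta_zpow hp0 hp k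

theorem countable_setOf_theta_mul_eq_zero (hp0 : p ≠ 0) (hp : ‖p‖ < 1) {b : ℂ} (hb : b ≠ 0) :
    {z : ℂ | z ≠ 0 ∧ theta p (z * b) = 0}.Countable := by
  refine (countable_range fun k : ℤ => p ^ k / b).mono ?_
  rintro z ⟨hz, h⟩
  obtain ⟨k, hk⟩ := (theta_eq_zero_iff hp0 hp (mul_ne_zero hz hb)).mp h
  exact ⟨k, by simp only [← hk]; field_simp⟩

theorem differentiableAt_theta_mul (hp : ‖p‖ < 1) {z b : ℂ} (hz : z ≠ 0) (hb : b ≠ 0) :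
    DifferentiableAt ℂ (fun z => theta p (z * b)) z :=
  (differentiableAt_theta hp (mul_ne_zero hz hb)).comp z (differentiableAt_id.mul_const b)

/-- There are no theta functions of negative degree. -/
theorem eq_zero_of_theta_degree_neg_one (hp0 : p ≠ 0) (hp : ‖p‖ < 1) {f : ℂ → ℂ} {c : ℂ}
    (hc0 : c ≠ 0) (hf : ∀ z ≠ 0, DifferentiableAt ℂ f z) (hq : ∀ z ≠ 0, f (p * z) = c * z * f z) :
    ∀ z ≠ 0, f z = 0 := by
  have hc : -c ≠ 0 := neg_ne_zero.mpr hc0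
  have hd : ∀ z ≠ 0, DifferentiableAt ℂ (fun z => f z * theta p (z * -c)) z := fun z hz =>
    (hf z hz).mul (differentiableAt_theta_mul hp hz hc)
  have hper : ∀ z ≠ 0, f (p * z) * theta p (p * z * -c) = f z * theta p (z * -c) := fun z hz => by
    rw [hq z hz, mul_assoc p z (-c), theta_mul hp0 hp (mul_ne_zero hz hc)]; field_simp
  -- `f(z) θ(-c z)` is `p`-periodic, hence constant, and it vanishes at `z = -c⁻¹`
  have hzero : ∀ z ≠ 0, f z * theta p (z * -c) = 0 := by
    intro z hz
    have hcn := norm_pos_iff.mpr (inv_ne_zero hc)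
    have hzn := norm_pos_iff.mpr hz
    have hpn := norm_pos_iff.mpr hp0
    obtain ⟨R, hR⟩ := exists_gt (max ‖(-c)⁻¹‖ ‖z‖)
    obtain ⟨r, hr, hr'⟩ := exists_between (lt_min (lt_min hcn hzn)
      (mul_pos hpn (hcn.trans ((le_max_left _ _).trans_lt hR))))
    simp only [max_lt_iff, lt_min_iff] at hR hr'
    have := eq_of_multiplicatively_periodic (f := fun z => f z * theta p (z * -c)) (c := p) hr hp0 hp
      hr'.2 (fun w hw _ => hd w (norm_pos_iff.mp (hr.trans hw)))
      (fun w hw _ => hper w (right_ne_zero_of_mul (norm_pos_iff.mp (hr.trans hw))))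
      hr'.1.2 hR.2 hr'.1.1 hR.1
    have h : f z * theta p (z * -c) = f (-c)⁻¹ * theta p ((-c)⁻¹ * -c) := this
    rwa [inv_mul_cancel₀ hc, theta_one hp, mul_zero] at h
  refine eq_zero_of_eq_zero_off_countable (fun z hz => (hf z hz).continuousAt)
    (countable_setOf_theta_mul_eq_zero hp0 hp hc) fun z hz hzS => ?_
  have hzS : theta p (z * -c) ≠ 0 := fun h => hzS ⟨hz, h⟩
  exact (mul_eq_zero.mp (hzero z hz)).resolve_right hzS

/-- A theta function of degree `n`, that is, a holomorphic function on `ℂ \ {0}` with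
`f(p z) = c z⁻ⁿ f(z)`, vanishes if it has `n + 1` zeros that are distinct modulo `p ^ ℤ`; here
`n + 1` is the length of the list of zeros. -/
theorem eq_zero_of_theta_zeros (hp0 : p ≠ 0) (hp : ‖p‖ < 1) (l : List ℂ) :
    ∀ {f : ℂ → ℂ} {c : ℂ}, c ≠ 0 → (∀ z ≠ 0, DifferentiableAt ℂ f z) →
      (∀ z ≠ 0, f (p * z) * z ^ l.length = c * z * f z) → (∀ a ∈ l, a ≠ 0 ∧ f a = 0) →
      l.Pairwise (fun a b => theta p (b / a) ≠ 0) → ∀ z ≠ 0, f z = 0 := by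
  induction l with
  | nil =>
    intro f c hc hf hq _ _
    exact eq_zero_of_theta_degree_neg_one hp0 hp hc hf (by simpa using hq)
  | cons a l ih =>
    intro f c hc hf hq hz hpw
    have ha : a ≠ 0 := (hz a (by simp)).1
    have hai : a⁻¹ ≠ 0 := inv_ne_zero ha
    have hfa : ∀ k : ℤ, f (a * p ^ k) = 0 := by
      intro k
      induction k using Int.induction_on with
      | zero => simpa using (hz a (by simp)).2
      | succ i ihi =>
        have hne : a * p ^ (i : ℤ) ≠ 0 := mul_ne_zero ha (zpow_ne_zero _ hp0)
        have h := hq _ hne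
        rw [ihi, mul_zero] at h
        have := (mul_eq_zero.mp h).resolve_right (pow_ne_zero _ hne)
        rwa [← mul_assoc, mul_comm p a, mul_assoc, ← zpow_one_add₀ hp0, add_comm] at this
      | pred i ihi =>
        have hne : a * p ^ (-(i : ℤ) - 1) ≠ 0 := mul_ne_zero ha (zpow_ne_zero _ hp0)
        have h := hq _ hne
        rw [← mul_assoc, mul_comm p a, mul_assoc, ← zpow_one_add₀ hp0, add_sub_cancel, ihi,
          zero_mul] at h
        exact (mul_eq_zero.mp h.symm).resolve_left (mul_ne_zero hc hne)
    obtain ⟨k, hk, hfk⟩ := exists_eq_mul_of_simple_zeros (f := f) (g := fun z => theta p (z * a⁻¹))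
      (U := {0}ᶜ) isOpen_compl_singleton
      (fun z hz => (hf z hz).differentiableWithinAt)
      (fun z hz => (differentiableAt_theta_mul hp hz hai).differentiableWithinAt)
      (fun z hz h0 => by
        obtain ⟨j, hj⟩ := (theta_eq_zero_iff hp0 hp (mul_ne_zero hz hai)).mp h0
        have := (differentiableAt_theta (z := z * a⁻¹) hp (mul_ne_zero hz hai)).hasDerivAt.comp z
          ((hasDerivAt_id z).mul_const a⁻¹)
        have h2 : deriv (fun z => theta p (z * a⁻¹)) z = deriv (theta p) (z * a⁻¹) * (1 * a⁻¹) :=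
          this.deriv
        rw [h2, hj, one_mul]
        exact mul_ne_zero (deriv_theta_zpow_ne_zero hp0 hp j) hai)
      (fun z hz h0 => by
        obtain ⟨j, hj⟩ := (theta_eq_zero_iff hp0 hp (mul_ne_zero hz hai)).mp h0
        have : z = a * p ^ j := by rw [← hj]; field_simp
        rw [this]; exact hfa j)
    have hkd : ∀ z ≠ 0, DifferentiableAt ℂ k z := fun z hz =>
      hk.differentiableAt (isOpen_compl_singleton.mem_nhds hz)
    have hkq : ∀ z ≠ 0, k (p * z) * z ^ l.length - -(c * a⁻¹) * z * k z = 0 := by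
      refine eq_zero_of_eq_zero_off_countable (fun z hz => ?_)
        (countable_setOf_theta_mul_eq_zero hp0 hp hai) fun z hz hzS => ?_
      · have h1 : ContinuousAt (fun z => k (p * z)) z :=
          ContinuousAt.comp (f := fun z => p * z) (hkd _ (mul_ne_zero hp0 hz)).continuousAt
            (by fun_prop)
        exact (h1.mul (by fun_prop)).sub ((by fun_prop : ContinuousAt _ z).mul (hkd z hz).continuousAt)
      · have hzS : theta p (z * a⁻¹) ≠ 0 := fun h => hzS ⟨hz, h⟩
        have h := hq z hz
        rw [hfk z hz, hfk (p * z) (mul_ne_zero hp0 hz), mul_assoc p z,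
          theta_mul hp0 hp (mul_ne_zero hz hai), List.length_cons] at h
        have h3 : theta p (z * a⁻¹) * (k (p * z) * z ^ l.length - -(c * a⁻¹) * z * k z) = 0 := by
          have e : (-(z * a⁻¹)⁻¹ * theta p (z * a⁻¹) * k (p * z)) * z ^ (l.length + 1) =
              - a * theta p (z * a⁻¹) * k (p * z) * z ^ l.length := by
            rw [pow_succ]; field_simp
          rw [e] at h
          have e2 : theta p (z * a⁻¹) * (k (p * z) * z ^ l.length - -(c * a⁻¹) * z * k z) =
              - a⁻¹ * (- a * theta p (z * a⁻¹) * k (p * z) * z ^ l.length) +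
                a⁻¹ * (c * z * (theta p (z * a⁻¹) * k z)) := by
            field_simp; ring
          rw [e2, h]; ring
        exact (mul_eq_zero.mp h3).resolve_left hzS
    have hk0 : ∀ z ≠ 0, k z = 0 := by
      refine ih (c := -(c * a⁻¹)) (neg_ne_zero.mpr (mul_ne_zero hc hai)) hkd
        (fun z hz => sub_eq_zero.mp (hkq z hz)) (fun b hb => ?_) (List.pairwise_cons.mp hpw).2
      obtain ⟨hb0, hfb⟩ := hz b (by simp [hb])
      refine ⟨hb0, ?_⟩
      rw [hfk b hb0] at hfb
      exact (mul_eq_zero.mp hfb).resolve_left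
        (by simpa [div_eq_mul_inv] using (List.pairwise_cons.mp hpw).1 b hb)
    intro z hz
    rw [hfk z hz, hk0 z hz, mul_zero]

end

end

section

/-! ### A theta function identity -/

/-- The difference of the two sides of the theta function identity behind the contiguity relation.
For `a b c d e u = p` it is a theta function of degree six in `z`, and vanishes
(`thetaDefect_eq_zero`). -/
noncomputable def thetaDefect (p a b c d e u z : ℂ) : ℂ :=
  theta p (z ^ 2) *
      (theta p (a * z) * theta p (a * z⁻¹) *
          (theta p (u * b) * theta p (u * c) * theta p (u * d) * theta p (u * e)) -
        theta p (u * z) * theta p (u * z⁻¹) *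
          (theta p (a * b) * theta p (a * c) * theta p (a * d) * theta p (a * e))) +
    a * theta p (u / a) *
      (theta p (a * z) * theta p (b * z) * theta p (c * z) * theta p (d * z) * theta p (e * z) *
            theta p (u * z) * z⁻¹ -
        z ^ 3 * (theta p (a * z⁻¹) * theta p (b * z⁻¹) * theta p (c * z⁻¹) * theta p (d * z⁻¹) *
          theta p (e * z⁻¹) * theta p (u * z⁻¹)))

variable {p : ℂ}

theorem theta_mul_mul (hp0 : p ≠ 0) (hp : ‖p‖ < 1) {x z : ℂ} (hx : x ≠ 0) (hz : z ≠ 0) :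
    theta p (x * (p * z)) = -(x * z)⁻¹ * theta p (x * z) := by
  rw [← theta_mul hp0 hp (mul_ne_zero hx hz)]; congr 1; ring

theorem theta_mul_inv_mul (hp0 : p ≠ 0) (hp : ‖p‖ < 1) {x z : ℂ} (hx : x ≠ 0) (hz : z ≠ 0) :
    theta p (x * (p * z)⁻¹) = -(x / (p * z)) * theta p (x * z⁻¹) := by
  have h := theta_mul hp0 hp (mul_ne_zero hx (inv_ne_zero (mul_ne_zero hp0 hz)))
  have e : p * (x * (p * z)⁻¹) = x * z⁻¹ := by field_simp
  rw [e] at h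
  rw [h]; field_simp

theorem thetaDefect_mul (hp0 : p ≠ 0) (hp : ‖p‖ < 1) {a b c d e u : ℂ}
    (h : a * b * c * d * e * u = p) {z : ℂ} (hz : z ≠ 0) :
    thetaDefect p a b c d e u (p * z) * z ^ 6 = (p ^ 2)⁻¹ * thetaDefect p a b c d e u z := by
  have h0 : a * b * c * d * e * u ≠ 0 := h ▸ hp0
  obtain ⟨⟨⟨⟨⟨ha, hb⟩, hc⟩, hd⟩, he⟩, hu⟩ :
      ((((a ≠ 0 ∧ b ≠ 0) ∧ c ≠ 0) ∧ d ≠ 0) ∧ e ≠ 0) ∧ u ≠ 0 := by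
    simpa only [mul_ne_zero_iff] using h0
  have hz2 : theta p ((p * z) ^ 2) = (p * z ^ 4)⁻¹ * theta p (z ^ 2) := by
    have e1 : (p * z) ^ 2 = p * (p * z ^ 2) := by ring
    rw [e1, theta_mul hp0 hp (mul_ne_zero hp0 (pow_ne_zero 2 hz)),
      theta_mul hp0 hp (pow_ne_zero 2 hz)]
    field_simp
  simp only [thetaDefect, hz2, theta_mul_mul hp0 hp ha hz, theta_mul_mul hp0 hp hb hz,
    theta_mul_mul hp0 hp hc hz, theta_mul_mul hp0 hp hd hz, theta_mul_mul hp0 hp he hz,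
    theta_mul_mul hp0 hp hu hz, theta_mul_inv_mul hp0 hp ha hz, theta_mul_inv_mul hp0 hp hb hz,
    theta_mul_inv_mul hp0 hp hc hz, theta_mul_inv_mul hp0 hp hd hz, theta_mul_inv_mul hp0 hp he hz,
    theta_mul_inv_mul hp0 hp hu hz]
  generalize theta p (z ^ 2) = Θ
  generalize theta p (u / a) = Θ'
  generalize theta p (u * b) * theta p (u * c) * theta p (u * d) * theta p (u * e) = B
  generalize theta p (a * b) * theta p (a * c) * theta p (a * d) * theta p (a * e) = D
  generalize theta p (a * z) = A1
  generalize theta p (b * z) = B1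
  generalize theta p (c * z) = C1
  generalize theta p (d * z) = D1
  generalize theta p (e * z) = E1
  generalize theta p (u * z) = U1
  generalize theta p (a * z⁻¹) = A2
  generalize theta p (b * z⁻¹) = B2
  generalize theta p (c * z⁻¹) = C2
  generalize theta p (d * z⁻¹) = D2
  generalize theta p (e * z⁻¹) = E2
  generalize theta p (u * z⁻¹) = U2
  have e1 : -(a * z)⁻¹ * A1 * (-(b * z)⁻¹ * B1) * (-(c * z)⁻¹ * C1) * (-(d * z)⁻¹ * D1) *
      (-(e * z)⁻¹ * E1) * (-(u * z)⁻¹ * U1) * (p * z)⁻¹ =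
      (p ^ 2 * z ^ 7)⁻¹ * (A1 * B1 * C1 * D1 * E1 * U1) := by
    have : -(a * z)⁻¹ * A1 * (-(b * z)⁻¹ * B1) * (-(c * z)⁻¹ * C1) * (-(d * z)⁻¹ * D1) *
      (-(e * z)⁻¹ * E1) * (-(u * z)⁻¹ * U1) * (p * z)⁻¹ =
      (a * b * c * d * e * u)⁻¹ * (p * z ^ 7)⁻¹ * (A1 * B1 * C1 * D1 * E1 * U1) := by
      field_simp
    rw [this, h]; field_simp
  have e2 : (p * z) ^ 3 * (-(a / (p * z)) * A2 * (-(b / (p * z)) * B2) * (-(c / (p * z)) * C2) *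
      (-(d / (p * z)) * D2) * (-(e / (p * z)) * E2) * (-(u / (p * z)) * U2)) =
      (p ^ 2 * z ^ 3)⁻¹ * (A2 * B2 * C2 * D2 * E2 * U2) := by
    have : (p * z) ^ 3 * (-(a / (p * z)) * A2 * (-(b / (p * z)) * B2) * (-(c / (p * z)) * C2) *
      (-(d / (p * z)) * D2) * (-(e / (p * z)) * E2) * (-(u / (p * z)) * U2)) =
      (a * b * c * d * e * u) * (p ^ 3 * z ^ 3)⁻¹ * (A2 * B2 * C2 * D2 * E2 * U2) := by
      field_simp
    rw [this, h]; field_simp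
  rw [e1, e2]
  field_simp

/-- By this symmetry `±1` are zeros, and in combination with `thetaDefect_mul` also `±√p`. -/
theorem thetaDefect_inv (hp : ‖p‖ < 1) (a b c d e u : ℂ) {z : ℂ} (hz : z ≠ 0) :
    thetaDefect p a b c d e u z⁻¹ = -(z ^ 2)⁻¹ * thetaDefect p a b c d e u z := by
  simp only [thetaDefect, inv_pow, inv_inv, theta_inv hp (pow_ne_zero 2 hz)]
  field_simp
  ring

theorem thetaDefect_self (hp : ‖p‖ < 1) {a b c d e u : ℂ} (ha : a ≠ 0) :
    thetaDefect p a b c d e u a = 0 := by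
  have h1 : theta p (a * a⁻¹) = 0 := by rw [mul_inv_cancel₀ ha, theta_one hp]
  simp only [thetaDefect, h1, mul_comm b a, mul_comm c a, mul_comm d a, mul_comm e a,
    mul_comm u a, div_eq_mul_inv, sq]
  field_simp
  ring

theorem thetaDefect_self_right (hp : ‖p‖ < 1) {a b c d e u : ℂ} (ha : a ≠ 0)
    (hu : u ≠ 0) : thetaDefect p a b c d e u u = 0 := by
  have h1 : theta p (u * u⁻¹) = 0 := by rw [mul_inv_cancel₀ hu, theta_one hp]
  have h2 : theta p (a * u⁻¹) = -(a / u) * theta p (u / a) := by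
    have := theta_inv (z := u / a) hp (div_ne_zero hu ha)
    rwa [inv_div, div_eq_mul_inv a u] at this
  simp only [thetaDefect, h1, h2, mul_comm b u, mul_comm c u, mul_comm d u, mul_comm e u, sq]
  field_simp
  ring

theorem differentiableAt_thetaDefect (hp : ‖p‖ < 1) {a b c d e u : ℂ}
    (h : a * b * c * d * e * u ≠ 0) {z : ℂ} (hz : z ≠ 0) :
    DifferentiableAt ℂ (thetaDefect p a b c d e u) z := by
  obtain ⟨⟨⟨⟨⟨ha, hb⟩, hc⟩, hd⟩, he⟩, hu⟩ :
      ((((a ≠ 0 ∧ b ≠ 0) ∧ c ≠ 0) ∧ d ≠ 0) ∧ e ≠ 0) ∧ u ≠ 0 := by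
    simpa only [mul_ne_zero_iff] using h
  have h1 : ∀ x : ℂ, x ≠ 0 → DifferentiableAt ℂ (fun z => theta p (x * z)) z := fun x hx =>
    (differentiableAt_theta hp (mul_ne_zero hx hz)).comp z (by fun_prop)
  have h2 : ∀ x : ℂ, x ≠ 0 → DifferentiableAt ℂ (fun z => theta p (x * z⁻¹)) z := fun x hx =>
    (differentiableAt_theta hp (mul_ne_zero hx (inv_ne_zero hz))).comp z
      ((differentiableAt_inv hz).const_mul x)
  have h3 : DifferentiableAt ℂ (fun z => theta p (z ^ 2)) z :=
    DifferentiableAt.comp (f := fun z : ℂ => z ^ 2) z (differentiableAt_theta hp (pow_ne_zero 2 hz))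
      (by fun_prop)
  have h4 := ((((((h1 a ha).fun_mul (h1 b hb)).fun_mul (h1 c hc)).fun_mul (h1 d hd)).fun_mul
    (h1 e he)).fun_mul (h1 u hu)).fun_mul (differentiableAt_inv (𝕜 := ℂ) hz)
  have h5 := (((((h2 a ha).fun_mul (h2 b hb)).fun_mul (h2 c hc)).fun_mul (h2 d hd)).fun_mul
    (h2 e he)).fun_mul (h2 u hu)
  exact (h3.fun_mul ((((h1 a ha).fun_mul (h2 a ha)).mul_const _).fun_sub
    (((h1 u hu).fun_mul (h2 u hu)).mul_const _))).fun_add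
    ((h4.fun_sub ((differentiableAt_id.pow 3).fun_mul h5)).const_mul _)

theorem theta_ne_zero_of_sq (hp0 : p ≠ 0) (hp : ‖p‖ < 1) {x : ℂ} (hx : x ≠ 0)
    (h : ∀ k : ℤ, x ^ 2 ≠ p ^ k) : theta p x ≠ 0 :=
  theta_ne_zero_of_forall_zpow hp0 hp hx fun k hk => h (k * 2) (by rw [hk, zpow_mul]; norm_cast)

theorem zpow_injective_of_norm_lt_one (hp0 : p ≠ 0) (hp : ‖p‖ < 1) :
    Function.Injective fun k : ℤ => p ^ k := by
  intro m n h
  have := congrArg norm h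
  simp only [norm_zpow] at this
  exact (zpow_right_strictAnti₀ (norm_pos_iff.mpr hp0) hp).injective this

/-- For generic parameters the theta function `thetaDefect` of degree six has the seven zeros
`±1`, `±√p`, `a`, `a⁻¹`, `u`. -/
theorem thetaDefect_eq_zero_of_generic (hp0 : p ≠ 0) (hp : ‖p‖ < 1) {a b c d e u : ℂ}
    (h : a * b * c * d * e * u = p) (ha2 : ∀ k : ℤ, a ^ 2 ≠ p ^ k) (hu2 : ∀ k : ℤ, u ^ 2 ≠ p ^ k)
    (hua : ∀ k : ℤ, u * a ≠ p ^ k) (hua' : ∀ k : ℤ, u / a ≠ p ^ k) :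
    ∀ z ≠ 0, thetaDefect p a b c d e u z = 0 := by
  have h0 : a * b * c * d * e * u ≠ 0 := h ▸ hp0
  obtain ⟨⟨⟨⟨⟨ha, hb⟩, hc⟩, hd⟩, he⟩, hu⟩ :
      ((((a ≠ 0 ∧ b ≠ 0) ∧ c ≠ 0) ∧ d ≠ 0) ∧ e ≠ 0) ∧ u ≠ 0 := by
    simpa only [mul_ne_zero_iff] using h0
  obtain ⟨s, hs⟩ : ∃ s : ℂ, s ^ 2 = p := IsAlgClosed.exists_pow_nat_eq p two_pos
  have hs0 : s ≠ 0 := by rintro rfl; exact hp0 (by rw [← hs]; simp)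
  have hone : ∀ ε : ℂ, ε ^ 2 = 1 → thetaDefect p a b c d e u ε = 0 := by
    intro ε hε
    have hε0 : ε ≠ 0 := by rintro rfl; simp at hε
    have h1 := thetaDefect_inv hp a b c d e u hε0
    have h2 : ε⁻¹ = ε := inv_eq_of_mul_eq_one_left (by rw [← sq, hε])
    rw [h2, hε] at h1
    have : (2 : ℂ) * thetaDefect p a b c d e u ε = 0 := by linear_combination h1
    simpa using this
  have hhalf : ∀ σ : ℂ, σ ^ 2 = p → thetaDefect p a b c d e u σ = 0 := by
    intro σ hσ
    have hσ0 : σ ≠ 0 := by rintro rfl; exact hp0 (by rw [← hσ]; simp)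
    have h1 := thetaDefect_mul hp0 hp h (inv_ne_zero hσ0)
    have h2 : p * σ⁻¹ = σ := by rw [← hσ]; field_simp
    have h3 : (σ⁻¹) ^ 6 = (p ^ 3)⁻¹ := by rw [← hσ, inv_pow]; ring
    rw [h2, h3, thetaDefect_inv hp a b c d e u hσ0, hσ] at h1
    have h4 : (2 : ℂ) * thetaDefect p a b c d e u σ * (p ^ 3)⁻¹ = 0 := by
      field_simp at h1 ⊢
      linear_combination h1
    simpa [hp0] using h4
  have hself := thetaDefect_self (b := b) (c := c) (d := d) (e := e) (u := u) hp ha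
  have hz0 : theta p (-1) ≠ 0 := by
    refine theta_ne_zero_of_forall_zpow hp0 hp (by norm_num) fun k hk => ?_
    have hk0 : k * 2 = 0 := by
      refine zpow_injective_of_norm_lt_one hp0 hp ?_
      simp only [zpow_mul, ← hk]; norm_num
    have : k = 0 := by omega
    rw [this] at hk; norm_num at hk
  have hsk : ∀ k : ℤ, s ≠ p ^ k ∧ -s ≠ p ^ k := by
    have key : ∀ k : ℤ, s ^ 2 ≠ (p ^ k) ^ 2 := by
      intro k hk
      have : (1 : ℤ) = k * 2 := by
        refine zpow_injective_of_norm_lt_one hp0 hp ?_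
        simp only [zpow_one, zpow_mul]
        rw [hs] at hk
        exact_mod_cast hk
      omega
    exact fun k => ⟨fun hk => key k (by rw [hk]), fun hk => key k (by rw [← hk]; ring)⟩
  -- ratios of zeros that are not powers of `p` because their squares are not
  have hr : ∀ y : ℂ, y ≠ 0 → (∀ k : ℤ, y ^ 2 ≠ p ^ k) → ∀ x : ℂ, x ≠ 0 →
      (x ^ 2 = 1 ∨ x ^ 2 = p) → theta p (y / x) ≠ 0 := by
    intro y hy hy2 x hx hx2
    refine theta_ne_zero_of_sq hp0 hp (div_ne_zero hy hx) fun k hk => ?_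
    rw [div_pow] at hk
    rcases hx2 with hx2 | hx2
    · exact hy2 k (by rw [← hk, hx2, div_one])
    · refine hy2 (k + 1) ?_
      rw [zpow_add₀ hp0, ← hk, hx2, zpow_one]; field_simp
  have hai2 : ∀ k : ℤ, (a⁻¹) ^ 2 ≠ p ^ k := fun k hk =>
    ha2 (-k) (by rw [zpow_neg, ← hk, inv_pow, inv_inv])
  have hai := inv_ne_zero ha
  refine eq_zero_of_theta_zeros hp0 hp [1, -1, s, -s, a, a⁻¹, u] (c := (p ^ 2)⁻¹)
    (inv_ne_zero (pow_ne_zero 2 hp0)) (fun z hz => differentiableAt_thetaDefect hp h0 hz)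
    (fun z hz => ?_) ?_ ?_
  · have := thetaDefect_mul hp0 hp h hz
    simp only [List.length_cons, List.length_nil]
    rw [pow_succ z, ← mul_assoc, this]; ring
  · simp only [List.mem_cons, List.not_mem_nil, or_false]
    rintro x (rfl | rfl | rfl | rfl | rfl | rfl | rfl)
    · exact ⟨one_ne_zero, hone _ (by norm_num)⟩
    · exact ⟨by norm_num, hone _ (by norm_num)⟩
    · exact ⟨hs0, hhalf _ hs⟩
    · exact ⟨neg_ne_zero.mpr hs0, hhalf _ (by rw [neg_sq, hs])⟩
    · exact ⟨ha, hself⟩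
    · exact ⟨hai, by rw [thetaDefect_inv hp _ _ _ _ _ _ ha, hself, mul_zero]⟩
    · exact ⟨hu, thetaDefect_self_right hp ha hu⟩
  · have hns : -s ≠ 0 := neg_ne_zero.mpr hs0
    have hs1 : theta p s ≠ 0 := theta_ne_zero_of_forall_zpow hp0 hp hs0 fun k => (hsk k).1
    have hs2 : theta p (-s) ≠ 0 := theta_ne_zero_of_forall_zpow hp0 hp hns fun k => (hsk k).2
    have hn1 : (-1 : ℂ) ≠ 0 := by norm_num
    have e1 : (1 : ℂ) ^ 2 = 1 ∨ (1 : ℂ) ^ 2 = p := by simp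
    have e2 : (-1 : ℂ) ^ 2 = 1 ∨ (-1 : ℂ) ^ 2 = p := by simp
    have e3 : s ^ 2 = 1 ∨ s ^ 2 = p := Or.inr hs
    have e4 : (-s) ^ 2 = 1 ∨ (-s) ^ 2 = p := Or.inr (by rw [neg_sq, hs])
    simp only [List.pairwise_cons, List.mem_cons, List.not_mem_nil, or_false, forall_eq_or_imp,
      forall_eq, List.Pairwise.nil, and_true, false_imp_iff, implies_true]
    refine ⟨⟨by simpa using hz0, by simpa using hs1, by simpa using hs2,
      hr a ha ha2 1 one_ne_zero e1, hr _ hai hai2 1 one_ne_zero e1, hr u hu hu2 1 one_ne_zero e1⟩,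
      ⟨by simpa [div_neg] using hs2, by simpa [div_neg] using hs1,
        hr a ha ha2 _ hn1 e2, hr _ hai hai2 _ hn1 e2, hr u hu hu2 _ hn1 e2⟩,
      ⟨by simpa [neg_div, hs0] using hz0, hr a ha ha2 s hs0 e3, hr _ hai hai2 s hs0 e3,
        hr u hu hu2 s hs0 e3⟩,
      ⟨hr a ha ha2 _ hns e4, hr _ hai hai2 _ hns e4, hr u hu hu2 _ hns e4⟩, ⟨?_, ?_⟩, ?_⟩
    · refine theta_ne_zero_of_forall_zpow hp0 hp (div_ne_zero hai ha) fun k hk => ha2 (-k) ?_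
      rw [zpow_neg, ← hk]; field_simp
    · exact theta_ne_zero_of_forall_zpow hp0 hp (div_ne_zero hu ha) hua'
    · refine theta_ne_zero_of_forall_zpow hp0 hp (div_ne_zero hu hai) fun k hk => hua k ?_
      rw [← hk]; field_simp

theorem countable_setOf_sq_eq_zpow (p : ℂ) : {x : ℂ | ∃ k : ℤ, x ^ 2 = p ^ k}.Countable := by
  choose s hs using fun k : ℤ => IsAlgClosed.exists_pow_nat_eq (p ^ k) two_pos
  refine ((countable_range s).union (countable_range fun k => -s k)).mono ?_
  rintro x ⟨k, hk⟩
  rw [← hs k, sq_eq_sq_iff_eq_or_eq_neg] at hk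
  rcases hk with rfl | rfl
  · exact Or.inl ⟨k, rfl⟩
  · exact Or.inr ⟨k, rfl⟩

theorem continuousAt_theta_comp (hp : ‖p‖ < 1) {f : ℂ → ℂ} {z : ℂ} (hf : ContinuousAt f z)
    (h0 : f z ≠ 0) : ContinuousAt (fun z => theta p (f z)) z :=
  ContinuousAt.comp (f := f) (differentiableAt_theta hp h0).continuousAt hf

/-- The theta function identity; the non-generic parameters are reached by continuity in `u` and
then in `a`. -/
theorem thetaDefect_eq_zero (hp0 : p ≠ 0) (hp : ‖p‖ < 1) {a b c d e u z : ℂ}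
    (h : a * b * c * d * e * u = p) (hz : z ≠ 0) : thetaDefect p a b c d e u z = 0 := by
  have h0 : a * b * c * d * e * u ≠ 0 := h ▸ hp0
  obtain ⟨⟨⟨⟨⟨ha, hb⟩, hc⟩, hd⟩, -⟩, hu⟩ :
      ((((a ≠ 0 ∧ b ≠ 0) ∧ c ≠ 0) ∧ d ≠ 0) ∧ e ≠ 0) ∧ u ≠ 0 := by
    simpa only [mul_ne_zero_iff] using h0
  have he : e = p / (a * b * c * d * u) := by rw [← h]; field_simp
  have hcont : ∀ (α υ : ℂ → ℂ) (x : ℂ), ContinuousAt α x → ContinuousAt υ x → α x ≠ 0 → υ x ≠ 0 →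
      ContinuousAt (fun x => thetaDefect p (α x) b c d (p / (α x * b * c * d * υ x)) (υ x) z) x := by
    intro α υ x hα hυ ha hu
    have hne : α x * b * c * d * υ x ≠ 0 := by simp [*]
    have hε : ContinuousAt (fun x => p / (α x * b * c * d * υ x)) x := by fun_prop (disch := assumption)
    have hε0 : p / (α x * b * c * d * υ x) ≠ 0 := div_ne_zero hp0 hne
    have hzi := inv_ne_zero hz
    have key : ∀ f g : ℂ → ℂ, ContinuousAt f x → ContinuousAt g x → f x ≠ 0 → g x ≠ 0 →
        ContinuousAt (fun x => theta p (f x * g x)) x := fun f g hf hg h1 h2 =>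
      continuousAt_theta_comp hp (hf.mul hg) (mul_ne_zero h1 h2)
    have k0 : ∀ w : ℂ, ContinuousAt (fun _ : ℂ => w) x := fun w => continuousAt_const
    have k1 := key _ _ hα (k0 z) ha hz
    have k2 := key _ _ hα (k0 _) ha hzi
    have k3 := key _ _ hυ (k0 z) hu hz
    have k4 := key _ _ hυ (k0 _) hu hzi
    have k5 := key _ _ hε (k0 z) hε0 hz
    have k6 := key _ _ hε (k0 _) hε0 hzi
    have k7 := key _ _ hα (k0 b) ha hb
    have k8 := key _ _ hα (k0 c) ha hc
    have k9 := key _ _ hα (k0 d) ha hd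
    have k10 := key _ _ hα hε ha hε0
    have k11 := key _ _ hυ (k0 b) hu hb
    have k12 := key _ _ hυ (k0 c) hu hc
    have k13 := key _ _ hυ (k0 d) hu hd
    have k14 := key _ _ hυ hε hu hε0
    have k15 := key _ _ hυ (hα.inv₀ ha) hu (inv_ne_zero ha)
    unfold thetaDefect
    simp only [div_eq_mul_inv] at *
    fun_prop
  have hrange : (range fun k : ℤ => p ^ k).Countable := countable_range _
  have step1 : ∀ a : ℂ, a ≠ 0 → (∀ k : ℤ, a ^ 2 ≠ p ^ k) → ∀ u ≠ 0,
      thetaDefect p a b c d (p / (a * b * c * d * u)) u z = 0 := by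
    intro a ha ha2
    refine eq_zero_of_eq_zero_off_countable
      (fun u hu => hcont (fun _ => a) id u continuousAt_const continuousAt_id ha hu)
      ((countable_setOf_sq_eq_zpow p).union ((hrange.image (· / a)).union (hrange.image (· * a))))
      fun u hu hS => ?_
    simp only [mem_union, not_or] at hS
    refine thetaDefect_eq_zero_of_generic hp0 hp (by field_simp) ha2 (fun k hk => hS.1 ⟨k, hk⟩)
      (fun k hk => hS.2.1 ⟨p ^ k, ⟨k, rfl⟩, by simp only [← hk]; field_simp⟩)
      (fun k hk => hS.2.2 ⟨p ^ k, ⟨k, rfl⟩, by simp only [← hk]; field_simp⟩) z hz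
  rw [he]
  exact eq_zero_of_eq_zero_off_countable
    (f := fun a => thetaDefect p a b c d (p / (a * b * c * d * u)) u z)
    (fun a ha => hcont id (fun _ => u) a continuousAt_id continuousAt_const ha hu)
    (countable_setOf_sq_eq_zpow p) (fun a ha hS => step1 a ha (fun k hk => hS ⟨k, hk⟩) u hu) a ha

end

section

/-! ### Averages over circles -/

/-- Rotating and scaling the variable changes only the radius of the circle. -/
theorem circleAverage_comp_mul (f : ℂ → ℂ) (c : ℂ) :
    Real.circleAverage (fun z => f (c * z)) 0 1 = Real.circleAverage f 0 ‖c‖ := by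
  rw [Real.circleAverage_eq_integral_add (f := f) (R := ‖c‖) (arg c), Real.circleAverage_def]
  congr 2
  ext θ
  congr 1
  simp only [circleMap, zero_add, ofReal_one, one_mul, ofReal_add, add_mul, exp_add]
  rw [mul_comm (cexp (θ * I)), ← mul_assoc, norm_mul_exp_arg_mul_I]

theorem circleAverage_eq_of_differentiableAt {f : ℂ → ℂ} {R : ℝ} (hR : 1 ≤ R)
    (hf : ∀ z, 1 ≤ ‖z‖ → ‖z‖ ≤ R → DifferentiableAt ℂ f z) :
    Real.circleAverage f 0 R = Real.circleAverage f 0 1 := by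
  rw [Real.circleAverage_eq_circleIntegral (by positivity),
    Real.circleAverage_eq_circleIntegral one_ne_zero]
  congr 1
  refine circleIntegral_sub_center_inv_smul_eq_of_differentiable_on_annulus_off_countable
    one_pos hR countable_empty ?_ ?_
  · rintro z ⟨h1, h2⟩
    exact (hf z (by simpa using h2) (by simpa using h1)).continuousAt.continuousWithinAt
  · rintro z ⟨⟨h1, h2⟩, -⟩
    have h1 : ‖z‖ < R := by simpa using h1
    have h2 : 1 < ‖z‖ := by simpa using h2
    exact hf z h2.le h1.le

theorem circleIntegrable_mul_const {f : ℂ → ℂ} {c : ℂ} {R : ℝ} (hf : CircleIntegrable f c R)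
    (B : ℂ) : CircleIntegrable (fun z => f z * B) c R :=
  IntervalIntegrable.mul_const hf B

theorem circleAverage_mul_const (f : ℂ → ℂ) (B c : ℂ) (R : ℝ) :
    Real.circleAverage (fun z => f z * B) c R = Real.circleAverage f c R * B := by
  rw [Real.circleAverage_def, Real.circleAverage_def, intervalIntegral.integral_mul_const,
    smul_mul_assoc]

/-! ### The integrals -/

/-- The integrand `∏ⱼ Γ(tⱼ z^{±1}) / Γ(z^{±2})`, where `1 / Γ(z^{±2})` is written as
`θ(z²; p) θ(z⁻²; q)`. -/
noncomputable def ellWeight (p q : ℂ) {ι : Type*} [Fintype ι] (t : ι → ℂ) (z : ℂ) : ℂ :=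
  (∏ j, ellGamma p q (t j * z) * ellGamma p q (t j * z⁻¹)) *
    (theta p (z ^ 2) * theta q ((z ^ 2)⁻¹))

/-- The integral of `ellWeight` over the unit circle against `dz / (2 π i z)`. -/
noncomputable def ellInt (p q : ℂ) {ι : Type*} [Fintype ι] (t : ι → ℂ) : ℂ :=
  Real.circleAverage (ellWeight p q t) 0 1

variable {p q : ℂ} {ι : Type*} [Fintype ι]

theorem ellWeight_inv (hp : ‖p‖ < 1) (hq : ‖q‖ < 1) (t : ι → ℂ) {z : ℂ} (hz : z ≠ 0) :
    ellWeight p q t z⁻¹ = ellWeight p q t z := by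
  have h := theta_inv hp (pow_ne_zero 2 hz)
  have h' := theta_inv hq (pow_ne_zero 2 hz)
  simp only [ellWeight, inv_inv, inv_pow, h, h']
  congr 1
  · exact Finset.prod_congr rfl fun j _ => mul_comm _ _
  · ring

/-- Changing the sign of all parameters amounts to the substitution `z ↦ -z`. -/
theorem ellInt_neg (t : ι → ℂ) : ellInt p q (fun j => -t j) = ellInt p q t := by
  have h := circleAverage_comp_mul (ellWeight p q t) (-1)
  rw [norm_neg, norm_one] at h
  rw [ellInt, ellInt, ← h]
  congr 1
  ext z
  simp [ellWeight, inv_neg]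

theorem ellInt_comp_equiv {κ : Type*} [Fintype κ] (e : κ ≃ ι) (t : ι → ℂ) :
    ellInt p q (fun j => t (e j)) = ellInt p q t := by
  rw [ellInt, ellInt]
  congr 1
  ext z
  simp only [ellWeight]
  rw [e.prod_comp fun j => ellGamma p q (t j * z) * ellGamma p q (t j * z⁻¹)]

theorem continuousOn_ellWeight (hp : ‖p‖ < 1) (hq : ‖q‖ < 1) {X : Type*} [TopologicalSpace X]
    {S : Set X} {t : X → ι → ℂ} {ζ : X → ℂ} (ht : ∀ j, ContinuousOn (fun x => t x j) S)
    (hζ : ContinuousOn ζ S) (ht0 : ∀ x ∈ S, ∀ j, t x j ≠ 0) (ht1 : ∀ x ∈ S, ∀ j, ‖t x j‖ < 1)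
    (hζ1 : ∀ x ∈ S, ‖ζ x‖ = 1) : ContinuousOn (fun x => ellWeight p q (t x) (ζ x)) S := by
  intro x hx
  have hz0 : ∀ x ∈ S, ζ x ≠ 0 := fun x hx h => by simpa [h] using hζ1 x hx
  have key : ∀ f : X → ℂ, ContinuousWithinAt f S x → f x ≠ 0 → ‖f x‖ < 1 →
      ContinuousWithinAt (fun x => ellGamma p q (f x)) S x := fun f hf h0 h1 =>
    ContinuousAt.comp_continuousWithinAt (f := f)
      (differentiableAt_ellGamma hp hq h0 h1).continuousAt hf
  have key2 : ∀ (p : ℂ), ‖p‖ < 1 → ∀ f : X → ℂ, ContinuousWithinAt f S x → f x ≠ 0 →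
      ContinuousWithinAt (fun x => theta p (f x)) S x := fun p hp f hf h0 =>
    ContinuousAt.comp_continuousWithinAt (f := f) (differentiableAt_theta hp h0).continuousAt hf
  have hζi : ContinuousWithinAt (fun x => (ζ x)⁻¹) S x := (hζ x hx).inv₀ (hz0 x hx)
  have hz2 : ζ x ^ 2 ≠ 0 := pow_ne_zero 2 (hz0 x hx)
  unfold ellWeight
  refine ContinuousWithinAt.mul (tendsto_finsetProd _ fun j _ => ?_) ?_
  · exact (key _ ((ht j x hx).mul (hζ x hx)) (mul_ne_zero (ht0 x hx j) (hz0 x hx))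
      (by simpa [hζ1 x hx] using ht1 x hx j)).mul
      (key _ ((ht j x hx).mul hζi) (mul_ne_zero (ht0 x hx j) (inv_ne_zero (hz0 x hx)))
      (by simpa [hζ1 x hx] using ht1 x hx j))
  · exact (key2 p hp _ ((hζ x hx).pow 2) hz2).mul
      (key2 q hq _ (((hζ x hx).pow 2).inv₀ hz2) (inv_ne_zero hz2))

theorem continuousOn_ellWeight_sphere (hp : ‖p‖ < 1) (hq : ‖q‖ < 1) {t : ι → ℂ}
    (ht0 : ∀ j, t j ≠ 0) (ht1 : ∀ j, ‖t j‖ < 1) :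
    ContinuousOn (ellWeight p q t) (Metric.sphere 0 1) :=
  continuousOn_ellWeight hp hq (t := fun _ => t) (fun _ => continuousOn_const) continuousOn_id
    (fun _ _ => ht0) (fun _ _ => ht1) (fun x hx => by simpa using hx)

theorem circleIntegrable_ellWeight (hp : ‖p‖ < 1) (hq : ‖q‖ < 1) {t : ι → ℂ}
    (ht0 : ∀ j, t j ≠ 0) (ht1 : ∀ j, ‖t j‖ < 1) : CircleIntegrable (ellWeight p q t) 0 1 :=
  (continuousOn_ellWeight_sphere hp hq ht0 ht1).circleIntegrable zero_le_one

/-! ### The contiguity relation -/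

/-- The function `G` with `G(1/(q z)) = -G(z)` such that the combination of integrands in the
contiguity relation is a multiple of `G(z) + G(1/z)`; see `contigKernel_inv_mul` and
`contigKernel_identity`. -/
noncomputable def contigKernel (p q : ℂ) (x : Fin 6 → ℂ) (z : ℂ) : ℂ :=
  (∏ j, ellGamma p q (q * (x j * z)) * ellGamma p q (x j * z⁻¹)) * (theta q ((z ^ 2)⁻¹) * z⁻¹)

theorem contigKernel_inv_mul (hq0 : q ≠ 0) (hq : ‖q‖ < 1) (x : Fin 6 → ℂ) {z : ℂ} (hz : z ≠ 0) :
    contigKernel p q x (q * z)⁻¹ = -contigKernel p q x z := by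
  have h1 : ((((q * z)⁻¹) ^ 2)⁻¹) = q * (q * z ^ 2) := by rw [inv_pow, inv_inv]; ring
  have h2 := theta_mul hq0 hq (mul_ne_zero hq0 (pow_ne_zero 2 hz))
  have h3 := theta_mul hq0 hq (pow_ne_zero 2 hz)
  have h4 := theta_inv hq (pow_ne_zero 2 hz)
  simp only [contigKernel, h1, h2, h3, h4, inv_inv]
  rw [← mul_neg]
  congr 1
  · refine Finset.prod_congr rfl fun j _ => ?_
    rw [mul_comm]
    congr 2
    · ring
    · field_simp
  · field_simp

theorem differentiableAt_contigKernel (hp : ‖p‖ < 1) (hq0 : q ≠ 0) (hq : ‖q‖ < 1) {x : Fin 6 → ℂ}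
    (hx0 : ∀ j, x j ≠ 0) (hx : ∀ j, ‖x j‖ < 1) {z : ℂ} (hz : 1 ≤ ‖z‖) (hqz : ‖q * z‖ ≤ 1) :
    DifferentiableAt ℂ (contigKernel p q x) z := by
  have hz0 : z ≠ 0 := norm_pos_iff.mp (one_pos.trans_le hz)
  have h1 : ∀ j, DifferentiableAt ℂ (fun z => ellGamma p q (q * (x j * z))) z := fun j => by
    refine DifferentiableAt.comp (f := fun z => q * (x j * z)) z (differentiableAt_ellGamma hp hq
      (mul_ne_zero hq0 (mul_ne_zero (hx0 j) hz0)) ?_) (by fun_prop)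
    rw [mul_left_comm, norm_mul]
    exact (mul_le_of_le_one_right (norm_nonneg _) hqz).trans_lt (hx j)
  have hi := differentiableAt_inv (𝕜 := ℂ) hz0
  have h2 : ∀ j, DifferentiableAt ℂ (fun z => ellGamma p q (x j * z⁻¹)) z := fun j => by
    refine DifferentiableAt.comp (f := fun z => x j * z⁻¹) z (differentiableAt_ellGamma hp hq
      (mul_ne_zero (hx0 j) (inv_ne_zero hz0)) ?_) (by fun_prop (disch := assumption))
    rw [norm_mul, norm_inv]
    exact (mul_le_of_le_one_right (norm_nonneg _) (inv_le_one_of_one_le₀ hz)).trans_lt (hx j)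
  have hz2 := pow_ne_zero 2 hz0
  have h3 : DifferentiableAt ℂ (fun z => theta q ((z ^ 2)⁻¹)) z :=
    DifferentiableAt.comp (f := fun z : ℂ => (z ^ 2)⁻¹) z
      (differentiableAt_theta hq (inv_ne_zero hz2)) (by fun_prop (disch := assumption))
  exact (DifferentiableAt.fun_finsetProd fun j _ => (h1 j).mul (h2 j)).mul (h3.mul hi)

theorem circleAverage_contigKernel (hp : ‖p‖ < 1) (hq0 : q ≠ 0) (hq : ‖q‖ < 1) {x : Fin 6 → ℂ}
    (hx0 : ∀ j, x j ≠ 0) (hx : ∀ j, ‖x j‖ < 1) :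
    Real.circleAverage (contigKernel p q x) 0 1 = 0 := by
  obtain ⟨c, hc⟩ : ∃ c : ℂ, c ^ 2 = q⁻¹ := IsAlgClosed.exists_pow_nat_eq q⁻¹ two_pos
  have hqpos := norm_pos_iff.mpr hq0
  have hcn : ‖c‖ ^ 2 = ‖q‖⁻¹ := by rw [← norm_pow, hc, norm_inv]
  have hc0 : c ≠ 0 := by rintro rfl; simp [eq_comm, hq0] at hc
  have hc1 : 1 ≤ ‖c‖ := by
    by_contra! h
    have h1 : ‖c‖ ^ 2 < 1 := pow_lt_one₀ (norm_nonneg _) h two_ne_zero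
    rw [hcn] at h1
    exact absurd h1 (not_lt.mpr ((one_le_inv₀ hqpos).mpr hq.le))
  -- move the contour to the circle that is invariant under `z ↦ 1 / (q z)`
  rw [← circleAverage_eq_of_differentiableAt hc1 fun z h1 h2 =>
    differentiableAt_contigKernel hp hq0 hq hx0 hx h1 ?_, ← circleAverage_comp_mul]
  · have h := Real.circleAverage_zero_one_congr_inv (f := fun z => contigKernel p q x (c * z))
    have h2 : Real.circleAverage (fun z => contigKernel p q x (c * z⁻¹)) 0 1 =
        -Real.circleAverage (fun z => contigKernel p q x (c * z)) 0 1 := by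
      rw [← neg_one_smul ℝ (Real.circleAverage _ 0 1), ← Real.circleAverage_fun_smul]
      refine Real.circleAverage_congr_sphere fun z hz => ?_
      have hz0 : z ≠ 0 := by rintro rfl; simp at hz
      have e : c * z⁻¹ = (q * (c * z))⁻¹ := by
        have : q = (c ^ 2)⁻¹ := by rw [hc, inv_inv]
        rw [this]; field_simp
      simp only [e, contigKernel_inv_mul hq0 hq x (mul_ne_zero hc0 hz0), neg_smul, one_smul]
    rw [h] at h2
    exact self_eq_neg.mp h2
  · rw [norm_mul]
    calc ‖q‖ * ‖z‖ ≤ ‖q‖ * ‖c‖ := by gcongr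
      _ ≤ ‖q‖ * ‖c‖ ^ 2 := by gcongr; exact le_self_pow₀ hc1 two_ne_zero
      _ = 1 := by rw [hcn, mul_inv_cancel₀ hqpos.ne']

/-- The theta function identity, multiplied by gamma functions: `Γ(q x z^{±1})` is turned into
`Γ(x z^{±1})` by the functional equation. -/
theorem contigKernel_identity (hp0 : p ≠ 0) (hq0 : q ≠ 0) (hp : ‖p‖ < 1) (hq : ‖q‖ < 1)
    {a b c d e u : ℂ} (h : a * b * c * d * e * u = p)
    (hx : ∀ j, ‖(![a, b, c, d, e, u] : Fin 6 → ℂ) j‖ < 1) {z : ℂ} (hz : ‖z‖ = 1) :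
    ellWeight p q ![q * a, b, c, d, e, u] z *
        (theta p (u * b) * theta p (u * c) * theta p (u * d) * theta p (u * e)) -
      ellWeight p q ![a, b, c, d, e, q * u] z *
        (theta p (a * b) * theta p (a * c) * theta p (a * d) * theta p (a * e)) =
    -(a * theta p (u / a)) * (contigKernel p q ![a, b, c, d, e, u] z +
      contigKernel p q ![a, b, c, d, e, u] z⁻¹) := by
  have hz0 : z ≠ 0 := by rintro rfl; simp at hz
  have hz2 := theta_inv hq (pow_ne_zero 2 hz0)
  have key : ∀ x : ℂ, ‖x‖ < 1 → ellGamma p q (q * (x * z)) = theta p (x * z) * ellGamma p q (x * z) ∧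
      ellGamma p q (q * (x * z⁻¹)) = theta p (x * z⁻¹) * ellGamma p q (x * z⁻¹) := fun x hx =>
    ⟨ellGamma_mul_right hp hq hq0 (by simpa [hz] using hx),
      ellGamma_mul_right hp hq hq0 (by simpa [hz] using hx)⟩
  obtain ⟨ka, ka'⟩ := key a (hx 0)
  obtain ⟨kb, kb'⟩ := key b (hx 1)
  obtain ⟨kc, kc'⟩ := key c (hx 2)
  obtain ⟨kd, kd'⟩ := key d (hx 3)
  obtain ⟨ke, ke'⟩ := key e (hx 4)
  obtain ⟨ku, ku'⟩ := key u (hx 5)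
  have hE := thetaDefect_eq_zero hp0 hp h hz0
  rw [thetaDefect] at hE
  simp only [ellWeight, contigKernel, Fin.prod_univ_six, Matrix.cons_val, inv_inv, inv_pow,
    mul_assoc q a, mul_assoc q u, ka, ka', kb, kb', kc, kc', kd, kd', ke, ke', ku, ku', hz2]
  generalize theta p (z ^ 2) = Θ at *
  generalize theta p (u / a) = Θ' at *
  generalize theta q (z ^ 2) = Q at *
  generalize ellGamma p q (a * z) = A1
  generalize ellGamma p q (b * z) = B1
  generalize ellGamma p q (c * z) = C1
  generalize ellGamma p q (d * z) = D1
  generalize ellGamma p q (e * z) = E1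
  generalize ellGamma p q (u * z) = U1
  generalize ellGamma p q (a * z⁻¹) = A2
  generalize ellGamma p q (b * z⁻¹) = B2
  generalize ellGamma p q (c * z⁻¹) = C2
  generalize ellGamma p q (d * z⁻¹) = D2
  generalize ellGamma p q (e * z⁻¹) = E2
  generalize ellGamma p q (u * z⁻¹) = U2
  generalize theta p (a * z⁻¹) = A3 at *
  generalize theta p (b * z⁻¹) = B3 at *
  generalize theta p (c * z⁻¹) = C3 at *
  generalize theta p (d * z⁻¹) = D3 at *
  generalize theta p (e * z⁻¹) = E3 at *
  generalize theta p (u * z⁻¹) = U3 at *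
  have hw : z * z⁻¹ = 1 := mul_inv_cancel₀ hz0
  rw [← inv_pow]
  generalize z⁻¹ = w at *
  linear_combination (-(A1 * B1 * C1 * D1 * E1 * U1 * A2 * B2 * C2 * D2 * E2 * U2 * w ^ 2 * Q)) * hE -
    (A1 * B1 * C1 * D1 * E1 * U1 * A2 * B2 * C2 * D2 * E2 * U2 * Q * a * Θ' *
      A3 * B3 * C3 * D3 * E3 * U3 * z * (z * w + 1)) * hw

/-- The contiguity relation: the average of `G(z) + G(1/z)` is zero. -/
theorem ellInt_contiguous (hp0 : p ≠ 0) (hq0 : q ≠ 0) (hp : ‖p‖ < 1) (hq : ‖q‖ < 1)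
    {a b c d e u : ℂ} (h : a * b * c * d * e * u = p)
    (hx : ∀ j, ‖(![a, b, c, d, e, u] : Fin 6 → ℂ) j‖ < 1) :
    ellInt p q ![q * a, b, c, d, e, u] *
        (theta p (u * b) * theta p (u * c) * theta p (u * d) * theta p (u * e)) =
      ellInt p q ![a, b, c, d, e, q * u] *
        (theta p (a * b) * theta p (a * c) * theta p (a * d) * theta p (a * e)) := by
  have h0 : a * b * c * d * e * u ≠ 0 := h ▸ hp0
  obtain ⟨⟨⟨⟨⟨ha, hb⟩, hc⟩, hd⟩, he⟩, hu⟩ :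
      ((((a ≠ 0 ∧ b ≠ 0) ∧ c ≠ 0) ∧ d ≠ 0) ∧ e ≠ 0) ∧ u ≠ 0 := by
    simpa only [mul_ne_zero_iff] using h0
  obtain ⟨xa, xb, xc, xd, xe, xu⟩ : ‖a‖ < 1 ∧ ‖b‖ < 1 ∧ ‖c‖ < 1 ∧ ‖d‖ < 1 ∧ ‖e‖ < 1 ∧ ‖u‖ < 1 :=
    ⟨hx 0, hx 1, hx 2, hx 3, hx 4, hx 5⟩
  have hqa : ‖q * a‖ < 1 := by
    rw [norm_mul]; exact mul_lt_one_of_nonneg_of_lt_one_left (norm_nonneg _) hq xa.le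
  have hqu : ‖q * u‖ < 1 := by
    rw [norm_mul]; exact mul_lt_one_of_nonneg_of_lt_one_left (norm_nonneg _) hq xu.le
  have hx0 : ∀ j, (![a, b, c, d, e, u] : Fin 6 → ℂ) j ≠ 0 := by
    simp [Fin.forall_fin_succ, ha, hb, hc, hd, he, hu]
  have i1 : CircleIntegrable (ellWeight p q ![q * a, b, c, d, e, u]) 0 1 :=
    circleIntegrable_ellWeight hp hq (by simp [Fin.forall_fin_succ, ha, hb, hc, hd, he, hu, hq0])
      (by simp [-norm_mul, -Complex.norm_mul, Fin.forall_fin_succ, hqa, xb, xc, xd, xe, xu])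
  have i2 : CircleIntegrable (ellWeight p q ![a, b, c, d, e, q * u]) 0 1 :=
    circleIntegrable_ellWeight hp hq (by simp [Fin.forall_fin_succ, ha, hb, hc, hd, he, hu, hq0])
      (by simp [-norm_mul, -Complex.norm_mul, Fin.forall_fin_succ, hqu, xa, xb, xc, xd, xe])
  have i3 : CircleIntegrable (contigKernel p q ![a, b, c, d, e, u]) 0 1 := by
    refine ContinuousOn.circleIntegrable zero_le_one fun z hz => ?_
    have hz1 : ‖z‖ = 1 := by simpa using hz
    exact (differentiableAt_contigKernel hp hq0 hq hx0 hx hz1.ge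
      (by rw [norm_mul, hz1, mul_one]; exact hq.le)).continuousAt.continuousWithinAt
  have i4 : CircleIntegrable (fun z => contigKernel p q ![a, b, c, d, e, u] z⁻¹) 0 1 := by
    refine ContinuousOn.circleIntegrable zero_le_one fun z hz => ?_
    have hz1 : ‖z‖ = 1 := by simpa using hz
    have hz0 : z ≠ 0 := by rintro rfl; simp at hz1
    have := (differentiableAt_contigKernel (z := z⁻¹) hp hq0 hq hx0 hx (by rw [norm_inv, hz1, inv_one])
      (by rw [norm_mul, norm_inv, hz1, inv_one, mul_one]; exact hq.le)).continuousAt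
    exact (ContinuousAt.comp (f := fun z => z⁻¹) this (continuousAt_inv₀ hz0)).continuousWithinAt
  have h0 := circleAverage_contigKernel hp hq0 hq hx0 hx
  have h1 := Real.circleAverage_zero_one_congr_inv (f := contigKernel p q ![a, b, c, d, e, u])
  have h2 := Real.circleAverage_congr_sphere (c := 0) (R := 1) fun z hz =>
    contigKernel_identity hp0 hq0 hp hq h hx (z := z) (by simpa using hz)
  generalize theta p (u * b) * theta p (u * c) * theta p (u * d) * theta p (u * e) = B at *
  generalize theta p (a * b) * theta p (a * c) * theta p (a * d) * theta p (a * e) = D at *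
  rw [Real.circleAverage_fun_sub (circleIntegrable_mul_const i1 B) (circleIntegrable_mul_const i2 D),
    circleAverage_mul_const, circleAverage_mul_const] at h2
  rw [← sub_eq_zero, ellInt, ellInt, h2]
  simp only [mul_comm (-(a * theta p (u / a)))]
  rw [circleAverage_mul_const, Real.circleAverage_fun_add i3 i4, h1, h0]
  ring

end

section

/-! ### Holomorphic dependence on parameters -/

/-- A circle average of functions depending holomorphically on a parameter is holomorphic. -/
theorem differentiableOn_circleAverage {F : ℂ → ℂ → ℂ} {U : Set ℂ} (hU : IsOpen U)
    (hc : ContinuousOn (Function.uncurry F) (U ×ˢ Metric.sphere 0 1))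
    (hd : ∀ z ∈ Metric.sphere (0 : ℂ) 1, DifferentiableOn ℂ (fun x => F x z) U) :
    DifferentiableOn ℂ (fun x => Real.circleAverage (F x) 0 1) U := by
  intro x₀ hx₀
  obtain ⟨r₀, hr₀, hball⟩ := Metric.isOpen_iff.mp hU x₀ hx₀
  set r := r₀ / 3 with hr
  have hrpos : 0 < r := by positivity
  have hcb : Metric.closedBall x₀ (2 * r) ⊆ U := fun y hy =>
    hball (by simp only [Metric.mem_closedBall, Metric.mem_ball] at *; linarith)
  have hsph : ∀ θ : ℝ, circleMap 0 1 θ ∈ Metric.sphere (0 : ℂ) 1 := fun θ =>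
    circleMap_mem_sphere _ zero_le_one θ
  obtain ⟨M, hM⟩ := ((isCompact_closedBall x₀ (2 * r)).prod
    (isCompact_sphere (0 : ℂ) 1)).exists_bound_of_continuousOn
      (hc.mono (prod_mono hcb Subset.rfl))
  have hcθ : ∀ x ∈ U, Continuous fun θ : ℝ => F x (circleMap 0 1 θ) := fun x hx =>
    hc.comp_continuous (f := fun θ : ℝ => (x, circleMap 0 1 θ))
      (continuous_const.prodMk (continuous_circleMap 0 1)) fun θ => ⟨hx, hsph θ⟩
  have hda : ∀ x ∈ U, ∀ θ : ℝ, DifferentiableAt ℂ (fun x => F x (circleMap 0 1 θ)) x :=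
    fun x hx θ => (hd _ (hsph θ)).differentiableAt (hU.mem_nhds hx)
  have hball1 : Metric.ball x₀ r ⊆ U := fun y hy =>
    hcb (by simp only [Metric.mem_closedBall, Metric.mem_ball] at *; linarith)
  have key := intervalIntegral.hasDerivAt_integral_of_dominated_loc_of_deriv_le
    (μ := MeasureTheory.volume) (a := 0) (b := 2 * Real.pi) (x₀ := x₀)
    (F := fun x θ => F x (circleMap 0 1 θ))
    (F' := fun x θ => deriv (fun y => F y (circleMap 0 1 θ)) x) (bound := fun _ => M / r)
    (Metric.ball_mem_nhds x₀ hrpos)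
    (by filter_upwards [hU.mem_nhds hx₀] with x hx using (hcθ x hx).aestronglyMeasurable)
    ((hcθ x₀ hx₀).intervalIntegrable _ _) ?_
    (Eventually.of_forall fun θ _ x hx => ?_) intervalIntegrable_const
    (Eventually.of_forall fun θ _ x hx => (hda x (hball1 hx) θ).hasDerivAt)
  · exact (key.2.const_smul ((2 * Real.pi)⁻¹ : ℝ)).differentiableAt.differentiableWithinAt
  · -- the derivative is a pointwise limit of difference quotients, hence measurable
    let h : ℕ → ℂ := fun n => ((r / (n + 2) : ℝ) : ℂ)
    have hhpos : ∀ n : ℕ, 0 < r / ((n : ℝ) + 2) := fun n => by positivity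
    have hU' : ∀ n, x₀ + h n ∈ U := fun n => hball1 (by
      rw [Metric.mem_ball, dist_self_add_left, norm_real, Real.norm_of_nonneg (hhpos n).le]
      exact div_lt_self hrpos (by linarith [n.cast_nonneg (α := ℝ)]))
    have hlim : Tendsto h atTop (𝓝[≠] 0) := by
      refine tendsto_nhdsWithin_iff.mpr ⟨?_, Eventually.of_forall fun n =>
        ofReal_ne_zero.mpr (hhpos n).ne'⟩
      rw [← ofReal_zero]
      exact (continuous_ofReal.tendsto 0).comp (tendsto_const_nhds.div_atTop
        (tendsto_atTop_add_const_right _ _ tendsto_natCast_atTop_atTop))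
    refine aestronglyMeasurable_of_tendsto_ae atTop
      (f := fun n θ => (h n)⁻¹ • (F (x₀ + h n) (circleMap 0 1 θ) - F x₀ (circleMap 0 1 θ)))
      (fun n => ?_) (Eventually.of_forall fun θ => ?_)
    · exact (((hcθ _ (hU' n)).sub (hcθ _ hx₀)).const_smul ((h n)⁻¹)).aestronglyMeasurable
    · exact (hda x₀ hx₀ θ).hasDerivAt.tendsto_slope_zero.comp hlim
  · have hsub : Metric.closedBall x r ⊆ Metric.closedBall x₀ (2 * r) :=
      Metric.closedBall_subset_closedBall' (by
        have := Metric.mem_ball.mp hx; linarith)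
    refine norm_deriv_le_of_forall_mem_sphere_norm_le hrpos
      (DifferentiableOn.diffContOnCl fun y hy => ?_) fun y hy =>
        hM (y, circleMap 0 1 θ) ⟨hsub (Metric.sphere_subset_closedBall hy), hsph θ⟩
    exact (hda y (hcb (hsub (Metric.closure_ball_subset_closedBall hy))) θ).differentiableWithinAt

theorem differentiableOn_ellGamma_comp {p q : ℂ} (hp : ‖p‖ < 1) (hq : ‖q‖ < 1) {f : ℂ → ℂ}
    {U : Set ℂ} (hf : DifferentiableOn ℂ f U) (h0 : ∀ x ∈ U, f x ≠ 0) (h1 : ∀ x ∈ U, ‖f x‖ < 1) :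
    DifferentiableOn ℂ (fun x => ellGamma p q (f x)) U := fun x hx =>
  (differentiableAt_ellGamma hp hq (h0 x hx) (h1 x hx)).comp_differentiableWithinAt x (hf x hx)

theorem differentiableOn_ellInt {p q : ℂ} (hp : ‖p‖ < 1) (hq : ‖q‖ < 1) {ι : Type*} [Fintype ι]
    {t : ℂ → ι → ℂ} {U : Set ℂ} (hU : IsOpen U) (ht : ∀ j, DifferentiableOn ℂ (fun x => t x j) U)
    (ht0 : ∀ x ∈ U, ∀ j, t x j ≠ 0) (ht1 : ∀ x ∈ U, ∀ j, ‖t x j‖ < 1) :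
    DifferentiableOn ℂ (fun x => ellInt p q (t x)) U := by
  refine differentiableOn_circleAverage hU ?_ fun z hz => ?_
  · refine continuousOn_ellWeight hp hq (t := fun y : ℂ × ℂ => t y.1) (ζ := fun y => y.2)
      (fun j => ?_) continuousOn_snd (fun y hy => ht0 _ hy.1) (fun y hy => ht1 _ hy.1)
      (fun y hy => by simpa using hy.2)
    exact (ht j).continuousOn.comp continuousOn_fst fun y hy => hy.1
  · have hz1 : ‖z‖ = 1 := by simpa using hz
    have hz0 : z ≠ 0 := by rintro rfl; simp at hz1
    have key : ∀ w : ℂ, ‖w‖ = 1 → ∀ j,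
        DifferentiableOn ℂ (fun x => ellGamma p q (t x j * w)) U := fun w hw j =>
      differentiableOn_ellGamma_comp hp hq ((ht j).mul_const w)
        (fun x hx => mul_ne_zero (ht0 x hx j) (by rintro rfl; simp at hw))
        (fun x hx => by simpa [hw] using ht1 x hx j)
    exact (DifferentiableOn.fun_finsetProd fun j _ =>
      (key z hz1 j).mul (key z⁻¹ (by rw [norm_inv, hz1, inv_one]) j)).mul_const _

/-- The identity principle on an open convex subset of `ℂⁿ`, for functions that are holomorphic
along complex lines. -/
theorem eq_of_eventuallyEq_of_lines {n : ℕ} {S : Set (Fin n → ℂ)} (hS : IsOpen S)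
    (hconv : Convex ℝ S) {A B : (Fin n → ℂ) → ℂ}
    (hA : ∀ (U : Set ℂ) (γ : ℂ → Fin n → ℂ), IsOpen U → Differentiable ℂ γ → (∀ x ∈ U, γ x ∈ S) →
      DifferentiableOn ℂ (fun x => A (γ x)) U)
    (hB : ∀ (U : Set ℂ) (γ : ℂ → Fin n → ℂ), IsOpen U → Differentiable ℂ γ → (∀ x ∈ U, γ x ∈ S) →
      DifferentiableOn ℂ (fun x => B (γ x)) U)
    {x₀ : Fin n → ℂ} (hx₀ : x₀ ∈ S) (hAB : A =ᶠ[𝓝 x₀] B) {y : Fin n → ℂ} (hy : y ∈ S) :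
    A y = B y := by
  let γ : ℂ → Fin n → ℂ := fun x => x₀ + x • (y - x₀)
  have hγ : Differentiable ℂ γ := by fun_prop
  have hUo : IsOpen (γ ⁻¹' S) := hS.preimage hγ.continuous
  have hUc : Convex ℝ (γ ⁻¹' S) := by
    intro z hz w hw a b ha hb hab
    have : γ (a • z + b • w) = a • γ z + b • γ w := by
      have hab' : (a : ℂ) + b = 1 := by exact_mod_cast hab
      ext j
      simp only [γ, Pi.add_apply, Pi.smul_apply, Pi.sub_apply, smul_eq_mul, real_smul]
      linear_combination -(x₀ j) * hab'
    rw [mem_preimage, this]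
    exact hconv hz hw ha hb hab
  have h0 : γ 0 = x₀ := by simp [γ]
  have h1 : γ 1 = y := by simp [γ]
  have h := ((hA _ γ hUo hγ fun _ => id).analyticOnNhd hUo).eqOn_of_preconnected_of_eventuallyEq
    ((hB _ γ hUo hγ fun _ => id).analyticOnNhd hUo) hUc.isPreconnected (z₀ := 0)
    (by rw [mem_preimage, h0]; exact hx₀)
    ((hγ.continuous.tendsto' 0 x₀ h0).eventually hAB)
  have := h (x := 1) (by rw [mem_preimage, h1]; exact hy)
  simpa only [h1] using this

/-! ### A Poisson kernel -/

theorem norm_circleAverage_le (f : ℂ → ℂ) (c : ℂ) (R : ℝ) :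
    ‖Real.circleAverage f c R‖ ≤ Real.circleAverage (fun z => ‖f z‖) c R := by
  rw [Real.circleAverage_def, Real.circleAverage_def, norm_smul, smul_eq_mul,
    Real.norm_of_nonneg (by positivity)]
  gcongr
  exact intervalIntegral.norm_integral_le_integral_norm (by positivity)

theorem circleAverage_ofReal (f : ℂ → ℝ) (c : ℂ) (R : ℝ) :
    Real.circleAverage (fun z => (f z : ℂ)) c R = (Real.circleAverage f c R : ℝ) := by
  rw [Real.circleAverage_def, Real.circleAverage_def, intervalIntegral.integral_ofReal]
  simp

/-- The Poisson kernel of the unit disc at the point `-r²`, evaluated at `z²`. -/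
noncomputable def sqPoisson (r : ℝ) (z : ℂ) : ℝ := (1 - r ^ 4) / ‖1 + r ^ 2 * z ^ 2‖ ^ 2

theorem one_sub_sq_le_norm {r : ℝ} {z : ℂ} (hz : ‖z‖ = 1) :
    1 - r ^ 2 ≤ ‖1 + (r : ℂ) ^ 2 * z ^ 2‖ := by
  have h := norm_sub_norm_le (1 : ℂ) (-((r : ℂ) ^ 2 * z ^ 2))
  simpa [hz] using h

theorem one_add_ne_zero_of_norm {r : ℝ} (hr : r ^ 2 < 1) {z : ℂ} (hz : ‖z‖ ≤ 1) :
    1 + (r : ℂ) ^ 2 * z ^ 2 ≠ 0 := by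
  intro h
  have h1 : ‖(r : ℂ) ^ 2 * z ^ 2‖ = 1 := by rw [← norm_neg, ← eq_neg_of_add_eq_zero_left h, norm_one]
  rw [norm_mul, norm_pow, norm_pow, norm_real, Real.norm_eq_abs, sq_abs] at h1
  have : ‖z‖ ^ 2 ≤ 1 := pow_le_one₀ (norm_nonneg _) hz
  nlinarith [sq_nonneg r]

theorem sqPoisson_eq (r : ℝ) {z : ℂ} (hz : ‖z‖ = 1) :
    (sqPoisson r z : ℂ) = (1 - r ^ 4) / ((1 + r ^ 2 * z ^ 2) * (1 + r ^ 2 * (z⁻¹) ^ 2)) := by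
  have hc : z⁻¹ = (starRingEnd ℂ) z := by
    rw [inv_def, normSq_eq_norm_sq, hz]; simp
  have h : (1 + (r : ℂ) ^ 2 * z ^ 2) * (1 + r ^ 2 * (z⁻¹) ^ 2) =
      ((‖1 + (r : ℂ) ^ 2 * z ^ 2‖ ^ 2 : ℝ) : ℂ) := by
    rw [ofReal_pow, ← mul_conj', hc]
    simp
  rw [h, sqPoisson]
  push_cast
  rfl

theorem sqPoisson_nonneg {r : ℝ} (hr : r ^ 2 < 1) (z : ℂ) : 0 ≤ sqPoisson r z := by
  refine div_nonneg ?_ (sq_nonneg _)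
  nlinarith [sq_nonneg r]

theorem continuousOn_sqPoisson {r : ℝ} (hr : r ^ 2 < 1) :
    ContinuousOn (sqPoisson r) (Metric.sphere 0 1) := by
  refine ContinuousOn.div (by fun_prop) (by fun_prop) fun z hz => ?_
  exact pow_ne_zero 2 (norm_ne_zero_iff.mpr (one_add_ne_zero_of_norm hr (by simpa using hz.le)))

theorem circleAverage_sqPoisson {r : ℝ} (hr : r ^ 2 < 1) :
    Real.circleAverage (sqPoisson r) 0 1 = 1 := by
  let k : ℂ → ℂ := fun z => (1 + (r : ℂ) ^ 2 * z ^ 2)⁻¹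
  have hd : ∀ z : ℂ, ‖z‖ ≤ 1 → DifferentiableAt ℂ k z := fun z hz => by
    have := one_add_ne_zero_of_norm hr hz
    exact DifferentiableAt.fun_inv (by fun_prop) this
  have h1 : Real.circleAverage k 0 1 = 1 := by
    rw [circleAverage_of_differentiable_on_off_countable (countable_empty) (f := k)
      (fun z hz => (hd z (by simpa using hz)).continuousAt.continuousWithinAt)
      (fun z hz => hd z (by have := hz.1; simp at this; exact this.le))]
    simp [k]
  have hci : ∀ z : ℂ, ‖z‖ = 1 → ContinuousAt (fun z => k z⁻¹) z := fun z hz => by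
    have hz0 : z ≠ 0 := by rintro rfl; simp at hz
    exact ContinuousAt.comp (f := fun z : ℂ => z⁻¹)
      (hd z⁻¹ (by rw [norm_inv, hz, inv_one])).continuousAt (continuousAt_inv₀ hz0)
  have i1 : CircleIntegrable k 0 1 := ContinuousOn.circleIntegrable zero_le_one fun z hz =>
    (hd z (by simpa using hz.le)).continuousAt.continuousWithinAt
  have i2 : CircleIntegrable (fun z => k z⁻¹) 0 1 := ContinuousOn.circleIntegrable zero_le_one
    fun z hz => (hci z (by simpa using hz)).continuousWithinAt
  have h2 : Real.circleAverage (fun z => (sqPoisson r z : ℂ)) 0 1 =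
      Real.circleAverage (fun z => (k z + k z⁻¹) - 1) 0 1 := by
    refine Real.circleAverage_congr_sphere fun z hz => ?_
    have hz : ‖z‖ = 1 := by simpa using hz
    have hz0 : z ≠ 0 := by rintro rfl; simp at hz
    have e1 := one_add_ne_zero_of_norm hr hz.le
    have e2 := one_add_ne_zero_of_norm (z := z⁻¹) hr (by rw [norm_inv, hz, inv_one])
    have hw : z * z⁻¹ = 1 := mul_inv_cancel₀ hz0
    simp only [sqPoisson_eq r hz, k]
    generalize z⁻¹ = w at *
    field_simp
    linear_combination ((r : ℂ) ^ 4 * (z * w + 1)) * hw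
  have i3 : CircleIntegrable (fun z => k z + k z⁻¹) 0 1 := CircleIntegrable.add i1 i2
  rw [Real.circleAverage_fun_sub i3 (circleIntegrable_const _ _ _),
    Real.circleAverage_fun_add i1 i2, Real.circleAverage_zero_one_congr_inv (f := k), h1,
    Real.circleAverage_const, circleAverage_ofReal] at h2
  norm_num at h2
  exact_mod_cast h2

/-- The kernels `sqPoisson r` concentrate at `±i` as `r → 1`. -/
theorem tendsto_circleAverage_mul_sqPoisson {M : ℝ → ℂ → ℂ} {r₀ : ℝ} (hr₀ : 0 < r₀) (hr₁ : r₀ < 1)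
    (hM : ContinuousOn (Function.uncurry M) (Icc r₀ 1 ×ˢ Metric.sphere 0 1)) {L : ℂ}
    (h1 : M 1 I = L) (h2 : M 1 (-I) = L) :
    Tendsto (fun r => Real.circleAverage (fun z => M r z * sqPoisson r z) 0 1) (𝓝[<] 1) (𝓝 L) := by
  have hK : IsCompact (Icc r₀ 1 ×ˢ Metric.sphere (0 : ℂ) 1) := isCompact_Icc.prod (isCompact_sphere _ _)
  have hg : ContinuousOn (fun x : ℝ × ℂ => ‖M x.1 x.2 - L‖) (Icc r₀ 1 ×ˢ Metric.sphere 0 1) :=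
    (hM.sub continuousOn_const).norm
  obtain ⟨B, hB⟩ := hK.exists_bound_of_continuousOn hg
  have hB0 : 0 ≤ B := (norm_nonneg _).trans (hB (1, 1) ⟨⟨hr₁.le, le_rfl⟩, by simp⟩)
  rw [Metric.tendsto_nhds]
  intro ε hε
  -- near the points `±i`, and for `r` near `1`, the function `M` is close to `L`
  obtain ⟨δ, hδ, hclose⟩ : ∃ δ > 0, ∀ x ∈ Icc r₀ 1 ×ˢ Metric.sphere (0 : ℂ) 1,
      1 - x.1 < δ → ‖1 + x.2 ^ 2‖ < δ → ‖M x.1 x.2 - L‖ ≤ ε / 2 := by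
    let K' := (Icc r₀ 1 ×ˢ Metric.sphere (0 : ℂ) 1) ∩ (fun x : ℝ × ℂ => ‖M x.1 x.2 - L‖) ⁻¹' Ici (ε / 2)
    have hK' : IsCompact K' := hK.of_isClosed_subset
      (hg.preimage_isClosed_of_isClosed hK.isClosed isClosed_Ici) inter_subset_left
    rcases K'.eq_empty_or_nonempty with he | hne
    · refine ⟨1, one_pos, fun x hx _ _ => ?_⟩
      by_contra! hlt
      exact notMem_empty x (he ▸ ⟨hx, hlt.le⟩)
    · obtain ⟨x₁, hx₁, hmin⟩ := hK'.exists_isMinOn hne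
        (f := fun x : ℝ × ℂ => max (1 - x.1) ‖1 + x.2 ^ 2‖) (by fun_prop)
      refine ⟨max (1 - x₁.1) ‖1 + x₁.2 ^ 2‖, ?_, fun x hx hxa hxb => ?_⟩
      · by_contra! hle
        obtain ⟨hle1, hle2⟩ := max_le_iff.mp hle
        have e1 : x₁.1 = 1 := le_antisymm hx₁.1.1.2 (by linarith)
        have e2 : 1 + x₁.2 ^ 2 = 0 := norm_le_zero_iff.mp hle2
        have e3 : x₁.2 = I ∨ x₁.2 = -I := by
          rw [← sq_eq_sq_iff_eq_or_eq_neg, I_sq]; linear_combination e2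
        have h3 : ε / 2 ≤ ‖M x₁.1 x₁.2 - L‖ := hx₁.2
        rcases e3 with e3 | e3 <;> rw [e1, e3] at h3 <;> simp [h1, h2] at h3 <;> linarith
      · by_contra! hlt
        have := hmin (a := x) ⟨hx, hlt.le⟩
        exact absurd this (not_le.mpr (max_lt hxa hxb))
  have hlim : Tendsto (fun r : ℝ => B * (4 * (1 - r ^ 4) / δ ^ 2)) (𝓝[<] 1) (𝓝 0) := by
    refine Tendsto.mono_left ?_ nhdsWithin_le_nhds
    have : Continuous fun r : ℝ => B * (4 * (1 - r ^ 4) / δ ^ 2) := by fun_prop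
    exact this.tendsto' 1 0 (by norm_num)
  have hev : ∀ᶠ r : ℝ in 𝓝[<] 1, max r₀ (1 - δ) < r :=
    nhdsWithin_le_nhds (lt_mem_nhds (max_lt hr₁ (by linarith)))
  filter_upwards [hlim.eventually_lt_const (half_pos hε), hev, self_mem_nhdsWithin] with r hr4 hr hr1
  obtain ⟨hra, hrb⟩ := max_lt_iff.mp hr
  have hrpos : 0 < r := hr₀.trans hra
  have hr1 : r < 1 := hr1
  have hr2 : r ^ 2 < 1 := pow_lt_one₀ hrpos.le hr1 two_ne_zero
  have hr4' : 0 ≤ 1 - r ^ 4 := by nlinarith [sq_nonneg r]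
  have hPc := continuousOn_sqPoisson hr2
  have hPc' : ContinuousOn (fun z => (sqPoisson r z : ℂ)) (Metric.sphere 0 1) :=
    continuous_ofReal.comp_continuousOn hPc
  have hMc : ContinuousOn (M r) (Metric.sphere 0 1) :=
    hM.comp (f := fun z : ℂ => (r, z)) (by fun_prop) fun z hz => ⟨⟨hra.le, hr1.le⟩, hz⟩
  have i1 : CircleIntegrable (fun z => M r z * (sqPoisson r z : ℂ)) 0 1 :=
    (hMc.mul hPc').circleIntegrable zero_le_one
  have i2 : CircleIntegrable (fun z => (sqPoisson r z : ℂ) * L) 0 1 :=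
    (hPc'.mul (continuousOn_const (c := L))).circleIntegrable zero_le_one
  have i3 : CircleIntegrable (fun z => ε / 2 * sqPoisson r z) 0 1 :=
    (continuousOn_const.mul hPc).circleIntegrable zero_le_one
  have e1 : Real.circleAverage (fun z => M r z * sqPoisson r z) 0 1 - L =
      Real.circleAverage (fun z => (M r z - L) * sqPoisson r z) 0 1 := by
    have e2 : Real.circleAverage (fun z => (sqPoisson r z : ℂ) * L) 0 1 = L := by
      rw [circleAverage_mul_const, circleAverage_ofReal, circleAverage_sqPoisson hr2]; simp
    rw [← e2, ← Real.circleAverage_fun_sub i1 i2, e2]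
    congr 1; ext z; ring
  rw [dist_eq_norm, e1]
  refine (norm_circleAverage_le _ _ _).trans_lt ?_
  have hle : Real.circleAverage (fun z => ‖(M r z - L) * sqPoisson r z‖) 0 1 ≤
      Real.circleAverage (fun z => ε / 2 * sqPoisson r z + B * (4 * (1 - r ^ 4) / δ ^ 2)) 0 1 := by
    refine Real.circleAverage_mono ?_ ?_ fun z hz => ?_
    · exact ((hMc.sub continuousOn_const).mul hPc').norm.circleIntegrable zero_le_one
    · exact ((continuousOn_const.mul hPc).add continuousOn_const).circleIntegrable zero_le_one
    · have hz' : z ∈ Metric.sphere (0 : ℂ) 1 := by simpa using hz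
      have hz1 : ‖z‖ = 1 := by simpa using hz
      have hmem : (r, z) ∈ Icc r₀ 1 ×ˢ Metric.sphere (0 : ℂ) 1 := ⟨⟨hra.le, hr1.le⟩, hz'⟩
      have hP := sqPoisson_nonneg hr2 z
      rw [norm_mul, norm_real, Real.norm_of_nonneg hP]
      rcases lt_or_ge ‖1 + z ^ 2‖ δ with hlt | hge
      · have := hclose (r, z) hmem (by simp only; linarith) hlt
        have h3 : 0 ≤ B * (4 * (1 - r ^ 4) / δ ^ 2) := by positivity
        have := mul_le_mul_of_nonneg_right this hP
        simp only at this
        linarith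
      · have hb : ‖M r z - L‖ ≤ B := by simpa using hB (r, z) hmem
        -- on the circle `|1 + z²| ≤ 2 |1 + r² z²|`
        have hn : δ / 2 ≤ ‖1 + (r : ℂ) ^ 2 * z ^ 2‖ := by
          have h3 : ‖1 + z ^ 2‖ ≤ ‖1 + (r : ℂ) ^ 2 * z ^ 2‖ + (1 - r ^ 2) := by
            have : 1 + z ^ 2 = (1 + (r : ℂ) ^ 2 * z ^ 2) + ((1 - r ^ 2 : ℝ) : ℂ) * z ^ 2 := by
              push_cast; ring
            rw [this]
            refine (norm_add_le _ _).trans ?_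
            rw [norm_mul, norm_real, norm_pow, hz1, Real.norm_of_nonneg (by linarith)]
            simp
          have := one_sub_sq_le_norm (r := r) hz1
          linarith
        have hPle : sqPoisson r z ≤ 4 * (1 - r ^ 4) / δ ^ 2 := by
          have : 4 * (1 - r ^ 4) / δ ^ 2 = (1 - r ^ 4) / (δ / 2) ^ 2 := by field_simp; ring
          rw [this, sqPoisson]
          gcongr
        have := mul_le_mul hb hPle hP hB0
        have h4 : 0 ≤ ε / 2 * sqPoisson r z := by positivity
        linarith
  refine hle.trans_lt ?_
  rw [Real.circleAverage_fun_add i3 (circleIntegrable_const _ _ _), Real.circleAverage_const]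
  have e3 : Real.circleAverage (fun z => ε / 2 * sqPoisson r z) 0 1 = ε / 2 := by
    have := Real.circleAverage_fun_smul (a := ε / 2) (f := sqPoisson r) (c := 0) (R := 1)
    simp only [smul_eq_mul, circleAverage_sqPoisson hr2, mul_one] at this
    exact this
  rw [e3]
  linarith

end

section

/-! ### The elliptic beta integral -/

/-- The product `∏_{j < k} Γ(tⱼ tₖ)`. -/
noncomputable def pairGamma (p q : ℂ) {n : ℕ} (t : Fin n → ℂ) : ℂ :=
  ∏ j, ∏ k ∈ Finset.Ioi j, ellGamma p q (t j * t k)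

variable {p q : ℂ}

theorem pairGamma_fin_six (t : Fin 6 → ℂ) : pairGamma p q t =
    (ellGamma p q (t 0 * t 1) * ellGamma p q (t 0 * t 2) * ellGamma p q (t 0 * t 3) *
      ellGamma p q (t 0 * t 4) * ellGamma p q (t 0 * t 5)) *
    (ellGamma p q (t 1 * t 2) * ellGamma p q (t 1 * t 3) * ellGamma p q (t 1 * t 4) *
      ellGamma p q (t 1 * t 5)) *
    (ellGamma p q (t 2 * t 3) * ellGamma p q (t 2 * t 4) * ellGamma p q (t 2 * t 5)) *
    (ellGamma p q (t 3 * t 4) * ellGamma p q (t 3 * t 5)) * ellGamma p q (t 4 * t 5) := by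
  simp [pairGamma, Fin.prod_univ_succ, Fin.prod_Ioi_succ]
  ring

theorem norm_mul_lt_one {x y : ℂ} (hx : ‖x‖ < 1) (hy : ‖y‖ < 1) : ‖x * y‖ < 1 := by
  rw [norm_mul]; exact mul_lt_one_of_nonneg_of_lt_one_left (norm_nonneg _) hx hy.le

theorem differentiableOn_pairGamma (hp : ‖p‖ < 1) (hq : ‖q‖ < 1) {n : ℕ} {t : ℂ → Fin n → ℂ}
    {U : Set ℂ} (ht : ∀ j, DifferentiableOn ℂ (fun x => t x j) U)
    (ht0 : ∀ x ∈ U, ∀ j, t x j ≠ 0) (ht1 : ∀ x ∈ U, ∀ j, ‖t x j‖ < 1) :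
    DifferentiableOn ℂ (fun x => pairGamma p q (t x)) U :=
  DifferentiableOn.fun_finsetProd fun j _ => DifferentiableOn.fun_finsetProd fun k _ =>
    differentiableOn_ellGamma_comp hp hq ((ht j).mul (ht k))
      (fun x hx => mul_ne_zero (ht0 x hx j) (ht0 x hx k))
      (fun x hx => norm_mul_lt_one (ht1 x hx j) (ht1 x hx k))

/-- If all `|tⱼ| < 1`, a product of two of at least three `tⱼ` exceeds the full product in modulus. -/
theorem norm_prod_lt_norm_mul {ι : Type*} [Fintype ι] {t : ι → ℂ} (h0 : ∀ j, t j ≠ 0)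
    (h1 : ∀ j, ‖t j‖ < 1) {j k l : ι} (hjk : j ≠ k) (hjl : j ≠ l) (hkl : k ≠ l) :
    ‖∏ i, t i‖ < ‖t j * t k‖ := by
  classical
  have hmem : l ∈ (Finset.univ.erase j).erase k := by simp [hjl.symm, hkl.symm]
  rw [← Finset.mul_prod_erase _ _ (Finset.mem_univ j), ← Finset.mul_prod_erase (Finset.univ.erase j) t
    (a := k) (by simp [hjk.symm]), ← mul_assoc, norm_mul, norm_prod]
  have hpos : 0 < ‖t j * t k‖ := norm_pos_iff.mpr (mul_ne_zero (h0 j) (h0 k))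
  refine mul_lt_of_lt_one_right hpos ?_
  calc ∏ i ∈ (Finset.univ.erase j).erase k, ‖t i‖ < ∏ i ∈ (Finset.univ.erase j).erase k, (1 : ℝ) :=
        Finset.prod_lt_prod_of_nonempty (fun i _ => norm_pos_iff.mpr (h0 i)) (fun i _ => h1 i) ⟨l, hmem⟩
    _ = 1 := by simp

theorem pairGamma_ne_zero (hp : ‖p‖ < 1) (hq : ‖q‖ < 1) {t : Fin 6 → ℂ} (h0 : ∀ j, t j ≠ 0)
    (h1 : ∀ j, ‖t j‖ < 1) (h : ∏ j, t j = p * q) : pairGamma p q t ≠ 0 := by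
  refine Finset.prod_ne_zero_iff.mpr fun j _ => Finset.prod_ne_zero_iff.mpr fun k hk => ?_
  have hjk : j ≠ k := (Finset.mem_Ioi.mp hk).ne
  obtain ⟨l, hl⟩ : ∃ l : Fin 6, l ∉ ({j, k} : Finset (Fin 6)) := by
    by_contra! hall
    have h2 : Finset.card (Finset.univ : Finset (Fin 6)) ≤ Finset.card {j, k} :=
      Finset.card_le_card fun l _ => hall l
    have := h2.trans Finset.card_le_two
    simp at this
  simp only [Finset.mem_insert, Finset.mem_singleton, not_or] at hl
  refine ellGamma_ne_zero hp hq (norm_mul_lt_one (h1 j) (h1 k)) ?_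
  rw [← h]
  exact norm_prod_lt_norm_mul h0 h1 hjk (Ne.symm hl.1) (Ne.symm hl.2)

theorem ellInt_mul_pairGamma_contiguous (hp0 : p ≠ 0) (hq0 : q ≠ 0) (hp : ‖p‖ < 1) (hq : ‖q‖ < 1)
    {a b c d e u : ℂ} (h : a * b * c * d * e * u = p)
    (hx : ∀ j, ‖(![a, b, c, d, e, u] : Fin 6 → ℂ) j‖ < 1) :
    ellInt p q ![q * a, b, c, d, e, u] * pairGamma p q ![a, b, c, d, e, q * u] =
      ellInt p q ![a, b, c, d, e, q * u] * pairGamma p q ![q * a, b, c, d, e, u] := by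
  obtain ⟨xa, xb, xc, xd, xe, xu⟩ : ‖a‖ < 1 ∧ ‖b‖ < 1 ∧ ‖c‖ < 1 ∧ ‖d‖ < 1 ∧ ‖e‖ < 1 ∧ ‖u‖ < 1 :=
    ⟨hx 0, hx 1, hx 2, hx 3, hx 4, hx 5⟩
  have k1 : ∀ x, ‖x‖ < 1 → ellGamma p q (q * a * x) = theta p (a * x) * ellGamma p q (a * x) :=
    fun x hx => by rw [mul_assoc, ellGamma_mul_right hp hq hq0 (norm_mul_lt_one xa hx)]
  have k2 : ∀ x, ‖x‖ < 1 → ellGamma p q (x * (q * u)) = theta p (u * x) * ellGamma p q (x * u) :=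
    fun x hx => by
      rw [mul_left_comm, ellGamma_mul_right hp hq hq0 (norm_mul_lt_one hx xu), mul_comm x u]
  have k3 : ellGamma p q (q * a * u) = ellGamma p q (a * (q * u)) := by congr 1; ring
  have h2 := ellInt_contiguous hp0 hq0 hp hq h hx
  simp only [pairGamma_fin_six, Matrix.cons_val, k3, k1 b xb, k1 c xc, k1 d xd, k1 e xe, k2 b xb,
    k2 c xc, k2 d xd, k2 e xe]
  linear_combination (ellGamma p q (a * b) * ellGamma p q (a * c) * ellGamma p q (a * d) *
    ellGamma p q (a * e) * ellGamma p q (a * (q * u)) * ellGamma p q (b * c) * ellGamma p q (b * d) *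
    ellGamma p q (b * e) * ellGamma p q (b * u) * ellGamma p q (c * d) * ellGamma p q (c * e) *
    ellGamma p q (c * u) * ellGamma p q (d * e) * ellGamma p q (d * u) * ellGamma p q (e * u)) * h2

/-- The six parameters `a, …, e` and `p q / (a b c d e)` of an elliptic beta integral. -/
noncomputable def betaParam (p q a b c d e : ℂ) : Fin 6 → ℂ :=
  ![a, b, c, d, e, p * q / (a * b * c * d * e)]

/-- The quotient of the elliptic beta integral by its expected value, up to a constant. -/
noncomputable def betaRatio (p q a b c d e : ℂ) : ℂ :=
  ellInt p q (betaParam p q a b c d e) / pairGamma p q (betaParam p q a b c d e)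

theorem forall_betaParam {P : ℂ → Prop} {a b c d e : ℂ} (ha : P a) (hb : P b) (hc : P c) (hd : P d)
    (he : P e) (hu : P (p * q / (a * b * c * d * e))) : ∀ j, P (betaParam p q a b c d e j) := by
  simp [betaParam, Fin.forall_fin_succ, ha, hb, hc, hd, he, hu]

theorem prod_betaParam {a b c d e : ℂ} (h : a * b * c * d * e ≠ 0) :
    ∏ j, betaParam p q a b c d e j = p * q := by
  simp only [betaParam, Fin.prod_univ_six, Matrix.cons_val]
  rw [mul_div_cancel₀ _ h]

theorem betaRatio_swap (a b c d e : ℂ) : betaRatio p q a b c d e = betaRatio p q b a c d e := by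
  have h1 : betaParam p q b a c d e = fun j => betaParam p q a b c d e (Equiv.swap 0 1 j) := by
    ext j
    fin_cases j <;> simp [betaParam, mul_comm b a, Equiv.swap_apply_def]
  rw [betaRatio, betaRatio, h1, ellInt_comp_equiv, ← h1]
  congr 1
  simp only [pairGamma_fin_six, betaParam, Matrix.cons_val, mul_comm b a]
  ring

/-- The ratio does not depend on the first parameter, as long as the annulus in which this
parameter can move is wider than one period. -/
theorem betaRatio_eq (hp0 : p ≠ 0) (hq0 : q ≠ 0) (hp : ‖p‖ < 1) (hq : ‖q‖ < 1) {b c d e : ℂ}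
    (hb : ‖b‖ < 1) (hc : ‖c‖ < 1) (hd : ‖d‖ < 1) (he : ‖e‖ < 1) (h : ‖p‖ < ‖b * c * d * e‖)
    {a a' : ℂ} (ha : ‖a‖ < 1) (ha' : ‖a'‖ < 1) (hpa : ‖p * q‖ < ‖a * (b * c * d * e)‖)
    (hpa' : ‖p * q‖ < ‖a' * (b * c * d * e)‖) :
    betaRatio p q a b c d e = betaRatio p q a' b c d e := by
  have hm : b * c * d * e ≠ 0 := norm_pos_iff.mp ((norm_nonneg p).trans_lt h)
  obtain ⟨⟨⟨hb0, hc0⟩, hd0⟩, he0⟩ : ((b ≠ 0 ∧ c ≠ 0) ∧ d ≠ 0) ∧ e ≠ 0 := by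
    simpa only [mul_ne_zero_iff] using hm
  have hmpos := norm_pos_iff.mpr hm
  have hpq : p * q ≠ 0 := mul_ne_zero hp0 hq0
  have hqpos := norm_pos_iff.mpr hq0
  set r := ‖p * q‖ / ‖b * c * d * e‖ with hr
  have hrpos : 0 < r := div_pos (norm_pos_iff.mpr hpq) hmpos
  have hiff : ∀ x, r < ‖x‖ ↔ ‖p * q‖ < ‖x * (b * c * d * e)‖ := fun x => by
    rw [hr, div_lt_iff₀ hmpos, norm_mul x]
  have hne : ∀ x : ℂ, r < ‖x‖ → x ≠ 0 := fun x hx => norm_pos_iff.mp (hrpos.trans hx)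
  have hlast : ∀ x, r < ‖x‖ → ‖p * q / (x * b * c * d * e)‖ < 1 := fun x hx => by
    have e1 : x * b * c * d * e = x * (b * c * d * e) := by ring
    rw [e1, norm_div, div_lt_one ((norm_nonneg _).trans_lt ((hiff x).mp hx))]
    exact (hiff x).mp hx
  have hne' : ∀ x, r < ‖x‖ → x * b * c * d * e ≠ 0 := fun x hx => by
    have := hne x hx
    positivity
  have t0 : ∀ x, r < ‖x‖ → ∀ j, betaParam p q x b c d e j ≠ 0 := fun x hx =>
    forall_betaParam (P := (· ≠ 0)) (hne x hx) hb0 hc0 hd0 he0 (div_ne_zero hpq (hne' x hx))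
  have t1 : ∀ x, r < ‖x‖ → ‖x‖ < 1 → ∀ j, ‖betaParam p q x b c d e j‖ < 1 := fun x hx hx1 =>
    forall_betaParam (P := fun y => ‖y‖ < 1) hx1 hb hc hd he (hlast x hx)
  have hdiff : ∀ j, DifferentiableOn ℂ (fun x => betaParam p q x b c d e j)
      {x | r < ‖x‖ ∧ ‖x‖ < 1} := by
    have h5 : DifferentiableOn ℂ (fun x => p * q / (x * b * c * d * e)) {x | r < ‖x‖ ∧ ‖x‖ < 1} :=
      fun x hx => by
        have := hne' x hx.1
        exact DifferentiableAt.differentiableWithinAt (by fun_prop (disch := assumption))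
    intro j
    fin_cases j
    · exact differentiableOn_id
    · exact differentiableOn_const b
    · exact differentiableOn_const c
    · exact differentiableOn_const d
    · exact differentiableOn_const e
    · exact h5
  have hopen := isOpen_annulus r 1
  have hD1 := differentiableOn_ellInt hp hq hopen hdiff (fun x hx => t0 x hx.1)
    (fun x hx => t1 x hx.1 hx.2)
  have hD2 := differentiableOn_pairGamma hp hq hdiff (fun x hx => t0 x hx.1)
    (fun x hx => t1 x hx.1 hx.2)
  have hP : ∀ x, r < ‖x‖ → ‖x‖ < 1 → pairGamma p q (betaParam p q x b c d e) ≠ 0 :=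
    fun x hx hx1 => pairGamma_ne_zero hp hq (t0 x hx) (t1 x hx hx1) (prod_betaParam (hne' x hx))
  refine eq_of_multiplicatively_periodic (f := fun x => betaRatio p q x b c d e) (r := r) (R := 1)
    (c := q) hrpos hq0 hq ?_ (fun z hz hz1 => ?_) (fun z hz hz1 => ?_) ((hiff a).mpr hpa) ha
    ((hiff a').mpr hpa') ha'
  · rw [hr, div_lt_iff₀ hmpos, norm_mul, mul_one, mul_comm]
    gcongr
  · exact (hD1.div hD2 fun x hx => hP x hx.1 hx.2).differentiableAt (hopen.mem_nhds ⟨hz, hz1⟩)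
  · have hz0 : z ≠ 0 := right_ne_zero_of_mul (hne _ hz)
    have hqz1 : ‖q * z‖ < 1 := norm_mul_lt_one hq hz1
    have hz' : r < ‖z‖ := hz.trans_le (by
      rw [norm_mul]; exact mul_le_of_le_one_left (norm_nonneg _) hq.le)
    -- the last parameter before the shift
    set u := p * q / (q * z * b * c * d * e) with hu
    have hu1 : ‖u‖ < 1 := hlast _ hz
    have hprod : z * b * c * d * e * u = p := by rw [hu]; field_simp
    have e1 : betaParam p q (q * z) b c d e = ![q * z, b, c, d, e, u] := rfl
    have e2 : betaParam p q z b c d e = ![z, b, c, d, e, q * u] := by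
      rw [betaParam, hu]; congr 6; field_simp
    have h3 := ellInt_mul_pairGamma_contiguous hp0 hq0 hp hq hprod
      (by simp [Fin.forall_fin_succ, hz1, hb, hc, hd, he, hu1])
    have hP1 := hP _ hz hqz1
    have hP2 := hP _ hz' hz1
    simp only [betaRatio]
    rw [e1] at hP1 ⊢
    rw [e2] at hP2 ⊢
    rw [div_eq_div_iff hP1 hP2]
    exact h3

/-! ### The limit in which two parameters tend to `±i` -/

/-- The regular part `(1 - x) Γ(x)` of the elliptic gamma function at `x = 1`. -/
noncomputable def gammaReg (p q x : ℂ) : ℂ :=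
  pqPoch (p * q * x⁻¹) p q / (qPoch (p * x) p * pqPoch (q * x) p q)

theorem ellGamma_eq_gammaReg_div (hp : ‖p‖ < 1) (hq : ‖q‖ < 1) (x : ℂ) :
    ellGamma p q x = gammaReg p q x / (1 - x) := by
  rw [ellGamma, gammaReg, pqPoch_eq_mul_right x hp hq, qPoch_eq_mul x hp, div_div]
  congr 1
  ring

theorem continuousAt_gammaReg (hp : ‖p‖ < 1) (hq : ‖q‖ < 1) {x : ℂ} (hx0 : x ≠ 0) (hx : ‖x‖ ≤ 1) :
    ContinuousAt (gammaReg p q) x := by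
  have h1 := (differentiable_pqPoch hp hq).continuous
  have h2 := (differentiable_qPoch hp).continuous
  have hlt : ∀ y : ℂ, ‖y‖ < 1 → ‖y * x‖ < 1 := fun y hy => by
    rw [norm_mul]; exact mul_lt_one_of_nonneg_of_lt_one_left (norm_nonneg _) hy hx
  refine ContinuousAt.div (h1.continuousAt.comp (by fun_prop (disch := assumption)))
    (((h2.comp (continuous_const_mul p)).mul (h1.comp (continuous_const_mul q))).continuousAt) ?_
  exact mul_ne_zero (qPoch_ne_zero_of_norm_lt_one hp (hlt p hp))
    (pqPoch_ne_zero_of_norm_lt_one hp hq (hlt q hq))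

theorem gammaReg_one (hp : ‖p‖ < 1) (hq : ‖q‖ < 1) : gammaReg p q 1 = (qPoch p p * qPoch q q)⁻¹ := by
  have h := pqPoch_ne_zero_of_norm_lt_one hp hq (norm_mul_lt_one hp hq)
  have h2 : pqPoch q p q = qPoch q q * pqPoch (p * q) p q := pqPoch_eq_mul_left q hp hq
  rw [gammaReg, inv_one, mul_one, mul_one, mul_one, h2]
  field_simp

/-- The weight with the parameters `i r` and `-i r`, without the singular factors `1 / (1 ∓ i r z)`
and `1 / (1 ∓ i r z⁻¹)`, which make up the Poisson kernel. -/
noncomputable def pinchWeight (p q c d e : ℂ) (r : ℝ) (z : ℂ) : ℂ :=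
  gammaReg p q (I * r * z) * gammaReg p q (-I * r * z) * gammaReg p q (I * r * z⁻¹) *
    gammaReg p q (-I * r * z⁻¹) * ellWeight p q ![c, d, e, p * q / (r ^ 2 * (c * d * e))] z

theorem betaParam_I (c d e : ℂ) (r : ℝ) :
    betaParam p q (I * r) (-I * r) c d e = ![I * r, -I * r, c, d, e, p * q / (r ^ 2 * (c * d * e))] := by
  rw [betaParam]
  have : I * r * (-I * r) * c * d * e = (r : ℂ) ^ 2 * (c * d * e) := by
    linear_combination (-(r : ℂ) ^ 2 * c * d * e) * I_sq
  rw [this]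

theorem mul_ellWeight_eq_pinchWeight (hp : ‖p‖ < 1) (hq : ‖q‖ < 1) (c d e : ℂ) (r : ℝ)
    {z : ℂ} (hz : ‖z‖ = 1) :
    ellWeight p q (betaParam p q (I * r) (-I * r) c d e) z * (1 - r ^ 4) =
      pinchWeight p q c d e r z * sqPoisson r z := by
  rw [betaParam_I, sqPoisson_eq r hz, pinchWeight]
  have e1 : 1 + (r : ℂ) ^ 2 * z ^ 2 = (1 - I * r * z) * (1 - -I * r * z) := by
    linear_combination ((r : ℂ) ^ 2 * z ^ 2) * I_sq
  have e2 : 1 + (r : ℂ) ^ 2 * (z⁻¹) ^ 2 = (1 - I * r * z⁻¹) * (1 - -I * r * z⁻¹) := by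
    linear_combination ((r : ℂ) ^ 2 * (z⁻¹) ^ 2) * I_sq
  rw [e1, e2]
  simp only [ellWeight, Fin.prod_univ_six, Fin.prod_univ_four, Matrix.cons_val,
    ellGamma_eq_gammaReg_div hp hq (I * r * z), ellGamma_eq_gammaReg_div hp hq (-I * r * z),
    ellGamma_eq_gammaReg_div hp hq (I * r * z⁻¹), ellGamma_eq_gammaReg_div hp hq (-I * r * z⁻¹),
    div_eq_mul_inv, mul_inv]
  ring

theorem continuousOn_pinchWeight (hp0 : p ≠ 0) (hq0 : q ≠ 0) (hp : ‖p‖ < 1) (hq : ‖q‖ < 1) {c d e : ℂ}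
    (hc : ‖c‖ < 1) (hd : ‖d‖ < 1) (he : ‖e‖ < 1) {r₀ : ℝ} (hr₀ : 0 < r₀)
    (h : ‖p * q‖ < r₀ ^ 2 * ‖c * d * e‖) :
    ContinuousOn (Function.uncurry (pinchWeight p q c d e)) (Icc r₀ 1 ×ˢ Metric.sphere 0 1) := by
  have hm : c * d * e ≠ 0 := by
    rintro h0; rw [h0, norm_zero, mul_zero] at h; exact absurd h (not_lt.mpr (norm_nonneg _))
  obtain ⟨⟨hc0, hd0⟩, he0⟩ : (c ≠ 0 ∧ d ≠ 0) ∧ e ≠ 0 := by simpa only [mul_ne_zero_iff] using hm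
  have hpq : p * q ≠ 0 := mul_ne_zero hp0 hq0
  have hS : ∀ x ∈ Icc r₀ 1 ×ˢ Metric.sphere (0 : ℂ) 1, x.1 ≠ 0 ∧ ‖(x.1 : ℂ)‖ ≤ 1 ∧ ‖x.2‖ = 1 ∧ x.2 ≠ 0 := by
    rintro ⟨r, z⟩ ⟨⟨hr, hr1⟩, hz⟩
    have hz : ‖z‖ = 1 := by simpa using hz
    have hrp : 0 < r := hr₀.trans_le hr
    refine ⟨hrp.ne', ?_, hz, ?_⟩
    · rw [norm_real, Real.norm_of_nonneg hrp.le]; exact hr1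
    · rintro rfl; simp at hz
  have hG : ∀ f : ℝ × ℂ → ℂ, ContinuousOn f (Icc r₀ 1 ×ˢ Metric.sphere (0 : ℂ) 1) →
      (∀ x ∈ Icc r₀ 1 ×ˢ Metric.sphere (0 : ℂ) 1, f x ≠ 0 ∧ ‖f x‖ ≤ 1) →
      ContinuousOn (fun x => gammaReg p q (f x)) (Icc r₀ 1 ×ˢ Metric.sphere (0 : ℂ) 1) :=
    fun f hf h2 x hx => ContinuousAt.comp_continuousWithinAt (f := f)
      (continuousAt_gammaReg hp hq (h2 x hx).1 (h2 x hx).2) (hf x hx)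
  have hinv : ContinuousOn (fun x : ℝ × ℂ => x.2⁻¹) (Icc r₀ 1 ×ˢ Metric.sphere (0 : ℂ) 1) :=
    continuousOn_snd.inv₀ fun x hx => (hS x hx).2.2.2
  have hr : ContinuousOn (fun x : ℝ × ℂ => (x.1 : ℂ)) (Icc r₀ 1 ×ˢ Metric.sphere (0 : ℂ) 1) := by
    fun_prop
  have hI : (I : ℂ) ≠ 0 := I_ne_zero
  have hu : ContinuousOn (fun x : ℝ × ℂ => p * q / ((x.1 : ℂ) ^ 2 * (c * d * e)))
      (Icc r₀ 1 ×ˢ Metric.sphere (0 : ℂ) 1) :=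
    continuousOn_const.div ((hr.pow 2).mul continuousOn_const) fun x hx =>
      mul_ne_zero (pow_ne_zero 2 (ofReal_ne_zero.mpr (hS x hx).1)) hm
  have hW : ContinuousOn (fun x : ℝ × ℂ =>
      ellWeight p q ![c, d, e, p * q / ((x.1 : ℂ) ^ 2 * (c * d * e))] x.2)
      (Icc r₀ 1 ×ˢ Metric.sphere (0 : ℂ) 1) := by
    refine continuousOn_ellWeight hp hq (fun j => ?_) continuousOn_snd (fun x hx => ?_)
      (fun x hx => ?_) fun x hx => (hS x hx).2.2.1
    · fin_cases j
      · exact continuousOn_const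
      · exact continuousOn_const
      · exact continuousOn_const
      · exact hu
    · have := (hS x hx).1
      simp [Fin.forall_fin_succ, hc0, hd0, he0, hp0, hq0, this]
    · have h1 : ‖p * q / ((x.1 : ℂ) ^ 2 * (c * d * e))‖ < 1 := by
        have hx1 : r₀ ≤ x.1 := hx.1.1
        rw [norm_div, norm_mul _ (c * d * e), norm_pow, norm_real,
          Real.norm_of_nonneg (hr₀.le.trans hx1), div_lt_one]
        · refine h.trans_le ?_
          gcongr
        · have := norm_pos_iff.mpr hm
          have := hr₀.trans_le hx1
          positivity
      simp [Fin.forall_fin_succ, hc, hd, he, -norm_div, -Complex.norm_div, h1]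
  refine ((((hG _ ((continuousOn_const.mul hr).mul continuousOn_snd) fun x hx => ?_).mul
    (hG _ ((continuousOn_const.mul hr).mul continuousOn_snd) fun x hx => ?_)).mul
    (hG _ ((continuousOn_const.mul hr).mul hinv) fun x hx => ?_)).mul
    (hG _ ((continuousOn_const.mul hr).mul hinv) fun x hx => ?_)).mul hW <;>
  · obtain ⟨h1, h2, h3, h4⟩ := hS x hx
    refine ⟨by simp [h1, h4], ?_⟩
    simpa [h3] using h2

end

section

variable {p q : ℂ}

/-- The factor made up of four values of `Γ` at `-1` is kept in this form, although it is equal to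
`1`: its two parts come from the regular parts of `Γ` and from the weight `1 / Γ(z^{±2})`. -/
theorem pinchWeight_one_I (hp : ‖p‖ < 1) (hq : ‖q‖ < 1) (c d e : ℂ) :
    pinchWeight p q c d e 1 I = 4 * ((qPoch p p * qPoch q q)⁻¹) ^ 2 *
        ((ellGamma p q (-1) * ellGamma p q (-1)) * (ellGamma p q (-1) * ellGamma p q (-1)⁻¹)⁻¹) *
      ∏ j, ellGamma p q ((![c, d, e, p * q / (c * d * e)] : Fin 4 → ℂ) j * I) *
        ellGamma p q ((![c, d, e, p * q / (c * d * e)] : Fin 4 → ℂ) j * -I) := by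
  have hI : I⁻¹ = -I := inv_I
  have e1 : gammaReg p q (-1) = 2 * ellGamma p q (-1) := by
    rw [ellGamma_eq_gammaReg_div hp hq]; ring
  have h := inv_ellGamma_mul_inv (x := -1) hp hq (by simp)
  rw [h, pinchWeight, ofReal_one, hI]
  have a1 : I * 1 * I = -1 := by rw [mul_one, I_mul_I]
  have a2 : -I * 1 * I = 1 := by rw [mul_one, neg_mul, I_mul_I, neg_neg]
  have a3 : I * 1 * -I = 1 := by rw [mul_one, mul_neg, I_mul_I, neg_neg]
  have a4 : -I * 1 * -I = -1 := by rw [mul_one, neg_mul_neg, I_mul_I]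
  rw [a1, a2, a3, a4, e1, gammaReg_one hp hq, one_pow, one_mul, ellWeight, I_sq, hI]
  ring

theorem pinchWeight_one_neg_I (hp : ‖p‖ < 1) (hq : ‖q‖ < 1) (c d e : ℂ) :
    pinchWeight p q c d e 1 (-I) = pinchWeight p q c d e 1 I := by
  have h : (-I : ℂ) = I⁻¹ := inv_I.symm
  rw [h, pinchWeight, pinchWeight, ellWeight_inv hp hq _ I_ne_zero, inv_inv]
  ring

theorem tendsto_ellInt_pinch (hp0 : p ≠ 0) (hq0 : q ≠ 0) (hp : ‖p‖ < 1) (hq : ‖q‖ < 1) {c d e : ℂ}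
    (hc : ‖c‖ < 1) (hd : ‖d‖ < 1) (he : ‖e‖ < 1) (h : ‖p * q‖ < ‖c * d * e‖) :
    Tendsto (fun r : ℝ => ellInt p q (betaParam p q (I * r) (-I * r) c d e) * (1 - r ^ 4)) (𝓝[<] 1)
      (𝓝 (pinchWeight p q c d e 1 I)) := by
  obtain ⟨r₀, hr₀, hr₁, h'⟩ : ∃ r₀ : ℝ, 0 < r₀ ∧ r₀ < 1 ∧ ‖p * q‖ < r₀ ^ 2 * ‖c * d * e‖ := by
    have h1 : ∀ᶠ r : ℝ in 𝓝[<] 1, ‖p * q‖ < r ^ 2 * ‖c * d * e‖ :=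
      nhdsWithin_le_nhds (ContinuousAt.eventually_lt (by fun_prop) (by fun_prop) (by simpa using h))
    have h2 : ∀ᶠ r : ℝ in 𝓝[<] 1, 0 < r := nhdsWithin_le_nhds (lt_mem_nhds one_pos)
    obtain ⟨r, hr, hr', hr''⟩ := (h1.and (h2.and self_mem_nhdsWithin)).exists
    exact ⟨r, hr', hr'', hr⟩
  refine (tendsto_circleAverage_mul_sqPoisson hr₀ hr₁
    (continuousOn_pinchWeight hp0 hq0 hp hq hc hd he hr₀ h') rfl
    (pinchWeight_one_neg_I hp hq c d e)).congr fun r => ?_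
  rw [ellInt, ← circleAverage_mul_const]
  exact (Real.circleAverage_congr_sphere fun z hz =>
    mul_ellWeight_eq_pinchWeight hp hq c d e r (by simpa using hz)).symm

/-- As `r → 1` the factor `Γ(r²)` has a simple pole, and the remaining factors `Γ(tⱼ tₖ)` that do not
involve the first two parameters cancel by reflection. -/
theorem tendsto_pairGamma_pinch (hp0 : p ≠ 0) (hq0 : q ≠ 0) (hp : ‖p‖ < 1) (hq : ‖q‖ < 1) {c d e : ℂ}
    (hc : ‖c‖ < 1) (hd : ‖d‖ < 1) (he : ‖e‖ < 1) (h : ‖p * q‖ < ‖c * d * e‖) :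
    Tendsto (fun r : ℝ => pairGamma p q (betaParam p q (I * r) (-I * r) c d e) * (1 - r ^ 4)) (𝓝[<] 1)
      (𝓝 (2 * (qPoch p p * qPoch q q)⁻¹ *
        ∏ j, ellGamma p q ((![c, d, e, p * q / (c * d * e)] : Fin 4 → ℂ) j * I) *
          ellGamma p q ((![c, d, e, p * q / (c * d * e)] : Fin 4 → ℂ) j * -I))) := by
  have hpq : p * q ≠ 0 := mul_ne_zero hp0 hq0
  have hm : c * d * e ≠ 0 := norm_pos_iff.mp ((norm_nonneg _).trans_lt h)
  obtain ⟨⟨hc0, hd0⟩, he0⟩ : (c ≠ 0 ∧ d ≠ 0) ∧ e ≠ 0 := by simpa only [mul_ne_zero_iff] using hm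
  set u : ℝ → ℂ := fun r => p * q / (r ^ 2 * (c * d * e)) with hu
  have hu1 : u 1 = p * q / (c * d * e) := by simp [hu]
  have hun : ‖u 1‖ < 1 := by
    rw [hu1, norm_div]; exact (div_lt_one ((norm_nonneg _).trans_lt h)).mpr h
  have hu0 : u 1 ≠ 0 := by rw [hu1]; exact div_ne_zero hpq hm
  have hr : ContinuousAt (fun r : ℝ => (r : ℂ)) 1 := continuous_ofReal.continuousAt
  have huc : ContinuousAt u 1 :=
    continuousAt_const.div ((hr.pow 2).mul continuousAt_const) (by simpa using hm)
  have hG : ∀ f : ℝ → ℂ, ContinuousAt f 1 → f 1 ≠ 0 → ‖f 1‖ < 1 →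
      ContinuousAt (fun r => ellGamma p q (f r)) 1 := fun f hf h0 h1 =>
    ContinuousAt.comp (f := f) (differentiableAt_ellGamma hp hq h0 h1).continuousAt hf
  have hI := I_ne_zero
  have hn : ∀ x : ℂ, ‖x‖ < 1 → ‖I * ((1 : ℝ) : ℂ) * x‖ < 1 ∧ ‖-I * ((1 : ℝ) : ℂ) * x‖ < 1 :=
    fun x hx => by simpa using hx
  have hG1 : ∀ f : ℝ → ℂ, ContinuousAt f 1 → f 1 ≠ 0 → ‖f 1‖ < 1 →
      ContinuousAt (fun r : ℝ => ellGamma p q (I * r * f r)) 1 := fun f hf h0 h1 =>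
    hG _ ((continuousAt_const.mul hr).mul hf) (by simpa using h0) (hn _ h1).1
  have hG2 : ∀ f : ℝ → ℂ, ContinuousAt f 1 → f 1 ≠ 0 → ‖f 1‖ < 1 →
      ContinuousAt (fun r : ℝ => ellGamma p q (-I * r * f r)) 1 := fun f hf h0 h1 =>
    hG _ ((continuousAt_const.mul hr).mul hf) (by simpa using h0) (hn _ h1).2
  have hG3 : ∀ x : ℂ, x ≠ 0 → ‖x‖ < 1 → ContinuousAt (fun r => ellGamma p q (x * u r)) 1 :=
    fun x h0 h1 => hG _ (continuousAt_const.mul huc) (mul_ne_zero h0 hu0) (norm_mul_lt_one h1 hun)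
  have hk : ∀ x : ℂ, ContinuousAt (fun _ : ℝ => x) 1 := fun x => continuousAt_const
  -- the product with the singular factor `Γ(r²)` regularised
  let Q : ℝ → ℂ := fun r => (1 + (r : ℂ) ^ 2) * gammaReg p q ((r : ℂ) ^ 2) *
    ((ellGamma p q (I * r * c) * ellGamma p q (-I * r * c)) *
      (ellGamma p q (I * r * d) * ellGamma p q (-I * r * d)) *
      (ellGamma p q (I * r * e) * ellGamma p q (-I * r * e)) *
      (ellGamma p q (I * r * u r) * ellGamma p q (-I * r * u r))) *
    ((ellGamma p q (c * d) * ellGamma p q (e * u r)) *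
      (ellGamma p q (c * e) * ellGamma p q (d * u r)) *
      (ellGamma p q (d * e) * ellGamma p q (c * u r)))
  have hQc : ContinuousAt Q 1 := by
    have hreg : ContinuousAt (fun r : ℝ => gammaReg p q ((r : ℂ) ^ 2)) 1 :=
      ContinuousAt.comp (f := fun r : ℝ => (r : ℂ) ^ 2)
        (continuousAt_gammaReg hp hq (by simp) (by simp)) (hr.pow 2)
    have k1 := hG1 _ (hk c) hc0 hc
    have k2 := hG2 _ (hk c) hc0 hc
    have k3 := hG1 _ (hk d) hd0 hd
    have k4 := hG2 _ (hk d) hd0 hd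
    have k5 := hG1 _ (hk e) he0 he
    have k6 := hG2 _ (hk e) he0 he
    have k7 := hG1 _ huc hu0 hun
    have k8 := hG2 _ huc hu0 hun
    have k9 := hG3 c hc0 hc
    have k10 := hG3 d hd0 hd
    have k11 := hG3 e he0 he
    exact (((continuousAt_const.add (hr.pow 2)).mul hreg).mul
      ((((k1.mul k2).mul (k3.mul k4)).mul (k5.mul k6)).mul (k7.mul k8))).mul
      ((((hk _).mul k11).mul ((hk _).mul k10)).mul ((hk _).mul k9))
  have hQ1 : Q 1 = 2 * (qPoch p p * qPoch q q)⁻¹ *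
        ∏ j, ellGamma p q ((![c, d, e, p * q / (c * d * e)] : Fin 4 → ℂ) j * I) *
          ellGamma p q ((![c, d, e, p * q / (c * d * e)] : Fin 4 → ℂ) j * -I) := by
    have r1 : ellGamma p q (c * d) * ellGamma p q (e * u 1) = 1 :=
      ellGamma_mul_reflect hp hq hp0 hq0 (norm_mul_lt_one hc hd) (norm_mul_lt_one he hun)
        (by rw [hu1]; field_simp)
    have r2 : ellGamma p q (c * e) * ellGamma p q (d * u 1) = 1 :=
      ellGamma_mul_reflect hp hq hp0 hq0 (norm_mul_lt_one hc he) (norm_mul_lt_one hd hun)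
        (by rw [hu1]; field_simp)
    have r3 : ellGamma p q (d * e) * ellGamma p q (c * u 1) = 1 :=
      ellGamma_mul_reflect hp hq hp0 hq0 (norm_mul_lt_one hd he) (norm_mul_lt_one hc hun)
        (by rw [hu1]; field_simp)
    simp only [Q, r1, r2, r3, Fin.prod_univ_four, Matrix.cons_val, ← hu1, ofReal_one, one_pow,
      gammaReg_one hp hq, mul_one, mul_comm _ I, mul_comm _ (-I)]
    norm_num
  rw [← hQ1]
  refine (hQc.tendsto.mono_left nhdsWithin_le_nhds).congr' ?_
  have h2 : ∀ᶠ r : ℝ in 𝓝[<] 1, 0 < r := nhdsWithin_le_nhds (lt_mem_nhds one_pos)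
  filter_upwards [h2, self_mem_nhdsWithin] with r hr0 hr1
  have hr1 : r < 1 := hr1
  have hne : 1 - (r : ℂ) ^ 2 ≠ 0 := by
    have : (1 - r ^ 2 : ℝ) ≠ 0 := by nlinarith
    exact_mod_cast this
  have e0 : I * (r : ℂ) * (-I * r) = (r : ℂ) ^ 2 := by linear_combination (-(r : ℂ) ^ 2) * I_sq
  have e1 : ellGamma p q ((r : ℂ) ^ 2) * (1 - r ^ 4) =
      (1 + (r : ℂ) ^ 2) * gammaReg p q ((r : ℂ) ^ 2) := by
    rw [ellGamma_eq_gammaReg_div hp hq]; field_simp; ring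
  rw [betaParam_I]
  simp only [Q, pairGamma_fin_six, Matrix.cons_val, e0, ← e1, hu]
  ring

/-- The elliptic beta integral, for parameters such that both of the first two can be moved to the
unit circle. -/
theorem ellBeta_of_norm_lt (hp0 : p ≠ 0) (hq0 : q ≠ 0) (hp : ‖p‖ < 1) (hq : ‖q‖ < 1) {a b c d e : ℂ}
    (ha : ‖a‖ < 1) (hb : ‖b‖ < 1) (hc : ‖c‖ < 1) (hd : ‖d‖ < 1) (he : ‖e‖ < 1)
    (hpb : ‖p‖ < ‖b * (c * d * e)‖) (hpab : ‖p * q‖ < ‖a * (b * c * d * e)‖) :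
    qPoch p p * qPoch q q / 2 * ellInt p q (betaParam p q a b c d e) =
      pairGamma p q (betaParam p q a b c d e) := by
  have hpq1 : ‖p * q‖ < ‖p‖ := by
    rw [norm_mul]; exact mul_lt_of_lt_one_right (norm_pos_iff.mpr hp0) hq
  have hcde : ‖p‖ < ‖c * d * e‖ := hpb.trans_le (by
    rw [norm_mul]; exact mul_le_of_le_one_left (norm_nonneg _) hb.le)
  have hm : c * d * e ≠ 0 := norm_pos_iff.mp ((norm_nonneg _).trans_lt hcde)
  obtain ⟨⟨hc0, hd0⟩, he0⟩ : (c ≠ 0 ∧ d ≠ 0) ∧ e ≠ 0 := by simpa only [mul_ne_zero_iff] using hm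
  have hab : a * (b * c * d * e) ≠ 0 := norm_pos_iff.mp ((norm_nonneg _).trans_lt hpab)
  have hpq : p * q ≠ 0 := mul_ne_zero hp0 hq0
  have hne : ∀ x y : ℂ, ‖p * q‖ < ‖x * (y * c * d * e)‖ → x * y * c * d * e ≠ 0 := fun x y h => by
    have := norm_pos_iff.mp ((norm_nonneg _).trans_lt h)
    simpa only [mul_assoc] using this
  have hP : ∀ x y : ℂ, ‖x‖ < 1 → ‖y‖ < 1 → ‖p * q‖ < ‖x * (y * c * d * e)‖ →
      pairGamma p q (betaParam p q x y c d e) ≠ 0 := by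
    intro x y hx hy h
    have h0 := hne x y h
    have hx0 : x ≠ 0 := by rintro rfl; simp at h0
    have hy0 : y ≠ 0 := by rintro rfl; simp at h0
    refine pairGamma_ne_zero hp hq
      (forall_betaParam (P := (· ≠ 0)) hx0 hy0 hc0 hd0 he0 (div_ne_zero hpq h0))
      (forall_betaParam (P := fun y => ‖y‖ < 1) hx hy hc hd he ?_) (prod_betaParam h0)
    rw [norm_div, div_lt_one (norm_pos_iff.mpr h0)]
    simpa only [mul_assoc] using h
  -- move the first two parameters to `i r` and `-i r` with `r` close to `1`
  have hconst : ∀ᶠ r : ℝ in 𝓝[<] 1, betaRatio p q a b c d e = betaRatio p q (I * r) (-I * r) c d e ∧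
      pairGamma p q (betaParam p q (I * r) (-I * r) c d e) ≠ 0 := by
    have h1 : ∀ᶠ r : ℝ in 𝓝[<] 1, ‖p‖ < r * ‖c * d * e‖ :=
      nhdsWithin_le_nhds (ContinuousAt.eventually_lt (by fun_prop) (by fun_prop) (by simpa using hcde))
    have h2 : ∀ᶠ r : ℝ in 𝓝[<] 1, ‖p * q‖ < r * ‖b * (c * d * e)‖ :=
      nhdsWithin_le_nhds (ContinuousAt.eventually_lt (by fun_prop) (by fun_prop)
        (by simpa using hpq1.trans hpb))
    have h3 : ∀ᶠ r : ℝ in 𝓝[<] 1, ‖p * q‖ < r ^ 2 * ‖c * d * e‖ :=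
      nhdsWithin_le_nhds (ContinuousAt.eventually_lt (by fun_prop) (by fun_prop)
        (by simpa using hpq1.trans hcde))
    have h4 : ∀ᶠ r : ℝ in 𝓝[<] 1, 0 < r := nhdsWithin_le_nhds (lt_mem_nhds one_pos)
    filter_upwards [h1, h2, h3, h4, self_mem_nhdsWithin] with r h1 h2 h3 h4 h5
    have h5 : r < 1 := h5
    have n1 : ‖I * (r : ℂ)‖ = r := by simp [abs_of_pos h4]
    have n2 : ‖-I * (r : ℂ)‖ = r := by simp [abs_of_pos h4]
    have h6 : ‖p * q‖ < ‖-I * (r : ℂ) * (I * r * c * d * e)‖ := by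
      have : ‖-I * (r : ℂ) * (I * r * c * d * e)‖ = r ^ 2 * ‖c * d * e‖ := by
        rw [norm_mul, n2, mul_assoc (I * (r : ℂ)), mul_assoc (I * (r : ℂ)), norm_mul, n1]; ring
      rwa [this]
    have h7 : ‖p * q‖ < ‖I * (r : ℂ) * (-I * r * c * d * e)‖ := by
      have : I * (r : ℂ) * (-I * r * c * d * e) = -I * (r : ℂ) * (I * r * c * d * e) := by ring
      rwa [this]
    refine ⟨?_, hP _ _ (n1.trans_lt h5) (n2.trans_lt h5) h7⟩
    rw [betaRatio_eq (a' := I * r) hp0 hq0 hp hq hb hc hd he (by simpa only [mul_assoc] using hpb) ha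
      (n1.trans_lt h5) hpab (by rw [norm_mul (I * (r : ℂ)), n1]; simpa only [mul_assoc] using h2),
      betaRatio_swap,
      betaRatio_eq (a' := -I * r) hp0 hq0 hp hq (n1.trans_lt h5) hc hd he ?_ hb (n2.trans_lt h5) ?_ h6,
      betaRatio_swap]
    · rw [mul_assoc (I * (r : ℂ)), mul_assoc (I * (r : ℂ)), norm_mul, n1]; exact h1
    · have : b * (I * (r : ℂ) * c * d * e) = I * r * (b * (c * d * e)) := by ring
      rw [this, norm_mul (I * (r : ℂ)), n1]; exact h2
  have l1 := tendsto_ellInt_pinch hp0 hq0 hp hq hc hd he (hpq1.trans hcde)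
  have l2 := tendsto_pairGamma_pinch hp0 hq0 hp hq hc hd he (hpq1.trans hcde)
  set K := betaRatio p q a b c d e with hK
  have l3 := l1.congr' (f₂ := fun r : ℝ =>
      K * (pairGamma p q (betaParam p q (I * r) (-I * r) c d e) * (1 - r ^ 4))) (by
    filter_upwards [hconst] with r hr
    rw [hr.1, betaRatio, ← mul_assoc, div_mul_cancel₀ _ hr.2])
  have hlim := tendsto_nhds_unique l3 (l2.const_mul K)
  rw [pinchWeight_one_I hp hq] at hlim
  have hu1 : ‖p * q / (c * d * e)‖ < 1 := by
    rw [norm_div, div_lt_one (norm_pos_iff.mpr hm)]; exact hpq1.trans hcde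
  have hprod : ∏ j, ellGamma p q ((![c, d, e, p * q / (c * d * e)] : Fin 4 → ℂ) j * I) *
      ellGamma p q ((![c, d, e, p * q / (c * d * e)] : Fin 4 → ℂ) j * -I) ≠ 0 := by
    have hx : ∀ x : ℂ, ‖x‖ < 1 → ‖p * q‖ < ‖x‖ →
        ellGamma p q (x * I) * ellGamma p q (x * -I) ≠ 0 := fun x h1 h2 =>
      mul_ne_zero (ellGamma_ne_zero hp hq (by simpa using h1) (by simpa using h2))
        (ellGamma_ne_zero hp hq (by simpa using h1) (by simpa using h2))
    have hlow : ∀ x y : ℂ, ‖y‖ ≤ 1 → ‖p * q‖ < ‖x * y‖ → ‖p * q‖ < ‖x‖ := fun x y hy h =>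
      h.trans_le (by rw [norm_mul]; exact mul_le_of_le_one_right (norm_nonneg _) hy)
    have hcde' := hpq1.trans hcde
    rw [Fin.prod_univ_four]
    refine mul_ne_zero (mul_ne_zero (mul_ne_zero (hx c hc ?_) (hx d hd ?_)) (hx e he ?_))
      (hx _ hu1 ?_)
    · exact hlow c (d * e) (norm_mul_lt_one hd he).le (by rwa [← mul_assoc])
    · exact hlow d (c * e) (norm_mul_lt_one hc he).le (by rwa [← mul_assoc, mul_comm d])
    · exact hlow e (c * d) (norm_mul_lt_one hc hd).le (by rwa [mul_comm e])
    · change ‖p * q‖ < ‖p * q / (c * d * e)‖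
      rw [norm_div, lt_div_iff₀ (norm_pos_iff.mpr hm)]
      exact mul_lt_of_lt_one_right (norm_pos_iff.mpr hpq) (norm_mul_lt_one (norm_mul_lt_one hc hd) he)
  have hg : ellGamma p q (-1) * ellGamma p q (-1) *
      (ellGamma p q (-1) * ellGamma p q (-1)⁻¹)⁻¹ = 1 := by
    have h1 : (-1 : ℂ)⁻¹ = -1 := by norm_num
    have hpq2 := norm_mul_lt_one hp hq
    have : ellGamma p q (-1) ≠ 0 := by
      refine div_ne_zero (pqPoch_ne_zero_of_norm_lt_one hp hq (by simpa using hpq2))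
        ?_
      rw [pqPoch_eq_mul_left _ hp hq, qPoch_eq_mul _ hq]
      exact mul_ne_zero (mul_ne_zero (by norm_num) (qPoch_ne_zero_of_norm_lt_one hq (by simpa)))
        (pqPoch_ne_zero_of_norm_lt_one hp hq (by simpa))
    rw [h1, mul_inv_cancel₀ (mul_ne_zero this this)]
  rw [hg] at hlim
  have hA : qPoch p p * qPoch q q ≠ 0 :=
    mul_ne_zero (qPoch_ne_zero_of_norm_lt_one hp hp) (qPoch_ne_zero_of_norm_lt_one hq hq)
  have hK2 : qPoch p p * qPoch q q / 2 * K = 1 := by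
    have : 4 * ((qPoch p p * qPoch q q)⁻¹) ^ 2 * 1 = K * (2 * (qPoch p p * qPoch q q)⁻¹) :=
      mul_right_cancel₀ hprod (by rw [hlim]; ring)
    have h2 : K * (qPoch p p * qPoch q q) = 2 := by
      generalize qPoch p p * qPoch q q = A at hA this
      field_simp at this
      linear_combination -this / 2
    linear_combination h2 / 2
  have hPa := hP a b ha hb hpab
  rw [hK, betaRatio, ← mul_div_assoc, div_eq_one_iff_eq hPa] at hK2
  exact hK2

theorem convex_setOf_forall_re_neg {n : ℕ} {ι : Type*} (g : (Fin n → ℂ) → ι → ℂ)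
    (hg : ∀ x y (a b : ℝ), a + b = 1 → ∀ i, g (a • x + b • y) i = a * g x i + b * g y i) :
    Convex ℝ {x | ∀ i, (g x i).re < 0} := by
  intro x hx y hy a b ha hb hab i
  have h1 := hx i
  have h2 := hy i
  rw [hg x y a b hab i, add_re, re_ofReal_mul, re_ofReal_mul]
  rcases eq_or_lt_of_le ha with rfl | ha
  · have : b = 1 := by linarith
    subst this; linarith
  · nlinarith [mul_pos_of_neg_of_neg h1 (neg_lt_zero.mpr ha), mul_nonneg hb (neg_nonneg.mpr h2.le)]

theorem isOpen_setOf_forall_re_neg {n : ℕ} {ι : Type*} [Finite ι] {g : (Fin n → ℂ) → ι → ℂ}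
    (hg : ∀ i, Continuous fun x => g x i) : IsOpen {x | ∀ i, (g x i).re < 0} := by
  simp only [Set.ofPred_forall]
  exact isOpen_iInter_of_finite fun i =>
    isOpen_lt (continuous_re.comp (hg i)) continuous_const

theorem norm_exp_lt_one {x : ℂ} (hx : x.re < 0) : ‖exp x‖ < 1 := by
  rw [norm_exp]; exact Real.exp_lt_one_iff.mpr hx

/-- Logarithms of six parameters with product `exp ℓ`. -/
noncomputable def logParamSix (ℓ : ℂ) (x : Fin 5 → ℂ) : Fin 6 → ℂ :=
  ![x 0, x 1, x 2, x 3, x 4, ℓ - (x 0 + x 1 + x 2 + x 3 + x 4)]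

/-- **Elliptic beta integral**: if `∏ tⱼ = p q` and `|tⱼ| < 1`, then the integral of
`∏ⱼ Γ(tⱼ z^{±1}) / Γ(z^{±2})` is `∏_{j < k} Γ(tⱼ tₖ)` up to a constant. -/
theorem ellBeta (hp0 : p ≠ 0) (hq0 : q ≠ 0) (hp : ‖p‖ < 1) (hq : ‖q‖ < 1) {t : Fin 6 → ℂ}
    (ht : ∀ j, ‖t j‖ < 1) (hprod : ∏ j, t j = p * q) :
    qPoch p p * qPoch q q / 2 * ellInt p q t = pairGamma p q t := by
  have hpq : p * q ≠ 0 := mul_ne_zero hp0 hq0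
  obtain ⟨ℓ, hℓ⟩ : ∃ ℓ, exp ℓ = p * q := ⟨log (p * q), exp_log hpq⟩
  have hℓre : ℓ.re < Real.log ‖p‖ := by
    rw [← Real.exp_lt_exp, ← norm_exp, hℓ, Real.exp_log (norm_pos_iff.mpr hp0), norm_mul]
    exact mul_lt_of_lt_one_right (norm_pos_iff.mpr hp0) hq
  have hlogp : Real.log ‖p‖ < 0 := Real.log_neg (norm_pos_iff.mpr hp0) hp
  set g := logParamSix ℓ with hg
  have hgc : ∀ j, Differentiable ℂ fun x => g x j := by
    intro j
    fin_cases j <;> simp only [hg, logParamSix] <;> simp <;> fun_prop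
  set T : (Fin 5 → ℂ) → Fin 6 → ℂ := fun x j => exp (g x j) with hT
  set S := {x | ∀ j, (g x j).re < 0} with hS
  have hSo : IsOpen S := isOpen_setOf_forall_re_neg fun j => (hgc j).continuous
  have hSc : Convex ℝ S := by
    refine convex_setOf_forall_re_neg g fun x y a b hab j => ?_
    have hab' : (a : ℂ) + b = 1 := by exact_mod_cast hab
    fin_cases j <;> simp [hg, logParamSix]
    linear_combination -ℓ * hab'
  have hT1 : ∀ x ∈ S, ∀ j, ‖T x j‖ < 1 := fun x hx j => norm_exp_lt_one (hx j)
  have hTd : ∀ γ : ℂ → Fin 5 → ℂ, Differentiable ℂ γ → ∀ (U : Set ℂ) j,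
      DifferentiableOn ℂ (fun x => T (γ x) j) U := fun γ hγ U j =>
    ((hgc j).comp hγ).cexp.differentiableOn
  have hTb : ∀ x, T x = betaParam p q (exp (x 0)) (exp (x 1)) (exp (x 2)) (exp (x 3)) (exp (x 4)) := by
    intro x
    ext j
    fin_cases j <;> simp [hT, hg, logParamSix, betaParam]
    rw [exp_sub, hℓ, exp_add, exp_add, exp_add, exp_add]
  -- a point near which the inequalities required by `ellBeta_of_norm_lt` hold
  let x₀ : Fin 5 → ℂ := fun _ => (Real.log ‖p‖ / 6 : ℝ)
  have hx₀ : x₀ ∈ S := by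
    intro j
    fin_cases j <;> simp [hg, logParamSix, x₀] <;> linarith
  have hAB : (fun x => qPoch p p * qPoch q q / 2 * ellInt p q (T x)) =ᶠ[𝓝 x₀]
      fun x => pairGamma p q (T x) := by
    have h1 : ∀ᶠ x : Fin 5 → ℂ in 𝓝 x₀, Real.log ‖p‖ < (x 1 + (x 2 + x 3 + x 4)).re := by
      refine ContinuousAt.eventually_lt (by fun_prop) (by fun_prop) ?_
      simp [x₀]; linarith
    filter_upwards [h1, hSo.mem_nhds hx₀] with x h1 hx
    have h2 : ‖p * q‖ < ‖exp (x 0) * (exp (x 1) * exp (x 2) * exp (x 3) * exp (x 4))‖ := by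
      rw [← exp_add, ← exp_add, ← exp_add, ← exp_add, ← hℓ, norm_exp, norm_exp, Real.exp_lt_exp]
      have := hx 5
      simp [hg, logParamSix] at this
      simp only [add_re]
      linarith
    have h3 : ‖p‖ < ‖exp (x 1) * (exp (x 2) * exp (x 3) * exp (x 4))‖ := by
      rw [← exp_add, ← exp_add, ← exp_add, norm_exp, ← Real.exp_log (norm_pos_iff.mpr hp0),
        Real.exp_lt_exp]
      exact h1
    rw [hTb]
    exact ellBeta_of_norm_lt hp0 hq0 hp hq (norm_exp_lt_one (hx 0)) (norm_exp_lt_one (hx 1))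
      (norm_exp_lt_one (hx 2)) (norm_exp_lt_one (hx 3)) (norm_exp_lt_one (hx 4)) h3 h2
  have ht0 : ∀ j, t j ≠ 0 := fun j h => by
    rw [Finset.prod_eq_zero (Finset.mem_univ j) h] at hprod
    exact hpq hprod.symm
  let y : Fin 5 → ℂ := ![log (t 0), log (t 1), log (t 2), log (t 3), log (t 4)]
  have hTy : T y = t := by
    rw [hTb]
    have e5 : p * q / (t 0 * t 1 * t 2 * t 3 * t 4) = t 5 := by
      rw [← hprod, Fin.prod_univ_six]
      have := ht0 0; have := ht0 1; have := ht0 2; have := ht0 3; have := ht0 4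
      field_simp
    ext j
    fin_cases j <;> simp [betaParam, y, exp_log, ht0, e5]
  have hy : y ∈ S := fun j => by
    have h := ht j
    rw [← hTy] at h
    simp only [hT, norm_exp] at h
    exact Real.exp_lt_one_iff.mp h
  have := eq_of_eventuallyEq_of_lines hSo hSc
    (A := fun x => qPoch p p * qPoch q q / 2 * ellInt p q (T x)) (B := fun x => pairGamma p q (T x))
    (fun U γ hU hγ hγS => (differentiableOn_ellInt hp hq hU (hTd γ hγ U)
      (fun x _ j => exp_ne_zero _) fun x hx => hT1 _ (hγS x hx)).const_mul _)
    (fun U γ hU hγ hγS => differentiableOn_pairGamma hp hq (hTd γ hγ U)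
      (fun x _ j => exp_ne_zero _) fun x hx => hT1 _ (hγS x hx)) hx₀ hAB hy
  simpa only [hTy] using this

end

section

/-! ### The elliptic hypergeometric function as a circle average -/

variable {p q : ℂ}

theorem vIntegrand_eq (hp : ‖p‖ < 1) (hq : ‖q‖ < 1) (t : Fin 8 → ℂ) {z : ℂ} (hz : ‖z‖ = 1) :
    vIntegrand p q t z = ellWeight p q t z * z⁻¹ := by
  have hz2 : ‖z ^ 2‖ = 1 := by rw [norm_pow, hz, one_pow]
  rw [vIntegrand, ellWeight, div_eq_mul_inv, inv_ellGamma_mul_inv hp hq hz2]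

theorem circleIntegrable_vIntegrand (hp : ‖p‖ < 1) (hq : ‖q‖ < 1) {t : Fin 8 → ℂ}
    (ht0 : ∀ j, t j ≠ 0) (ht1 : ∀ j, ‖t j‖ < 1) : CircleIntegrable (vIntegrand p q t) 0 1 := by
  refine ContinuousOn.circleIntegrable zero_le_one ?_
  have hz : ∀ z ∈ Metric.sphere (0 : ℂ) 1, z ≠ 0 := fun z hz h => by simp [h] at hz
  exact ((continuousOn_ellWeight_sphere hp hq ht0 ht1).mul (continuousOn_id.inv₀ hz)).congr
    fun z hz => vIntegrand_eq hp hq t (by simpa using hz)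

theorem V_eq_ellInt (hp : ‖p‖ < 1) (hq : ‖q‖ < 1) (t : Fin 8 → ℂ) :
    V p q t = qPoch p p * qPoch q q / 2 * ellInt p q t := by
  have h : (∮ z in C(0, 1), vIntegrand p q t z) =
      ∮ z in C(0, 1), (z - 0)⁻¹ • ellWeight p q t z :=
    circleIntegral.integral_congr zero_le_one fun z hz => by
      rw [vIntegrand_eq hp hq t (by simpa using hz), sub_zero, smul_eq_mul, mul_comm]
  rw [V, kappa, h, ellInt, Real.circleAverage_eq_circleIntegral one_ne_zero, smul_eq_mul]
  have := Real.pi_ne_zero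
  have := I_ne_zero
  field_simp
  ring

/-! ### The first transformation -/

theorem pairGamma_fin_four (t : Fin 4 → ℂ) : pairGamma p q t =
    (ellGamma p q (t 0 * t 1) * ellGamma p q (t 2 * t 3)) *
    (ellGamma p q (t 0 * t 2) * ellGamma p q (t 1 * t 3)) *
    (ellGamma p q (t 0 * t 3) * ellGamma p q (t 1 * t 2)) := by
  simp [pairGamma, Fin.prod_univ_succ, Fin.prod_Ioi_succ]
  ring

/-- Fubini's theorem for circle averages. -/
theorem circleAverage_comm {F : ℂ → ℂ → ℂ}
    (hF : ContinuousOn (fun x : ℂ × ℂ => F x.1 x.2)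
      (Metric.sphere (0 : ℂ) 1 ×ˢ Metric.sphere (0 : ℂ) 1)) :
    Real.circleAverage (fun w => Real.circleAverage (fun z => F z w) 0 1) 0 1 =
      Real.circleAverage (fun z => Real.circleAverage (fun w => F z w) 0 1) 0 1 := by
  have hc : Continuous fun x : ℝ × ℝ => F (circleMap 0 1 x.2) (circleMap 0 1 x.1) :=
    hF.comp_continuous (f := fun x : ℝ × ℝ => (circleMap 0 1 x.2, circleMap 0 1 x.1))
      (by fun_prop) fun x => ⟨by simp, by simp⟩
  simp only [Real.circleAverage_def, intervalIntegral.integral_smul]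
  congr 2
  refine MeasureTheory.intervalIntegral_intervalIntegral_swap ?_
  exact (hc.continuousOn.integrableOn_compact
    (isCompact_uIcc.prod isCompact_uIcc)).mono_set (prod_mono uIoc_subset_uIcc uIoc_subset_uIcc)

/-- The factors `Γ(c z^{±1} w^{±1})` coupling the two integrations in the proof of the first
transformation. -/
noncomputable def crossGamma (p q c z w : ℂ) : ℂ :=
  (ellGamma p q (c * w * z) * ellGamma p q (c * w * z⁻¹)) *
    (ellGamma p q (c * w⁻¹ * z) * ellGamma p q (c * w⁻¹ * z⁻¹))

theorem crossGamma_comm (c z w : ℂ) : crossGamma p q c z w = crossGamma p q c w z := by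
  simp only [crossGamma, mul_right_comm c]
  ring

theorem continuousOn_crossGamma (hp : ‖p‖ < 1) (hq : ‖q‖ < 1) {c : ℂ} (hc0 : c ≠ 0)
    (hc : ‖c‖ < 1) : ContinuousOn (fun x : ℂ × ℂ => crossGamma p q c x.1 x.2)
      (Metric.sphere (0 : ℂ) 1 ×ˢ Metric.sphere (0 : ℂ) 1) := by
  have h0 : ∀ x ∈ Metric.sphere (0 : ℂ) 1 ×ˢ Metric.sphere (0 : ℂ) 1, x.1 ≠ 0 ∧ x.2 ≠ 0 := by
    rintro ⟨z, w⟩ ⟨hz, hw⟩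
    exact ⟨fun h => by simp_all, fun h => by simp_all⟩
  have h1 : ∀ x ∈ Metric.sphere (0 : ℂ) 1 ×ˢ Metric.sphere (0 : ℂ) 1, ‖x.1‖ = 1 ∧ ‖x.2‖ = 1 := by
    rintro ⟨z, w⟩ ⟨hz, hw⟩
    exact ⟨by simpa using hz, by simpa using hw⟩
  have key : ∀ f g : ℂ × ℂ → ℂ,
      ContinuousOn f (Metric.sphere (0 : ℂ) 1 ×ˢ Metric.sphere (0 : ℂ) 1) →
      ContinuousOn g (Metric.sphere (0 : ℂ) 1 ×ˢ Metric.sphere (0 : ℂ) 1) →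
      (∀ x ∈ Metric.sphere (0 : ℂ) 1 ×ˢ Metric.sphere (0 : ℂ) 1, ‖f x‖ = 1) →
      (∀ x ∈ Metric.sphere (0 : ℂ) 1 ×ˢ Metric.sphere (0 : ℂ) 1, ‖g x‖ = 1) →
      ContinuousOn (fun x => ellGamma p q (c * f x * g x))
        (Metric.sphere (0 : ℂ) 1 ×ˢ Metric.sphere (0 : ℂ) 1) := by
    intro f g hf hg hf1 hg1 x hx
    refine ContinuousAt.comp_continuousWithinAt (f := fun x => c * f x * g x)
      (differentiableAt_ellGamma hp hq ?_ ?_).continuousAt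
      ((continuousWithinAt_const.mul (hf x hx)).mul (hg x hx))
    · exact mul_ne_zero (mul_ne_zero hc0 (norm_ne_zero_iff.mp (by simp [hf1 x hx])))
        (norm_ne_zero_iff.mp (by simp [hg1 x hx]))
    · simpa [hf1 x hx, hg1 x hx] using hc
  have c1 := continuousOn_fst (α := ℂ) (β := ℂ)
    (s := Metric.sphere (0 : ℂ) 1 ×ˢ Metric.sphere (0 : ℂ) 1)
  have c2 := continuousOn_snd (α := ℂ) (β := ℂ)
    (s := Metric.sphere (0 : ℂ) 1 ×ˢ Metric.sphere (0 : ℂ) 1)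
  have c3 := c1.inv₀ fun x hx => (h0 x hx).1
  have c4 := c2.inv₀ fun x hx => (h0 x hx).2
  have n1 := fun x hx => (h1 x hx).1
  have n2 := fun x hx => (h1 x hx).2
  have n3 : ∀ x ∈ Metric.sphere (0 : ℂ) 1 ×ˢ Metric.sphere (0 : ℂ) 1, ‖(x.1)⁻¹‖ = 1 :=
    fun x hx => by rw [norm_inv, n1 x hx, inv_one]
  have n4 : ∀ x ∈ Metric.sphere (0 : ℂ) 1 ×ˢ Metric.sphere (0 : ℂ) 1, ‖(x.2)⁻¹‖ = 1 :=
    fun x hx => by rw [norm_inv, n2 x hx, inv_one]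
  exact ((key _ _ c2 c1 n2 n1).mul (key _ _ c2 c3 n2 n3)).mul
    ((key _ _ c4 c1 n4 n1).mul (key _ _ c4 c3 n4 n3))

/-- One of the two integrations of the coupled double integral: the elliptic beta integral with
parameters `a₁, …, a₄, c w, c w⁻¹`. -/
theorem circleAverage_crossGamma (hp0 : p ≠ 0) (hq0 : q ≠ 0) (hp : ‖p‖ < 1) (hq : ‖q‖ < 1)
    {a : Fin 4 → ℂ} {c : ℂ} (b : Fin 4 → ℂ) (ha : ∀ j, ‖a j‖ < 1) (hc : ‖c‖ < 1)
    (h : c ^ 2 * ∏ j, a j = p * q) {w : ℂ} (hw : ‖w‖ = 1) :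
    qPoch p p * qPoch q q / 2 * Real.circleAverage (fun z =>
        ellWeight p q a z * ellWeight p q b w * crossGamma p q c z w) 0 1 =
      ellGamma p q (c ^ 2) * pairGamma p q a *
        ellWeight p q (Sum.elim (fun j => c * a j) b) w := by
  have hw0 : w ≠ 0 := norm_ne_zero_iff.mp (by simp [hw])
  let T : Fin 6 → ℂ := ![a 0, a 1, a 2, a 3, c * w, c * w⁻¹]
  have hT1 : ∀ j, ‖T j‖ < 1 := by
    intro j
    fin_cases j <;> simp [T, ha, hc, hw]
  have hT : ∏ j, T j = p * q := by
    rw [← h, Fin.prod_univ_six, Fin.prod_univ_four]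
    simp only [T, Matrix.cons_val]
    field_simp
  have e : (fun z => ellWeight p q a z * ellWeight p q b w * crossGamma p q c z w) =
      fun z => ellWeight p q T z * ellWeight p q b w := by
    ext z
    simp only [ellWeight, crossGamma, Fin.prod_univ_six, Fin.prod_univ_four, T, Matrix.cons_val]
    ring
  have e2 : c * w * (c * w⁻¹) = c ^ 2 := by field_simp
  rw [e, circleAverage_mul_const, ← mul_assoc]
  change qPoch p p * qPoch q q / 2 * ellInt p q T * _ = _
  rw [ellBeta hp0 hq0 hp hq hT1 hT, pairGamma_fin_six, pairGamma_fin_four]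
  simp only [T, Matrix.cons_val, e2, ellWeight, Fintype.prod_sum_type, Sum.elim_inl, Sum.elim_inr,
    Fin.prod_univ_four, mul_left_comm (a _) c, ← mul_assoc c]
  ring

/-- Fubini's theorem for the coupled double integral. -/
theorem pairGamma_mul_ellInt (hp0 : p ≠ 0) (hq0 : q ≠ 0) (hp : ‖p‖ < 1) (hq : ‖q‖ < 1)
    {a b : Fin 4 → ℂ} {c : ℂ} (ha : ∀ j, ‖a j‖ < 1) (hb : ∀ j, ‖b j‖ < 1) (hc : ‖c‖ < 1)
    (hca : c ^ 2 * ∏ j, a j = p * q) (hcb : c ^ 2 * ∏ j, b j = p * q) :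
    pairGamma p q a * ellInt p q (Sum.elim (fun j => c * a j) b) =
      pairGamma p q b * ellInt p q (Sum.elim a (fun j => c * b j)) := by
  have hpq : p * q ≠ 0 := mul_ne_zero hp0 hq0
  have hc0 : c ≠ 0 := by rintro rfl; exact hpq (by rw [← hca]; ring)
  have ha0 : ∀ j, a j ≠ 0 := fun j hj => hpq (by
    rw [← hca, Finset.prod_eq_zero (Finset.mem_univ j) hj, mul_zero])
  have hb0 : ∀ j, b j ≠ 0 := fun j hj => hpq (by
    rw [← hcb, Finset.prod_eq_zero (Finset.mem_univ j) hj, mul_zero])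
  have hA : qPoch p p * qPoch q q / 2 ≠ 0 := div_ne_zero
    (mul_ne_zero (qPoch_ne_zero_of_norm_lt_one hp hp) (qPoch_ne_zero_of_norm_lt_one hq hq))
    two_ne_zero
  have hΓ : ellGamma p q (c ^ 2) ≠ 0 := by
    refine ellGamma_ne_zero hp hq (by rw [sq]; exact norm_mul_lt_one hc hc) ?_
    rw [← hca, norm_mul, norm_prod]
    refine mul_lt_of_lt_one_right (norm_pos_iff.mpr (pow_ne_zero 2 hc0)) ?_
    calc ∏ j, ‖a j‖ < ∏ j : Fin 4, (1 : ℝ) := Finset.prod_lt_prod_of_nonempty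
          (fun j _ => norm_pos_iff.mpr (ha0 j)) (fun j _ => ha j) Finset.univ_nonempty
      _ = 1 := by simp
  have hF : ContinuousOn (fun x : ℂ × ℂ =>
      ellWeight p q a x.1 * ellWeight p q b x.2 * crossGamma p q c x.1 x.2)
      (Metric.sphere (0 : ℂ) 1 ×ˢ Metric.sphere (0 : ℂ) 1) :=
    (((continuousOn_ellWeight_sphere hp hq ha0 ha).comp continuousOn_fst fun x hx => hx.1).mul
      ((continuousOn_ellWeight_sphere hp hq hb0 hb).comp continuousOn_snd fun x hx => hx.2)).mul
      (continuousOn_crossGamma hp hq hc0 hc)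
  have hswap := circleAverage_comm
    (F := fun z w => ellWeight p q a z * ellWeight p q b w * crossGamma p q c z w) hF
  have h1 : ∀ (a b : Fin 4 → ℂ), (∀ j, ‖a j‖ < 1) → c ^ 2 * ∏ j, a j = p * q →
      qPoch p p * qPoch q q / 2 * Real.circleAverage (fun w => Real.circleAverage (fun z =>
        ellWeight p q a z * ellWeight p q b w * crossGamma p q c z w) 0 1) 0 1 =
      ellInt p q (Sum.elim (fun j => c * a j) b) * (ellGamma p q (c ^ 2) * pairGamma p q a) := by
    intro a b ha h
    rw [mul_comm, ← circleAverage_mul_const, ellInt, ← circleAverage_mul_const]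
    refine Real.circleAverage_congr_sphere fun w hw => ?_
    have := circleAverage_crossGamma hp0 hq0 hp hq b ha hc h (w := w) (by simpa using hw)
    linear_combination this
  have h2 := h1 b a hb hcb
  have e : (fun z w => ellWeight p q b z * ellWeight p q a w * crossGamma p q c z w) =
      fun z w => ellWeight p q a w * ellWeight p q b z * crossGamma p q c w z := by
    ext z w; rw [crossGamma_comm]; ring
  have e' := fun z w => congrFun₂ e z w
  simp only [e'] at h2
  rw [← hswap, h1 a b ha hca] at h2
  have h3 : ellInt p q (Sum.elim (fun j => c * b j) a) = ellInt p q (Sum.elim a fun j => c * b j) := by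
    rw [← ellInt_comp_equiv (Equiv.sumComm (Fin 4) (Fin 4))]
    congr 1
    ext (j | j) <;> rfl
  rw [h3] at h2
  refine mul_left_cancel₀ hΓ ?_
  linear_combination h2

/-- The reflection formula for all pairs of complementary pairs of indices. -/
theorem pairGamma_mul_pairGamma (hp0 : p ≠ 0) (hq0 : q ≠ 0) (hp : ‖p‖ < 1) (hq : ‖q‖ < 1)
    {a x : Fin 4 → ℂ} (ha : ∀ j, ‖a j‖ < 1) (hx : ∀ j, ‖x j‖ < 1) {c : ℂ}
    (hax : ∀ j, x j = c * a j) (h : c ^ 2 * ∏ j, a j = p * q) :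
    pairGamma p q a * pairGamma p q x = 1 := by
  rw [Fin.prod_univ_four] at h
  have key : ∀ i j k l, c ^ 2 * (a i * a j * a k * a l) = p * q →
      ellGamma p q (a i * a j) * ellGamma p q (x k * x l) = 1 := fun i j k l h =>
    ellGamma_mul_reflect hp hq hp0 hq0 (norm_mul_lt_one (ha i) (ha j))
      (norm_mul_lt_one (hx k) (hx l)) (by rw [← h, hax, hax]; ring)
  have k1 := key 0 1 2 3 (by linear_combination h)
  have k2 := key 2 3 0 1 (by linear_combination h)
  have k3 := key 0 2 1 3 (by linear_combination h)
  have k4 := key 1 3 0 2 (by linear_combination h)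
  have k5 := key 0 3 1 2 (by linear_combination h)
  have k6 := key 1 2 0 3 (by linear_combination h)
  rw [pairGamma_fin_four, pairGamma_fin_four]
  calc _ = (ellGamma p q (a 0 * a 1) * ellGamma p q (x 2 * x 3)) *
        (ellGamma p q (a 2 * a 3) * ellGamma p q (x 0 * x 1)) *
        ((ellGamma p q (a 0 * a 2) * ellGamma p q (x 1 * x 3)) *
        (ellGamma p q (a 1 * a 3) * ellGamma p q (x 0 * x 2))) *
        ((ellGamma p q (a 0 * a 3) * ellGamma p q (x 1 * x 2)) *
        (ellGamma p q (a 1 * a 2) * ellGamma p q (x 0 * x 3))) := by ring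
    _ = 1 := by rw [k1, k2, k3, k4, k5, k6]; norm_num

theorem ellInt_transform_of_norm_lt (hp0 : p ≠ 0) (hq0 : q ≠ 0) (hp : ‖p‖ < 1) (hq : ‖q‖ < 1)
    {x y : Fin 4 → ℂ} {ρ : ℂ} (hx : ∀ j, ‖x j‖ < 1) (hy : ∀ j, ‖y j‖ < 1)
    (hρx : ρ ^ 2 * (p * q) = ∏ j, x j) (hρy : ρ ^ 2 * ∏ j, y j = p * q)
    (hx' : ∀ j, ‖ρ⁻¹ * x j‖ < 1) (hρ : ‖ρ‖ < 1) :
    ellInt p q (Sum.elim x y) = pairGamma p q x * pairGamma p q y *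
      ellInt p q (Sum.elim (fun j => ρ⁻¹ * x j) fun j => ρ * y j) := by
  have hρ0 : ρ ≠ 0 := by
    rintro rfl
    exact mul_ne_zero hp0 hq0 (by rw [← hρy]; ring)
  have e : ∀ j, x j = ρ * (ρ⁻¹ * x j) := fun j => (mul_inv_cancel_left₀ hρ0 _).symm
  have hprod : ρ ^ 2 * ∏ j, ρ⁻¹ * x j = p * q := by
    rw [Finset.prod_mul_distrib, ← hρx]
    simp only [Finset.prod_const, Finset.card_univ, Fintype.card_fin]
    field_simp
  have h1 := pairGamma_mul_ellInt hp0 hq0 hp hq hx' hy hρ hprod hρy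
  have h2 := pairGamma_mul_pairGamma hp0 hq0 hp hq hx' hx e hprod
  simp only [mul_inv_cancel_left₀ hρ0] at h1
  linear_combination (-ellInt p q (Sum.elim x y)) * h2 + pairGamma p q x * h1

/-- The first transformation: `|ρ| > 1` reduces to `|ρ| < 1` by exchanging the halves, and the case
`|ρ| = 1` follows from `|ρ| < 1` by continuity. -/
theorem ellInt_transform (hp0 : p ≠ 0) (hq0 : q ≠ 0) (hp : ‖p‖ < 1) (hq : ‖q‖ < 1)
    {x y : Fin 4 → ℂ} {ρ : ℂ} (hx : ∀ j, ‖x j‖ < 1) (hy : ∀ j, ‖y j‖ < 1)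
    (hρx : ρ ^ 2 * (p * q) = ∏ j, x j) (hρy : ρ ^ 2 * ∏ j, y j = p * q)
    (hx' : ∀ j, ‖ρ⁻¹ * x j‖ < 1) (hy' : ∀ j, ‖ρ * y j‖ < 1) :
    ellInt p q (Sum.elim x y) = pairGamma p q x * pairGamma p q y *
      ellInt p q (Sum.elim (fun j => ρ⁻¹ * x j) fun j => ρ * y j) := by
  have hpq : p * q ≠ 0 := mul_ne_zero hp0 hq0
  have hρ0 : ρ ≠ 0 := by rintro rfl; exact hpq (by rw [← hρy]; ring)
  have hy0 : ∀ j, y j ≠ 0 := fun j hj => hpq (by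
    rw [← hρy, Finset.prod_eq_zero (Finset.mem_univ j) hj, mul_zero])
  have hx0 : ∀ j, x j ≠ 0 := fun j hj => mul_ne_zero (pow_ne_zero 2 hρ0) hpq (by
    rw [hρx, Finset.prod_eq_zero (Finset.mem_univ j) hj])
  have hcomm : ∀ x y : Fin 4 → ℂ, ellInt p q (Sum.elim x y) = ellInt p q (Sum.elim y x) := by
    intro x y
    rw [← ellInt_comp_equiv (Equiv.sumComm (Fin 4) (Fin 4))]
    congr 1
    ext (j | j) <;> rfl
  rcases lt_trichotomy ‖ρ‖ 1 with hρ | hρ | hρ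
  · exact ellInt_transform_of_norm_lt hp0 hq0 hp hq hx hy hρx hρy hx' hρ
  · -- perturb to `x e^{-r}`, `y e^r`, `ρ e^{-2r}` with `r > 0`
    let X : ℂ → Fin 4 → ℂ := fun r j => exp (-r) * x j
    let Y : ℂ → Fin 4 → ℂ := fun r j => exp r * y j
    let X' : ℂ → Fin 4 → ℂ := fun r j => exp r * (ρ⁻¹ * x j)
    let Y' : ℂ → Fin 4 → ℂ := fun r j => exp (-r) * (ρ * y j)
    have hnhds : ∀ (a : Fin 4 → ℂ) (f : ℂ → ℂ), Continuous f → f 0 = 1 → (∀ j, ‖a j‖ < 1) →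
        ∀ᶠ r in 𝓝 (0 : ℂ), ∀ j, ‖f r * a j‖ < 1 := by
      intro a f hf hf0 ha
      refine eventually_all.mpr fun j => ContinuousAt.eventually_lt (by fun_prop) (by fun_prop) ?_
      simpa [hf0] using ha j
    have hX := hnhds x (fun r => exp (-r)) (by fun_prop) (by simp) hx
    have hY := hnhds y (fun r => exp r) (by fun_prop) (by simp) hy
    have hX' := hnhds _ (fun r => exp r) (by fun_prop) (by simp) hx'
    have hY' := hnhds _ (fun r => exp (-r)) (by fun_prop) (by simp) hy'
    obtain ⟨U, hU, hUo, h0U⟩ := mem_nhds_iff.mp (hX.and (hY.and (hX'.and hY')))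
    have dX : ∀ j, DifferentiableOn ℂ (fun r => X r j) U := fun j => by
      simp only [X]; fun_prop
    have dY : ∀ j, DifferentiableOn ℂ (fun r => Y r j) U := fun j => by
      simp only [Y]; fun_prop
    have dX' : ∀ j, DifferentiableOn ℂ (fun r => X' r j) U := fun j => by
      simp only [X']; fun_prop
    have dY' : ∀ j, DifferentiableOn ℂ (fun r => Y' r j) U := fun j => by
      simp only [Y']; fun_prop
    have dI : ∀ A B : ℂ → Fin 4 → ℂ, (∀ j, DifferentiableOn ℂ (fun r => A r j) U) →
        (∀ j, DifferentiableOn ℂ (fun r => B r j) U) → (∀ r ∈ U, ∀ j, A r j ≠ 0) →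
        (∀ r ∈ U, ∀ j, B r j ≠ 0) → (∀ r ∈ U, ∀ j, ‖A r j‖ < 1) → (∀ r ∈ U, ∀ j, ‖B r j‖ < 1) →
        DifferentiableOn ℂ (fun r => ellInt p q (Sum.elim (A r) (B r))) U := by
      intro A B dA dB a0 b0 a1 b1
      refine differentiableOn_ellInt hp hq hUo ?_ ?_ ?_
      · rintro (j | j)
        exacts [dA j, dB j]
      · rintro r hr (j | j)
        exacts [a0 r hr j, b0 r hr j]
      · rintro r hr (j | j)
        exacts [a1 r hr j, b1 r hr j]
    have hL := dI X Y dX dY (fun r _ j => mul_ne_zero (exp_ne_zero _) (hx0 j))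
      (fun r _ j => mul_ne_zero (exp_ne_zero _) (hy0 j)) (fun r hr => (hU hr).1)
      (fun r hr => (hU hr).2.1)
    have hR := ((differentiableOn_pairGamma hp hq dX
      (fun r _ j => mul_ne_zero (exp_ne_zero _) (hx0 j)) (fun r hr => (hU hr).1)).mul
      (differentiableOn_pairGamma hp hq dY
      (fun r _ j => mul_ne_zero (exp_ne_zero _) (hy0 j)) (fun r hr => (hU hr).2.1))).mul
      (dI X' Y' dX' dY' (fun r _ j => mul_ne_zero (exp_ne_zero _)
        (mul_ne_zero (inv_ne_zero hρ0) (hx0 j))) (fun r _ j => mul_ne_zero (exp_ne_zero _)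
        (mul_ne_zero hρ0 (hy0 j))) (fun r hr => (hU hr).2.2.1) (fun r hr => (hU hr).2.2.2))
    have hUn := hUo.mem_nhds h0U
    have hr0 : Tendsto (fun r : ℝ => (r : ℂ)) (𝓝[>] 0) (𝓝 0) :=
      (continuous_ofReal.tendsto' 0 0 ofReal_zero).mono_left nhdsWithin_le_nhds
    have hev : ∀ᶠ r : ℝ in 𝓝[>] 0, ellInt p q (Sum.elim (X r) (Y r)) =
        pairGamma p q (X r) * pairGamma p q (Y r) * ellInt p q (Sum.elim (X' r) (Y' r)) := by
      filter_upwards [hr0.eventually hUn, self_mem_nhdsWithin] with r hr hr0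
      have hr0 : 0 < r := hr0
      obtain ⟨u1, u2, u3, u4⟩ := hU hr
      have hE : exp (-(r : ℂ)) ≠ 0 := exp_ne_zero _
      have hE' : exp (r : ℂ) = (exp (-(r : ℂ)))⁻¹ := by rw [exp_neg, inv_inv]
      have hEn : ‖exp (-(r : ℂ))‖ < 1 := norm_exp_lt_one (by simpa using hr0)
      have e1 : X' r = fun j => (exp (-(r : ℂ)) ^ 2 * ρ)⁻¹ * X r j := by
        ext j; simp only [X', X, hE']; field_simp
      have e2 : Y' r = fun j => (exp (-(r : ℂ)) ^ 2 * ρ) * Y r j := by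
        ext j; simp only [Y', Y, hE']; field_simp
      rw [e1, e2]
      refine ellInt_transform_of_norm_lt hp0 hq0 hp hq u1 u2 ?_ ?_ ?_ ?_
      · simp only [X, Finset.prod_mul_distrib, ← hρx, Finset.prod_const, Finset.card_univ,
          Fintype.card_fin]
        ring
      · simp only [Y, Finset.prod_mul_distrib, ← hρy, Finset.prod_const, Finset.card_univ,
          Fintype.card_fin, hE']
        field_simp
      · intro j
        have := congrFun e1 j
        exact this ▸ u3 j
      · rw [norm_mul, hρ, mul_one, norm_pow]
        exact pow_lt_one₀ (norm_nonneg _) hEn two_ne_zero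
    have := tendsto_nhds_unique_of_eventuallyEq
      ((hL.continuousOn.continuousAt hUn).tendsto.comp hr0)
      ((hR.continuousOn.continuousAt hUn).tendsto.comp hr0) hev
    simpa [X, Y, X', Y'] using this
  · have hρi : ‖ρ⁻¹‖ < 1 := by rw [norm_inv]; exact inv_lt_one_of_one_lt₀ hρ
    have := ellInt_transform_of_norm_lt (ρ := ρ⁻¹) hp0 hq0 hp hq hy hx
      (by rw [← hρy]; field_simp) (by rw [← hρx]; field_simp) (by simpa using hy') hρi
    rw [hcomm x y, this, hcomm, inv_inv]
    ring

end

section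

/-! ### The second and third transformations near a base point -/

variable {p q : ℂ}

theorem ellInt_congr {ι κ : Type*} [Fintype ι] [Fintype κ] {t : ι → ℂ} {s : κ → ℂ}
    (h : ∀ f : ℂ → ℂ, ∏ j, f (t j) = ∏ j, f (s j)) : ellInt p q t = ellInt p q s := by
  rw [ellInt, ellInt]
  congr 1
  ext z
  rw [ellWeight, ellWeight, h fun x => ellGamma p q (x * z) * ellGamma p q (x * z⁻¹)]

/-- The prefactor `∏_{j, k} Γ(tⱼ tₖ₊₄)` of the second transformation. -/
noncomputable def mixedGamma (p q : ℂ) (t : Fin 8 → ℂ) : ℂ :=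
  ∏ j : Fin 4, ∏ k : Fin 4, ellGamma p q (t (Fin.castAdd 4 j) * t (Fin.natAdd 4 k))

theorem mixedGamma_eq (t : Fin 8 → ℂ) : mixedGamma p q t =
    (ellGamma p q (t 0 * t 4) * ellGamma p q (t 0 * t 5) * ellGamma p q (t 0 * t 6) *
      ellGamma p q (t 0 * t 7)) *
    (ellGamma p q (t 1 * t 4) * ellGamma p q (t 1 * t 5) * ellGamma p q (t 1 * t 6) *
      ellGamma p q (t 1 * t 7)) *
    (ellGamma p q (t 2 * t 4) * ellGamma p q (t 2 * t 5) * ellGamma p q (t 2 * t 6) *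
      ellGamma p q (t 2 * t 7)) *
    (ellGamma p q (t 3 * t 4) * ellGamma p q (t 3 * t 5) * ellGamma p q (t 3 * t 6) *
      ellGamma p q (t 3 * t 7)) := by
  simp only [mixedGamma, Fin.prod_univ_four]
  rfl

theorem pairGamma_fin_eight (t : Fin 8 → ℂ) : pairGamma p q t =
    mixedGamma p q t * pairGamma p q ![t 0, t 1, t 2, t 3] * pairGamma p q ![t 4, t 5, t 6, t 7] := by
  rw [mixedGamma_eq, pairGamma_fin_four, pairGamma_fin_four]
  simp [pairGamma, Fin.prod_univ_succ, Fin.prod_Ioi_succ]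
  ring

/-- The first transformation for the splitting of the parameters into the first and last four. -/
theorem ellInt_transform_fin_eight (hp0 : p ≠ 0) (hq0 : q ≠ 0) (hp : ‖p‖ < 1) (hq : ‖q‖ < 1)
    {t : Fin 8 → ℂ} (ht : ∀ j, ‖t j‖ < 1) (hbal : ∏ j, t j = p ^ 2 * q ^ 2) {ρ : ℂ}
    (hρ : ρ ^ 2 * (p * q) = t 0 * t 1 * t 2 * t 3) {s : Fin 8 → ℂ}
    (hs : s = ![ρ⁻¹ * t 0, ρ⁻¹ * t 1, ρ⁻¹ * t 2, ρ⁻¹ * t 3, ρ * t 4, ρ * t 5, ρ * t 6, ρ * t 7])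
    (hs1 : ∀ j, ‖s j‖ < 1) :
    ellInt p q t = pairGamma p q ![t 0, t 1, t 2, t 3] * pairGamma p q ![t 4, t 5, t 6, t 7] *
      ellInt p q s := by
  have hpq : p * q ≠ 0 := mul_ne_zero hp0 hq0
  have e1 : ellInt p q t = ellInt p q (Sum.elim ![t 0, t 1, t 2, t 3] ![t 4, t 5, t 6, t 7]) :=
    ellInt_congr fun f => by
      simp [Fin.prod_univ_eight, Fintype.prod_sum_type, Fin.prod_univ_four]; ring
  have e2 : ellInt p q s = ellInt p q (Sum.elim (fun j => ρ⁻¹ * (![t 0, t 1, t 2, t 3] : Fin 4 → ℂ) j)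
      fun j => ρ * (![t 4, t 5, t 6, t 7] : Fin 4 → ℂ) j) :=
    ellInt_congr fun f => by
      simp [hs, Fin.prod_univ_eight, Fintype.prod_sum_type, Fin.prod_univ_four]; ring
  rw [e1, e2]
  rw [Fin.prod_univ_eight] at hbal
  refine ellInt_transform hp0 hq0 hp hq ?_ ?_ ?_ ?_ ?_ ?_
  · intro j; fin_cases j <;> exact ht _
  · intro j; fin_cases j <;> exact ht _
  · rw [hρ, Fin.prod_univ_four]; rfl
  · rw [Fin.prod_univ_four]
    refine mul_right_cancel₀ hpq ?_
    simp only [Matrix.cons_val]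
    linear_combination hbal + t 4 * t 5 * t 6 * t 7 * hρ
  · intro j
    fin_cases j
    exacts [by simpa [hs] using hs1 0, by simpa [hs] using hs1 1, by simpa [hs] using hs1 2,
      by simpa [hs] using hs1 3]
  · intro j
    fin_cases j
    exacts [by simpa [hs] using hs1 4, by simpa [hs] using hs1 5, by simpa [hs] using hs1 6,
      by simpa [hs] using hs1 7]

/-- The second transformation, as the composition of two instances of the first one, for the
splittings `{1, 2, 5, 6}, {3, 4, 7, 8}` and `{1, 2, 7, 8}, {3, 4, 5, 6}`. The parameters `s` in
between have to be smaller than `1` in modulus. -/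
theorem ellInt_transform_mixed (hp0 : p ≠ 0) (hq0 : q ≠ 0) (hp : ‖p‖ < 1) (hq : ‖q‖ < 1)
    {t : Fin 8 → ℂ} (ht : ∀ j, ‖t j‖ < 1) (hbal : ∏ j, t j = p ^ 2 * q ^ 2) {τ υ ρ : ℂ}
    (hτ : τ ^ 2 = t 0 * t 1 * t 2 * t 3) (hτυ : τ * υ = p * q)
    (hρ : ρ ^ 2 * (p * q) = t 0 * t 1 * t 4 * t 5) {s u : Fin 8 → ℂ}
    (hs : s = ![ρ⁻¹ * t 0, ρ⁻¹ * t 1, ρ * t 2, ρ * t 3, ρ⁻¹ * t 4, ρ⁻¹ * t 5, ρ * t 6, ρ * t 7])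
    (hs1 : ∀ j, ‖s j‖ < 1)
    (hu : u = ![τ / t 0, τ / t 1, τ / t 2, τ / t 3, υ / t 4, υ / t 5, υ / t 6, υ / t 7])
    (hu1 : ∀ j, ‖u j‖ < 1) :
    ellInt p q t = mixedGamma p q t * ellInt p q u := by
  have hpq : p * q ≠ 0 := mul_ne_zero hp0 hq0
  have ht0 : ∀ j, t j ≠ 0 := fun j hj => mul_ne_zero (pow_ne_zero 2 hp0) (pow_ne_zero 2 hq0) (by
    rw [← hbal, Finset.prod_eq_zero (Finset.mem_univ j) hj])
  rw [Fin.prod_univ_eight] at hbal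
  have hτ0 : τ ≠ 0 := left_ne_zero_of_mul (hτυ ▸ hpq)
  have hυ0 : υ ≠ 0 := right_ne_zero_of_mul (hτυ ▸ hpq)
  have hρ0 : ρ ≠ 0 := by
    rintro rfl
    exact mul_ne_zero (mul_ne_zero (mul_ne_zero (ht0 0) (ht0 1)) (ht0 4)) (ht0 5) (by rw [← hρ]; ring)
  have hυ : υ ^ 2 = t 4 * t 5 * t 6 * t 7 := by
    refine mul_left_cancel₀ (pow_ne_zero 2 hτ0) ?_
    linear_combination (τ * υ + p * q) * hτυ - hbal - t 4 * t 5 * t 6 * t 7 * hτ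
  have h0 := ht0 0
  have h1 := ht0 1
  have h2 := ht0 2
  have h3 := ht0 3
  have h4 := ht0 4
  have h5 := ht0 5
  have h6 := ht0 6
  have h7 := ht0 7
  -- the parameter of the second step
  set ρ' : ℂ := t 0 * t 1 / (τ * ρ) with hρ'
  have hρ'0 : ρ' ≠ 0 := div_ne_zero (mul_ne_zero h0 h1) (mul_ne_zero hτ0 hρ0)
  have hρ2 : ρ ^ 2 = t 0 * t 1 * t 4 * t 5 / (p * q) := by rw [← hρ]; field_simp
  have p67 : t 6 * t 7 = υ ^ 2 / (t 4 * t 5) := by rw [hυ]; field_simp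
  have p23 : t 2 * t 3 = τ ^ 2 / (t 0 * t 1) := by rw [hτ]; field_simp
  -- the first step
  have T1 := ellInt_transform_fin_eight hp0 hq0 hp hq
    (t := ![t 0, t 1, t 4, t 5, t 2, t 3, t 6, t 7]) (ρ := ρ)
    (s := ![s 0, s 1, s 4, s 5, s 2, s 3, s 6, s 7])
    (fun j => by fin_cases j <;> exact ht _)
    (by rw [Fin.prod_univ_eight]; simp only [Matrix.cons_val]; linear_combination hbal)
    (by simp only [Matrix.cons_val]; exact hρ)
    (by simp [hs])
    (fun j => by fin_cases j <;> exact hs1 _)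
  -- the second step
  have T2 := ellInt_transform_fin_eight hp0 hq0 hp hq
    (t := ![s 0, s 1, s 6, s 7, s 2, s 3, s 4, s 5]) (ρ := ρ')
    (s := ![u 1, u 0, u 7, u 6, u 3, u 2, u 5, u 4])
    (fun j => by fin_cases j <;> exact hs1 _)
    (by
      rw [Fin.prod_univ_eight]
      simp only [Matrix.cons_val, hs]
      field_simp
      linear_combination hbal)
    (by
      simp only [Matrix.cons_val, hs]
      rw [show ρ⁻¹ * t 0 * (ρ⁻¹ * t 1) * (ρ * t 6) * (ρ * t 7) = t 0 * t 1 * (t 6 * t 7) by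
        field_simp, p67, hρ', div_pow, mul_pow τ, hρ2, ← hτυ]
      field_simp)
    (by
      have k1 : (ρ' * ρ)⁻¹ = τ / (t 0 * t 1) := by rw [hρ']; field_simp
      have k2 : ρ' * ρ = t 0 * t 1 / τ := by rw [hρ']; field_simp
      have k3 : ρ' * ρ⁻¹ = υ / (t 4 * t 5) := by
        rw [hρ', show t 0 * t 1 / (τ * ρ) * ρ⁻¹ = t 0 * t 1 / (τ * ρ ^ 2) by field_simp, hρ2, ← hτυ]
        field_simp
      have k4 : ρ'⁻¹ * ρ = t 4 * t 5 / υ := by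
        rw [show ρ'⁻¹ * ρ = (ρ' * ρ⁻¹)⁻¹ by field_simp, k3, inv_div]
      have k5 : ρ'⁻¹ * ρ⁻¹ = τ / (t 0 * t 1) := by rw [← mul_inv, k1]
      have k6 : t 3 = τ ^ 2 / (t 0 * t 1) / t 2 := by rw [← p23]; field_simp
      have k7 : t 7 = υ ^ 2 / (t 4 * t 5) / t 6 := by rw [← p67]; field_simp
      simp only [hs, hu, Matrix.cons_val, ← mul_assoc, k2, k3, k4, k5]
      rw [k6, k7]
      congr 1
      · field_simp
      congr 1
      · field_simp
      congr 1
      · field_simp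
      congr 1
      · field_simp
      congr 1
      · field_simp
      congr 1
      · field_simp
      congr 1
      · field_simp
      congr 1
      field_simp)
    (fun j => by fin_cases j <;> exact hu1 _)
  have c1 : ellInt p q ![t 0, t 1, t 4, t 5, t 2, t 3, t 6, t 7] = ellInt p q t :=
    ellInt_congr fun f => by simp only [Fin.prod_univ_eight, Matrix.cons_val]; ring
  have c2 : ellInt p q ![s 0, s 1, s 4, s 5, s 2, s 3, s 6, s 7] =
      ellInt p q ![s 0, s 1, s 6, s 7, s 2, s 3, s 4, s 5] :=
    ellInt_congr fun f => by simp only [Fin.prod_univ_eight, Matrix.cons_val]; ring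
  have c3 : ellInt p q ![u 1, u 0, u 7, u 6, u 3, u 2, u 5, u 4] = ellInt p q u :=
    ellInt_congr fun f => by simp only [Fin.prod_univ_eight, Matrix.cons_val]; ring
  rw [c1, c2, T2, c3] at T1
  rw [T1, mixedGamma_eq]
  simp only [pairGamma_fin_four, Matrix.cons_val]
  have r : ∀ i j k l : Fin 8, t i * t j * (s k * s l) = p * q →
      ellGamma p q (t i * t j) * ellGamma p q (s k * s l) = 1 := fun i j k l h =>
    ellGamma_mul_reflect hp hq hp0 hq0 (norm_mul_lt_one (ht i) (ht j))
      (norm_mul_lt_one (hs1 k) (hs1 l)) h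
  have r1 := r 4 5 0 1 (by simp only [hs, Matrix.cons_val]; field_simp; linear_combination -hρ)
  have r2 := r 0 1 4 5 (by simp only [hs, Matrix.cons_val]; field_simp; linear_combination -hρ)
  have hbal' : t 2 * t 3 * t 6 * t 7 * ρ ^ 2 = p * q := by
    refine mul_right_cancel₀ hpq ?_
    linear_combination hbal + t 2 * t 3 * t 6 * t 7 * hρ
  have r3 := r 2 3 6 7 (by simp only [hs, Matrix.cons_val]; linear_combination hbal')
  have r4 := r 6 7 2 3 (by simp only [hs, Matrix.cons_val]; linear_combination hbal')
  have m1 : s 0 * s 6 = t 0 * t 6 := by simp only [hs, Matrix.cons_val]; field_simp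
  have m2 : s 0 * s 7 = t 0 * t 7 := by simp only [hs, Matrix.cons_val]; field_simp
  have m3 : s 1 * s 6 = t 1 * t 6 := by simp only [hs, Matrix.cons_val]; field_simp
  have m4 : s 1 * s 7 = t 1 * t 7 := by simp only [hs, Matrix.cons_val]; field_simp
  have m5 : s 2 * s 4 = t 2 * t 4 := by simp only [hs, Matrix.cons_val]; field_simp
  have m6 : s 2 * s 5 = t 2 * t 5 := by simp only [hs, Matrix.cons_val]; field_simp
  have m7 : s 3 * s 4 = t 3 * t 4 := by simp only [hs, Matrix.cons_val]; field_simp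
  have m8 : s 3 * s 5 = t 3 * t 5 := by simp only [hs, Matrix.cons_val]; field_simp
  rw [m1, m2, m3, m4, m5, m6, m7, m8]
  generalize hG : ellGamma p q = G at *
  calc _ = (G (t 4 * t 5) * G (s 0 * s 1)) * (G (t 0 * t 1) * G (s 4 * s 5)) *
        ((G (t 2 * t 3) * G (s 6 * s 7)) * (G (t 6 * t 7) * G (s 2 * s 3))) *
        ((G (t 0 * t 4) * G (t 0 * t 5) * G (t 0 * t 6) * G (t 0 * t 7)) *
        (G (t 1 * t 4) * G (t 1 * t 5) * G (t 1 * t 6) * G (t 1 * t 7)) *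
        (G (t 2 * t 4) * G (t 2 * t 5) * G (t 2 * t 6) * G (t 2 * t 7)) *
        (G (t 3 * t 4) * G (t 3 * t 5) * G (t 3 * t 6) * G (t 3 * t 7)) * ellInt p q u) := by ring
    _ = _ := by rw [r1, r2, r3, r4]; ring

/-- The third transformation, as the composition of the second and the first one. -/
theorem ellInt_transform_all (hp0 : p ≠ 0) (hq0 : q ≠ 0) (hp : ‖p‖ < 1) (hq : ‖q‖ < 1)
    {t : Fin 8 → ℂ} (ht : ∀ j, ‖t j‖ < 1) (hbal : ∏ j, t j = p ^ 2 * q ^ 2) {τ υ σ ρ : ℂ}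
    (hτ : τ ^ 2 = t 0 * t 1 * t 2 * t 3) (hτυ : τ * υ = p * q) (hσ : σ ^ 2 = p * q)
    (hρ : ρ ^ 2 * (p * q) = t 0 * t 1 * t 4 * t 5) {s u : Fin 8 → ℂ}
    (hs : s = ![ρ⁻¹ * t 0, ρ⁻¹ * t 1, ρ * t 2, ρ * t 3, ρ⁻¹ * t 4, ρ⁻¹ * t 5, ρ * t 6, ρ * t 7])
    (hs1 : ∀ j, ‖s j‖ < 1)
    (hu : u = ![τ / t 0, τ / t 1, τ / t 2, τ / t 3, υ / t 4, υ / t 5, υ / t 6, υ / t 7])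
    (hu1 : ∀ j, ‖u j‖ < 1) (hv1 : ∀ j, ‖σ / t j‖ < 1) :
    ellInt p q t = pairGamma p q t * ellInt p q (fun j => σ / t j) := by
  have hpq : p * q ≠ 0 := mul_ne_zero hp0 hq0
  have h1 := ellInt_transform_mixed hp0 hq0 hp hq ht hbal hτ hτυ hρ hs hs1 hu hu1
  have ht0 : ∀ j, t j ≠ 0 := fun j hj => mul_ne_zero (pow_ne_zero 2 hp0) (pow_ne_zero 2 hq0) (by
    rw [← hbal, Finset.prod_eq_zero (Finset.mem_univ j) hj])
  rw [Fin.prod_univ_eight] at hbal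
  have hτ0 : τ ≠ 0 := left_ne_zero_of_mul (hτυ ▸ hpq)
  have hυ0 : υ ≠ 0 := right_ne_zero_of_mul (hτυ ▸ hpq)
  have hσ0 : σ ≠ 0 := by rintro rfl; exact hpq (by rw [← hσ]; ring)
  have hυ : υ ^ 2 = t 4 * t 5 * t 6 * t 7 := by
    refine mul_left_cancel₀ (pow_ne_zero 2 hτ0) ?_
    linear_combination (τ * υ + p * q) * hτυ - hbal - t 4 * t 5 * t 6 * t 7 * hτ
  have h0 := ht0 0
  have h1' := ht0 1
  have h2 := ht0 2
  have h3 := ht0 3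
  have h4 := ht0 4
  have h5 := ht0 5
  have h6 := ht0 6
  have h7 := ht0 7
  have hυτ : υ = σ ^ 2 / τ := by rw [hσ, ← hτυ]; field_simp
  have eτ : u 0 * u 1 * u 2 * u 3 = τ ^ 2 := by
    simp only [hu, Matrix.cons_val]
    rw [show τ / t 0 * (τ / t 1) * (τ / t 2) * (τ / t 3) = τ ^ 2 * τ ^ 2 / (t 0 * t 1 * t 2 * t 3) by
      field_simp, ← hτ]
    field_simp
  have eυ : u 4 * u 5 * u 6 * u 7 = υ ^ 2 := by
    simp only [hu, Matrix.cons_val]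
    rw [show υ / t 4 * (υ / t 5) * (υ / t 6) * (υ / t 7) = υ ^ 2 * υ ^ 2 / (t 4 * t 5 * t 6 * t 7) by
      field_simp, ← hυ]
    field_simp
  have T := ellInt_transform_fin_eight hp0 hq0 hp hq (ρ := τ / σ) (s := fun j => σ / t j) hu1
    (by
      rw [Fin.prod_univ_eight]
      linear_combination u 4 * u 5 * u 6 * u 7 * eτ + τ ^ 2 * eυ + (τ * υ + p * q) * hτυ)
    (by rw [eτ, ← hσ]; field_simp)
    (by
      ext j
      fin_cases j <;> simp only [hu, hυτ, Matrix.cons_val] <;> simp <;> field_simp)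
    hv1
  have sτ : ∀ i j k l, t i * t j * (t k * t l) = τ ^ 2 → τ / t i * (τ / t j) = t k * t l := by
    intro i j k l h
    have hi := ht0 i
    have hj := ht0 j
    rw [div_mul_div_comm, div_eq_iff (mul_ne_zero hi hj)]
    linear_combination -h
  have sυ : ∀ i j k l, t i * t j * (t k * t l) = υ ^ 2 → υ / t i * (υ / t j) = t k * t l := by
    intro i j k l h
    have hi := ht0 i
    have hj := ht0 j
    rw [div_mul_div_comm, div_eq_iff (mul_ne_zero hi hj)]
    linear_combination -h
  have e1 : pairGamma p q ![u 0, u 1, u 2, u 3] = pairGamma p q ![t 0, t 1, t 2, t 3] := by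
    simp only [pairGamma_fin_four, hu, Matrix.cons_val]
    rw [sτ 0 1 2 3 (by linear_combination -hτ), sτ 2 3 0 1 (by linear_combination -hτ),
      sτ 0 2 1 3 (by linear_combination -hτ), sτ 1 3 0 2 (by linear_combination -hτ),
      sτ 0 3 1 2 (by linear_combination -hτ), sτ 1 2 0 3 (by linear_combination -hτ)]
    ring
  have e2 : pairGamma p q ![u 4, u 5, u 6, u 7] = pairGamma p q ![t 4, t 5, t 6, t 7] := by
    simp only [pairGamma_fin_four, hu, Matrix.cons_val]
    rw [sυ 4 5 6 7 (by linear_combination -hυ), sυ 6 7 4 5 (by linear_combination -hυ),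
      sυ 4 6 5 7 (by linear_combination -hυ), sυ 5 7 4 6 (by linear_combination -hυ),
      sυ 4 7 5 6 (by linear_combination -hυ), sυ 5 6 4 7 (by linear_combination -hυ)]
    ring
  rw [h1, T, e1, e2, pairGamma_fin_eight]
  ring

end

section

/-! ### Analytic continuation in the logarithms of the parameters -/

variable {p q : ℂ}

/-- An identity between two of the integrals, whose parameters are exponentials of affine functions
`g` and `h`, extends from a neighbourhood of one point to all points at which both integrals are
defined. -/
theorem ellInt_eq_of_eventually {n : ℕ} (hp : ‖p‖ < 1) (hq : ‖q‖ < 1)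
    {g h : (Fin n → ℂ) → Fin 8 → ℂ} (hgd : ∀ j, Differentiable ℂ fun x => g x j)
    (hhd : ∀ j, Differentiable ℂ fun x => h x j)
    (hga : ∀ x y (a b : ℝ), a + b = 1 → ∀ i, g (a • x + b • y) i = a * g x i + b * g y i)
    (hha : ∀ x y (a b : ℝ), a + b = 1 → ∀ i, h (a • x + b • y) i = a * h x i + b * h y i)
    {C : (Fin 8 → ℂ) → ℂ}
    (hC : ∀ (U : Set ℂ) (t : ℂ → Fin 8 → ℂ), (∀ j, DifferentiableOn ℂ (fun x => t x j) U) →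
      (∀ x ∈ U, ∀ j, t x j ≠ 0) → (∀ x ∈ U, ∀ j, ‖t x j‖ < 1) →
      DifferentiableOn ℂ (fun x => C (t x)) U)
    {x₀ : Fin n → ℂ} (hg₀ : ∀ j, (g x₀ j).re < 0) (hh₀ : ∀ j, (h x₀ j).re < 0)
    (hev : ∀ᶠ x in 𝓝 x₀, (∀ j, (g x j).re < 0) → (∀ j, (h x j).re < 0) →
      ellInt p q (fun j => exp (g x j)) =
        C (fun j => exp (g x j)) * ellInt p q (fun j => exp (h x j)))
    {y : Fin n → ℂ} (hg : ∀ j, (g y j).re < 0) (hh : ∀ j, (h y j).re < 0) :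
    ellInt p q (fun j => exp (g y j)) =
      C (fun j => exp (g y j)) * ellInt p q (fun j => exp (h y j)) := by
  have hSo := (isOpen_setOf_forall_re_neg fun j => (hgd j).continuous).inter
    (isOpen_setOf_forall_re_neg fun j => (hhd j).continuous)
  have hSc := (convex_setOf_forall_re_neg g hga).inter (convex_setOf_forall_re_neg h hha)
  have hd : ∀ {g : (Fin n → ℂ) → Fin 8 → ℂ}, (∀ j, Differentiable ℂ fun x => g x j) →
      ∀ (U : Set ℂ) (γ : ℂ → Fin n → ℂ), Differentiable ℂ γ →
      ∀ j, DifferentiableOn ℂ (fun x => exp (g (γ x) j)) U := fun hgd U γ hγ j =>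
    ((hgd j).comp hγ).cexp.differentiableOn
  refine eq_of_eventuallyEq_of_lines hSo hSc
    (A := fun x => ellInt p q (fun j => exp (g x j)))
    (B := fun x => C (fun j => exp (g x j)) * ellInt p q (fun j => exp (h x j)))
    (fun U γ hU hγ hγS => differentiableOn_ellInt hp hq hU (hd hgd U γ hγ)
      (fun _ _ _ => exp_ne_zero _) fun x hx j => norm_exp_lt_one ((hγS x hx).1 j))
    (fun U γ hU hγ hγS => (hC U _ (hd hgd U γ hγ)
      (fun _ _ _ => exp_ne_zero _) fun x hx j => norm_exp_lt_one ((hγS x hx).1 j)).mul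
      (differentiableOn_ellInt hp hq hU (hd hhd U γ hγ)
      (fun _ _ _ => exp_ne_zero _) fun x hx j => norm_exp_lt_one ((hγS x hx).2 j)))
    (x₀ := x₀) ⟨hg₀, hh₀⟩ ?_ (y := y) ⟨hg, hh⟩
  filter_upwards [hev, hSo.mem_nhds ⟨hg₀, hh₀⟩] with x hx hxS using hx hxS.1 hxS.2

/-- Logarithms of eight parameters with product `exp (2 ℓ)`. -/
noncomputable def logParam (ℓ : ℂ) (x : Fin 7 → ℂ) : Fin 8 → ℂ :=
  ![x 0, x 1, x 2, x 3, x 4, x 5, x 6, 2 * ℓ - (x 0 + x 1 + x 2 + x 3 + x 4 + x 5 + x 6)]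

/-- The logarithm of the square root `τ` of the product of the first four parameters. -/
noncomputable def logTau (x : Fin 7 → ℂ) : ℂ := (x 0 + x 1 + x 2 + x 3) / 2

/-- Logarithms of the parameters on the right-hand side of the second transformation. -/
noncomputable def logMixed (ℓ : ℂ) (x : Fin 7 → ℂ) : Fin 8 → ℂ :=
  ![logTau x - x 0, logTau x - x 1, logTau x - x 2, logTau x - x 3,
    ℓ - logTau x - x 4, ℓ - logTau x - x 5, ℓ - logTau x - x 6,
    ℓ - logTau x - (2 * ℓ - (x 0 + x 1 + x 2 + x 3 + x 4 + x 5 + x 6))]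

/-- The logarithm of the parameter `ρ` in the first of the two steps leading to the second
transformation. -/
noncomputable def logRho (ℓ : ℂ) (x : Fin 7 → ℂ) : ℂ := (x 0 + x 1 + x 4 + x 5 - ℓ) / 2

/-- Logarithms of the parameters between the two steps leading to the second transformation. -/
noncomputable def logStep (ℓ : ℂ) (x : Fin 7 → ℂ) : Fin 8 → ℂ :=
  ![-logRho ℓ x + x 0, -logRho ℓ x + x 1, logRho ℓ x + x 2, logRho ℓ x + x 3,
    -logRho ℓ x + x 4, -logRho ℓ x + x 5, logRho ℓ x + x 6,
    logRho ℓ x + (2 * ℓ - (x 0 + x 1 + x 2 + x 3 + x 4 + x 5 + x 6))]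

theorem differentiable_logParam (ℓ : ℂ) (j : Fin 8) : Differentiable ℂ fun x => logParam ℓ x j := by
  fin_cases j <;> simp only [logParam] <;> simp <;> fun_prop

theorem differentiable_logMixed (ℓ : ℂ) (j : Fin 8) : Differentiable ℂ fun x => logMixed ℓ x j := by
  fin_cases j <;> simp only [logMixed, logTau] <;> simp <;> fun_prop

theorem differentiable_logStep (ℓ : ℂ) (j : Fin 8) : Differentiable ℂ fun x => logStep ℓ x j := by
  fin_cases j <;> simp only [logStep, logRho] <;> simp <;> fun_prop

theorem logParam_affine (ℓ : ℂ) (x y : Fin 7 → ℂ) (a b : ℝ) (h : a + b = 1) (j : Fin 8) :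
    logParam ℓ (a • x + b • y) j = a * logParam ℓ x j + b * logParam ℓ y j := by
  obtain rfl : b = 1 - a := by linarith
  fin_cases j <;> simp [logParam]
  ring

theorem logMixed_affine (ℓ : ℂ) (x y : Fin 7 → ℂ) (a b : ℝ) (h : a + b = 1) (j : Fin 8) :
    logMixed ℓ (a • x + b • y) j = a * logMixed ℓ x j + b * logMixed ℓ y j := by
  obtain rfl : b = 1 - a := by linarith
  fin_cases j <;> simp [logMixed, logTau] <;> ring

/-- The base point of the continuation: all logarithms involved are equal to `ℓ / 4` there. -/
theorem logParam_const (ℓ : ℂ) (j : Fin 8) : logParam ℓ (fun _ => ℓ / 4) j = ℓ / 4 := by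
  fin_cases j <;> simp [logParam]
  ring

theorem logMixed_const (ℓ : ℂ) (j : Fin 8) : logMixed ℓ (fun _ => ℓ / 4) j = ℓ / 4 := by
  fin_cases j <;> simp [logMixed, logTau] <;> ring

theorem logStep_const (ℓ : ℂ) (j : Fin 8) : logStep ℓ (fun _ => ℓ / 4) j = ℓ / 4 := by
  fin_cases j <;> simp [logStep, logRho] <;> ring

theorem prod_exp_logParam {ℓ : ℂ} (hℓ : exp ℓ = p * q) (x : Fin 7 → ℂ) :
    ∏ j, exp (logParam ℓ x j) = p ^ 2 * q ^ 2 := by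
  rw [← mul_pow, ← hℓ, ← exp_nat_mul, ← exp_sum, Fin.sum_univ_eight]
  simp only [logParam, Matrix.cons_val]
  congr 1
  push_cast
  ring

theorem exp_logTau_sq (ℓ : ℂ) (x : Fin 7 → ℂ) : exp (logTau x) ^ 2 =
    exp (logParam ℓ x 0) * exp (logParam ℓ x 1) * exp (logParam ℓ x 2) * exp (logParam ℓ x 3) := by
  rw [← exp_nat_mul, ← exp_add, ← exp_add, ← exp_add]
  simp only [logParam, logTau, Matrix.cons_val]
  congr 1
  push_cast
  ring

theorem exp_logRho_sq {ℓ : ℂ} (hℓ : exp ℓ = p * q) (x : Fin 7 → ℂ) :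
    exp (logRho ℓ x) ^ 2 * (p * q) =
    exp (logParam ℓ x 0) * exp (logParam ℓ x 1) * exp (logParam ℓ x 4) * exp (logParam ℓ x 5) := by
  rw [← exp_nat_mul, ← hℓ, ← exp_add, ← exp_add, ← exp_add, ← exp_add]
  simp only [logParam, logRho, Matrix.cons_val]
  congr 1
  push_cast
  ring

theorem exp_logStep (ℓ : ℂ) (x : Fin 7 → ℂ) (t : Fin 8 → ℂ) (ρ : ℂ) (hρ : ρ = exp (logRho ℓ x))
    (ht : t = fun j => exp (logParam ℓ x j)) : (fun j => exp (logStep ℓ x j)) =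
    ![ρ⁻¹ * t 0, ρ⁻¹ * t 1, ρ * t 2, ρ * t 3, ρ⁻¹ * t 4, ρ⁻¹ * t 5, ρ * t 6, ρ * t 7] := by
  subst hρ ht
  ext j
  fin_cases j <;> simp [logStep, logParam, exp_add, exp_neg]

theorem exp_logMixed (ℓ : ℂ) (x : Fin 7 → ℂ) (t : Fin 8 → ℂ) (τ υ : ℂ) (hτ : τ = exp (logTau x))
    (hυ : υ = exp (ℓ - logTau x)) (ht : t = fun j => exp (logParam ℓ x j)) :
    (fun j => exp (logMixed ℓ x j)) =
    ![τ / t 0, τ / t 1, τ / t 2, τ / t 3, υ / t 4, υ / t 5, υ / t 6, υ / t 7] := by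
  subst hτ hυ ht
  ext j
  fin_cases j <;> simp [logMixed, logParam, exp_sub]

/-- All admissible parameters have logarithms of the form `logParam`. -/
theorem exists_logParam {t : Fin 8 → ℂ} (ht0 : ∀ j, t j ≠ 0) {ℓ : ℂ} (hℓ : exp ℓ = p * q)
    (hbal : ∏ j, t j = p ^ 2 * q ^ 2) : ∃ y : Fin 7 → ℂ, ∀ j, exp (logParam ℓ y j) = t j := by
  have h7 : exp (2 * ℓ) = t 0 * t 1 * t 2 * t 3 * t 4 * t 5 * t 6 * t 7 := by
    rw [← Fin.prod_univ_eight, hbal, ← mul_pow, ← hℓ, ← exp_nat_mul]; norm_num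
  refine ⟨![log (t 0), log (t 1), log (t 2), log (t 3), log (t 4), log (t 5), log (t 6)],
    fun j => ?_⟩
  fin_cases j <;> simp [logParam, exp_log, ht0]
  rw [exp_sub, h7]
  simp only [exp_add, exp_log (ht0 _)]
  have := ht0 0; have := ht0 1; have := ht0 2; have := ht0 3; have := ht0 4; have := ht0 5
  have := ht0 6
  field_simp

theorem re_neg_of_norm_exp_lt_one {x : ℂ} (h : ‖exp x‖ < 1) : x.re < 0 := by
  rw [norm_exp] at h; exact Real.exp_lt_one_iff.mp h

theorem eventually_norm_exp_logStep {ℓ : ℂ} (hℓ : ℓ.re < 0) :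
    ∀ᶠ x in 𝓝 (fun _ => ℓ / 4 : Fin 7 → ℂ), ∀ j, ‖exp (logStep ℓ x j)‖ < 1 := by
  have h := (isOpen_setOf_forall_re_neg fun j => (differentiable_logStep ℓ j).continuous).mem_nhds
    (x := fun _ => ℓ / 4) fun j => by rw [logStep_const]; simp; linarith
  filter_upwards [h] with x hx j using norm_exp_lt_one (hx j)

theorem eventually_norm_exp_logMixed {ℓ : ℂ} (hℓ : ℓ.re < 0) :
    ∀ᶠ x in 𝓝 (fun _ => ℓ / 4 : Fin 7 → ℂ), ∀ j, ‖exp (logMixed ℓ x j)‖ < 1 := by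
  have h := (isOpen_setOf_forall_re_neg fun j => (differentiable_logMixed ℓ j).continuous).mem_nhds
    (x := fun _ => ℓ / 4) fun j => by rw [logMixed_const]; simp; linarith
  filter_upwards [h] with x hx j using norm_exp_lt_one (hx j)

theorem differentiableOn_mixedGamma (hp : ‖p‖ < 1) (hq : ‖q‖ < 1) {t : ℂ → Fin 8 → ℂ} {U : Set ℂ}
    (ht : ∀ j, DifferentiableOn ℂ (fun x => t x j) U)
    (ht0 : ∀ x ∈ U, ∀ j, t x j ≠ 0) (ht1 : ∀ x ∈ U, ∀ j, ‖t x j‖ < 1) :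
    DifferentiableOn ℂ (fun x => mixedGamma p q (t x)) U :=
  DifferentiableOn.fun_finsetProd fun _ _ => DifferentiableOn.fun_finsetProd fun _ _ =>
    differentiableOn_ellGamma_comp hp hq ((ht _).mul (ht _))
      (fun x hx => mul_ne_zero (ht0 x hx _) (ht0 x hx _))
      (fun x hx => norm_mul_lt_one (ht1 x hx _) (ht1 x hx _))

theorem exists_exp_eq_mul (hp0 : p ≠ 0) (hq0 : q ≠ 0) (hp : ‖p‖ < 1) (hq : ‖q‖ < 1) :
    ∃ ℓ : ℂ, exp ℓ = p * q ∧ ℓ.re < 0 := by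
  have h := exp_log (mul_ne_zero hp0 hq0)
  exact ⟨_, h, re_neg_of_norm_exp_lt_one (by rw [h]; exact norm_mul_lt_one hp hq)⟩

/-- The second transformation, for all parameters for which both sides are defined. -/
theorem ellInt_eq_mixedGamma_mul (hp0 : p ≠ 0) (hq0 : q ≠ 0) (hp : ‖p‖ < 1) (hq : ‖q‖ < 1)
    {t : Fin 8 → ℂ} (ht : ∀ j, ‖t j‖ < 1) (hbal : ∏ j, t j = p ^ 2 * q ^ 2) {τ υ : ℂ}
    (hτ : τ ^ 2 = t 0 * t 1 * t 2 * t 3) (hτυ : τ * υ = p * q) {u : Fin 8 → ℂ}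
    (hu : u = ![τ / t 0, τ / t 1, τ / t 2, τ / t 3, υ / t 4, υ / t 5, υ / t 6, υ / t 7])
    (hu1 : ∀ j, ‖u j‖ < 1) : ellInt p q t = mixedGamma p q t * ellInt p q u := by
  have hpq : p * q ≠ 0 := mul_ne_zero hp0 hq0
  have ht0 : ∀ j, t j ≠ 0 := fun j hj => mul_ne_zero (pow_ne_zero 2 hp0) (pow_ne_zero 2 hq0) (by
    rw [← hbal, Finset.prod_eq_zero (Finset.mem_univ j) hj])
  obtain ⟨ℓ, hℓ, hℓre⟩ := exists_exp_eq_mul hp0 hq0 hp hq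
  obtain ⟨y, hy⟩ := exists_logParam ht0 hℓ hbal
  have hyt : t = fun j => exp (logParam ℓ y j) := funext fun j => (hy j).symm
  have hexp : ∀ x : ℂ, exp x * exp (ℓ - x) = p * q := fun x => by
    rw [← exp_add, add_sub_cancel, hℓ]
  -- the square root of the product of the first four parameters is determined up to sign
  have hmix : (fun j => exp (logMixed ℓ y j)) = u ∨ (fun j => exp (logMixed ℓ y j)) = fun j => -u j := by
    rw [exp_logMixed ℓ y t _ _ rfl rfl hyt]
    have hτ2 : exp (logTau y) ^ 2 = τ ^ 2 := by
      rw [exp_logTau_sq ℓ, hτ, hy, hy, hy, hy]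
    have hτ0 : τ ≠ 0 := left_ne_zero_of_mul (hτυ ▸ hpq)
    have h2 := hexp (logTau y)
    rw [← hτυ] at h2
    rcases sq_eq_sq_iff_eq_or_eq_neg.mp hτ2 with h | h
    · left
      rw [h] at h2
      rw [h, mul_left_cancel₀ hτ0 h2, hu]
    · right
      rw [h, neg_mul, ← mul_neg] at h2
      have h3 : exp (ℓ - logTau y) = -υ := by rw [← mul_left_cancel₀ hτ0 h2, neg_neg]
      rw [h, h3, hu]
      ext j
      fin_cases j <;> simp [neg_div]
  have hmain := ellInt_eq_of_eventually hp hq (g := logParam ℓ) (h := logMixed ℓ)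
    (differentiable_logParam ℓ) (differentiable_logMixed ℓ) (logParam_affine ℓ) (logMixed_affine ℓ)
    (C := mixedGamma p q) (fun U t h h0 h1 => differentiableOn_mixedGamma hp hq h h0 h1)
    (x₀ := fun _ => ℓ / 4)
    (fun j => by rw [logParam_const]; simp; linarith)
    (fun j => by rw [logMixed_const]; simp; linarith)
    (by
      filter_upwards [eventually_norm_exp_logStep hℓre] with x hs hg hh
      exact ellInt_transform_mixed hp0 hq0 hp hq (fun j => norm_exp_lt_one (hg j))
        (prod_exp_logParam hℓ x) (exp_logTau_sq ℓ x) (hexp _) (exp_logRho_sq hℓ x)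
        (exp_logStep ℓ x _ _ rfl rfl) hs (exp_logMixed ℓ x _ _ _ rfl rfl rfl)
        fun j => norm_exp_lt_one (hh j))
    (y := y) (fun j => re_neg_of_norm_exp_lt_one (by rw [hy]; exact ht j))
    (fun j => re_neg_of_norm_exp_lt_one (by
      rcases hmix with h | h
      · exact (congrFun h j) ▸ hu1 j
      · rw [congrFun h j, norm_neg]; exact hu1 j))
  rw [← hyt] at hmain
  rcases hmix with h | h
  · rwa [h] at hmain
  · rwa [h, ellInt_neg] at hmain

/-- The third transformation, for all parameters for which both sides are defined. -/
theorem ellInt_eq_pairGamma_mul (hp0 : p ≠ 0) (hq0 : q ≠ 0) (hp : ‖p‖ < 1) (hq : ‖q‖ < 1)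
    {t : Fin 8 → ℂ} (ht : ∀ j, ‖t j‖ < 1) (hbal : ∏ j, t j = p ^ 2 * q ^ 2) {σ : ℂ}
    (hσ : σ ^ 2 = p * q) (hσt : ∀ j, ‖σ / t j‖ < 1) :
    ellInt p q t = pairGamma p q t * ellInt p q (fun j => σ / t j) := by
  have ht0 : ∀ j, t j ≠ 0 := fun j hj => mul_ne_zero (pow_ne_zero 2 hp0) (pow_ne_zero 2 hq0) (by
    rw [← hbal, Finset.prod_eq_zero (Finset.mem_univ j) hj])
  obtain ⟨ℓ, hℓ, hℓre⟩ := exists_exp_eq_mul hp0 hq0 hp hq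
  obtain ⟨y, hy⟩ := exists_logParam ht0 hℓ hbal
  have hyt : t = fun j => exp (logParam ℓ y j) := funext fun j => (hy j).symm
  have hexp : ∀ x : ℂ, exp x * exp (ℓ - x) = p * q := fun x => by
    rw [← exp_add, add_sub_cancel, hℓ]
  have hhalf : exp (ℓ / 2) ^ 2 = p * q := by
    rw [← exp_nat_mul, ← hℓ]; congr 1; push_cast; ring
  have hsub : ∀ x, (fun j => exp (ℓ / 2 - logParam ℓ x j)) =
      fun j => exp (ℓ / 2) / exp (logParam ℓ x j) := fun x => funext fun j => exp_sub _ _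
  have hall : (fun j => exp (ℓ / 2 - logParam ℓ y j)) = (fun j => σ / t j) ∨
      (fun j => exp (ℓ / 2 - logParam ℓ y j)) = fun j => -(σ / t j) := by
    rw [hsub]
    simp only [hy]
    rcases sq_eq_sq_iff_eq_or_eq_neg.mp (hhalf.trans hσ.symm) with h | h
    · left; rw [h]
    · right; simp only [h, neg_div]
  have hmain := ellInt_eq_of_eventually hp hq (g := logParam ℓ)
    (h := fun x j => ℓ / 2 - logParam ℓ x j)
    (differentiable_logParam ℓ) (fun j => (differentiable_logParam ℓ j).const_sub _)
    (logParam_affine ℓ)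
    (fun x y a b hab j => by
      have hab' : (a : ℂ) + b = 1 := by exact_mod_cast hab
      rw [logParam_affine ℓ x y a b hab]
      linear_combination (-ℓ / 2) * hab')
    (C := pairGamma p q) (fun U t h h0 h1 => differentiableOn_pairGamma hp hq h h0 h1)
    (x₀ := fun _ => ℓ / 4)
    (fun j => by rw [logParam_const]; simp; linarith)
    (fun j => by
      rw [logParam_const, show ℓ / 2 - ℓ / 4 = ℓ / 4 by ring]; simp; linarith)
    (by
      filter_upwards [eventually_norm_exp_logStep hℓre, eventually_norm_exp_logMixed hℓre]
        with x hs hu hg hh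
      rw [hsub]
      exact ellInt_transform_all hp0 hq0 hp hq (fun j => norm_exp_lt_one (hg j))
        (prod_exp_logParam hℓ x) (exp_logTau_sq ℓ x) (hexp _) hhalf (exp_logRho_sq hℓ x)
        (exp_logStep ℓ x _ _ rfl rfl) hs (exp_logMixed ℓ x _ _ _ rfl rfl rfl) hu
        fun j => by rw [← exp_sub]; exact norm_exp_lt_one (hh j))
    (y := y) (fun j => re_neg_of_norm_exp_lt_one (by rw [hy]; exact ht j))
    (fun j => re_neg_of_norm_exp_lt_one (by
      rcases hall with h | h
      · exact (congrFun h j) ▸ hσt j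
      · rw [congrFun h j, norm_neg]; exact hσt j))
  rw [← hyt] at hmain
  rcases hall with h | h
  · rwa [h] at hmain
  · rwa [h, ellInt_neg] at hmain

end

end EllipticV

theorem mainTheorem4 (p q : ℂ) (hp0 : p ≠ 0) (hq0 : q ≠ 0) (hp : ‖p‖ < 1) (hq : ‖q‖ < 1)
    (t : Fin 8 → ℂ) (ht : ∀ j, ‖t j‖ < 1) (hbal : ∏ j, t j = p ^ 2 * q ^ 2) :
    CircleIntegrable (EllipticV.vIntegrand p q t) 0 1 ∧
    -- the first transformation, for either choice of the square root `ρ`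
    (∀ (ρ : ℂ) (s : Fin 8 → ℂ),
      ρ ^ 2 = t 0 * t 1 * t 2 * t 3 / (p * q) →
      (∀ j : Fin 8, s j = if (j : ℕ) < 4 then ρ⁻¹ * t j else ρ * t j) →
      (∀ j, ‖s j‖ < 1) →
      EllipticV.V p q t =
        (∏ j : Fin 4, ∏ k ∈ Finset.Ioi j,
          EllipticV.ellGamma p q (t (Fin.castAdd 4 j) * t (Fin.castAdd 4 k)) *
            EllipticV.ellGamma p q (t (Fin.natAdd 4 j) * t (Fin.natAdd 4 k))) *
          EllipticV.V p q s) ∧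
    -- the second transformation, with `τ = T^{1/2}`, `υ = U^{1/2}` and `τ υ = p q`
    (∀ τ υ : ℂ,
      τ ^ 2 = t 0 * t 1 * t 2 * t 3 →
      υ ^ 2 = t 4 * t 5 * t 6 * t 7 →
      τ * υ = p * q →
      (∀ j : Fin 4, ‖τ‖ < ‖t (Fin.castAdd 4 j)‖) →
      (∀ j : Fin 4, ‖υ‖ < ‖t (Fin.natAdd 4 j)‖) →
      EllipticV.V p q t =
        (∏ j : Fin 4, ∏ k : Fin 4,
          EllipticV.ellGamma p q (t (Fin.castAdd 4 j) * t (Fin.natAdd 4 k))) *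
          EllipticV.V p q (fun j : Fin 8 => if (j : ℕ) < 4 then τ / t j else υ / t j)) ∧
    -- the third transformation, for either choice of the square root `σ` of `p q`
    (∀ σ : ℂ,
      σ ^ 2 = p * q →
      (∀ j, ‖σ‖ < ‖t j‖) →
      EllipticV.V p q t =
        (∏ j : Fin 8, ∏ k ∈ Finset.Ioi j, EllipticV.ellGamma p q (t j * t k)) *
          EllipticV.V p q (fun j : Fin 8 => σ / t j)) := by
  have hpq : p * q ≠ 0 := mul_ne_zero hp0 hq0
  have ht0 : ∀ j, t j ≠ 0 := fun j hj => mul_ne_zero (pow_ne_zero 2 hp0) (pow_ne_zero 2 hq0) (by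
    rw [← hbal, Finset.prod_eq_zero (Finset.mem_univ j) hj])
  refine ⟨EllipticV.circleIntegrable_vIntegrand hp hq ht0 ht, ?_, ?_, ?_⟩
  · intro ρ s hρ hs hs1
    have hprod : (∏ j : Fin 4, ∏ k ∈ Finset.Ioi j,
          EllipticV.ellGamma p q (t (Fin.castAdd 4 j) * t (Fin.castAdd 4 k)) *
            EllipticV.ellGamma p q (t (Fin.natAdd 4 j) * t (Fin.natAdd 4 k))) =
        EllipticV.pairGamma p q ![t 0, t 1, t 2, t 3] *
          EllipticV.pairGamma p q ![t 4, t 5, t 6, t 7] := by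
      have h1 : (![t 0, t 1, t 2, t 3] : Fin 4 → ℂ) = fun j => t (Fin.castAdd 4 j) := by
        ext j; fin_cases j <;> rfl
      have h2 : (![t 4, t 5, t 6, t 7] : Fin 4 → ℂ) = fun j => t (Fin.natAdd 4 j) := by
        ext j; fin_cases j <;> rfl
      simp only [h1, h2, EllipticV.pairGamma, Finset.prod_mul_distrib]
    rw [EllipticV.V_eq_ellInt hp hq, EllipticV.V_eq_ellInt hp hq, hprod,
      EllipticV.ellInt_transform_fin_eight hp0 hq0 hp hq ht hbal
        (by rw [hρ, div_mul_cancel₀ _ hpq]) (s := s) ?_ hs1]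
    · ring
    · ext j
      rw [hs]
      fin_cases j <;> simp
  · intro τ υ hτ _ hτυ hτ1 hυ1
    rw [EllipticV.V_eq_ellInt hp hq, EllipticV.V_eq_ellInt hp hq,
      EllipticV.ellInt_eq_mixedGamma_mul hp0 hq0 hp hq ht hbal hτ hτυ
        (u := fun j : Fin 8 => if (j : ℕ) < 4 then τ / t j else υ / t j) ?_ ?_]
    · rw [EllipticV.mixedGamma]; ring
    · ext j
      fin_cases j <;> simp
    · have h1 : ∀ {x y : ℂ}, ‖x‖ < ‖y‖ → ‖x / y‖ < 1 := fun {x y} h => by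
        rw [norm_div]; exact (div_lt_one ((norm_nonneg _).trans_lt h)).mpr h
      intro j
      fin_cases j
      exacts [h1 (hτ1 0), h1 (hτ1 1), h1 (hτ1 2), h1 (hτ1 3), h1 (hυ1 0), h1 (hυ1 1), h1 (hυ1 2),
        h1 (hυ1 3)]
  · intro σ hσ hσ1
    rw [EllipticV.V_eq_ellInt hp hq, EllipticV.V_eq_ellInt hp hq,
      EllipticV.ellInt_eq_pairGamma_mul hp0 hq0 hp hq ht hbal hσ fun j => by
        rw [norm_div]; exact (div_lt_one ((norm_nonneg _).trans_lt (hσ1 j))).mpr (hσ1 j)]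
    rw [EllipticV.pairGamma]; ring
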